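/- Let $T\in(0,\infty)$, let $m\ge 2$ be an integer, $H_T=[0,T]\times\mathbb R^d$, and let $\Lambda_1\subset\mathbb R^d\setminus\{0\}$ be a finite set, $|\Lambda_1|^2=\sum_{\lambda\in\Lambda_1}|\lambda|^2$. For an integer $k\ge0$, $\mathfrak B^k=\mathfrak B^k_T$ denotes the set of bounded Borel functions $\psi(t,x)$ on $H_T$ that are continuous in $x$ for each $t\in[0,T]$ and whose generalized derivatives $D^\alpha\psi(t,x)$ in $x$, $|\alpha|\le k$, are bounded functions on $H_T$; put $$\|\psi\|_k^2=\sup_{H_T}\sum_{|\alpha|\le k}|D^\alpha\psi|^2,\qquad |D^k\psi|^2=\sum_{|\alpha|=k}|D^\alpha\psi|^2$$ (suprema of generalized derivatives are over $t\in[0,T]$ and essential in $x$). The same notation is used for functions independent of $t$. Let $q_\lambda,p_\lambda$ ($\lambda\in\Lambda_1$), $c$, $f$ and $g$ be real functions in $\mathfrak B^m$, with $g=g(x)$ independent of $t$ and $q_\lambda\ge0$, such that for some constants $M_0,\dots,M_m$ and all $k=0,\dots,m$ $$\sup_{H_T}\Big(\sum_{\lambda\in\Lambda_1}\big(|D^kq_\lambda|^2+|D^kp_\lambda|^2\big)+|D^kc|^2\Big)\le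 M_k^2 .$$ Put $$\mathcal L=\tfrac12\sum_{\lambda\in\Lambda_1}\sum_{i,j=1}^d q_\lambda\lambda_i\lambda_jD_iD_j+\sum_{\lambda\in\Lambda_1}\sum_{i=1}^d p_\lambda\lambda_iD_i-c .$$ A solution of $\partial_tu=\mathcal Lu+f$ on $(0,T]\times\mathbb R^d$, $u(0,\cdot)=g$, is a bounded continuous function $u$ on $H_T$ that belongs to $\mathfrak B^2$ and satisfies, for all $t\in[0,T]$ and $\phi\in C_0^\infty(\mathbb R^d)$, $$\int_{\mathbb R^d}\phi\,u(t,x)\,dx=\int_{\mathbb R^d}\phi\, g\,dx+\int_0^t\int_{\mathbb R^d}\phi\,(\mathcal Lu+f)(s,x)\,dx\,ds .$$ Then there is exactly one solution $u$. Moreover, $u\in\mathfrak B^m$ and $$\|u\|_m\le N\big(\|f\|_m+\|g\|_m\big),$$ where $N$ is a constant depending only on $d$, $m$, $|\Lambda_1|$, $M_0,\dots,M_m$ and $T$. -/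

import Mathlib

open MeasureTheory Set
open scoped ContDiff

noncomputable section

namespace DegenerateParabolic

/-- The space `ℝ^d` with its Euclidean norm and Lebesgue measure. -/
abbrev Space (d : ℕ) : Type := EuclideanSpace ℝ (Fin d)

variable {d : ℕ}

/-- The classical partial derivative `D_i η`. -/
def partialDeriv (i : Fin d) (η : Space d → ℝ) : Space d → ℝ :=
  fun x => fderiv ℝ η x (EuclideanSpace.single i 1)

/-- The classical derivative `D^α η = D_1^{α_1} ... D_d^{α_d} η` for a multi-index `α`
(only used for smooth `η`). -/
def multiDeriv (α : Fin d → ℕ) (η : Space d → ℝ) : Space d → ℝ :=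
  (List.finRange d).foldr (fun i ψ => (partialDeriv i)^[α i] ψ) η

/-- The order `|α|` of a multi-index. -/
def order (α : Fin d → ℕ) : ℕ := ∑ i, α i

/-- The test functions `C_0^∞(ℝ^d)`. -/
def IsTest (η : Space d → ℝ) : Prop := ContDiff ℝ ∞ η ∧ HasCompactSupport η

/-- `w` is the generalized derivative `D^α φ` on `ℝ^d`, as a locally integrable function. -/
def IsWeakDeriv (α : Fin d → ℕ) (φ w : Space d → ℝ) : Prop :=
  LocallyIntegrable φ ∧ LocallyIntegrable w ∧
    ∀ η : Space d → ℝ, IsTest η →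
      ∫ x, φ x * multiDeriv α η x = (-1) ^ order α * ∫ x, w x * η x

open Classical in
/-- A representative of the generalized derivative `D^α φ`; it is unique up to equality almost
everywhere when it exists as a locally integrable function (and is set to `0` otherwise). -/
def weakDeriv (α : Fin d → ℕ) (φ : Space d → ℝ) : Space d → ℝ :=
  if h : ∃ w, IsWeakDeriv α φ w then h.choose else 0

/-- The multi-index of the first order derivative `D_i`. -/
def idx (i : Fin d) : Fin d → ℕ := Pi.single i 1

/-- `|D^k φ|^2`, the sum of `|D^α φ|^2` over all multi-indices of order `k`. -/
def sqDeriv (k : ℕ) (φ : Space d → ℝ) (x : Space d) : ℝ :=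
  ∑ α ∈ Finset.piAntidiag (Finset.univ : Finset (Fin d)) k, (weakDeriv α φ x) ^ 2

/-- The class `𝔅^m_T`: bounded Borel functions `ψ(t,x)` on `[0,T] × ℝ^d`, continuous in `x` for
each `t`, whose generalized derivatives in `x` up to order `m` are bounded on `[0,T] × ℝ^d`.
Only the values of `ψ t` with `t ∈ [0,T]` matter. -/
structure MemB (m : ℕ) (T : ℝ) (ψ : ℝ → Space d → ℝ) : Prop where
  measurable : Measurable (fun z : Icc (0 : ℝ) T × Space d => ψ z.1 z.2)
  bounded : ∃ K : ℝ, ∀ t ∈ Icc (0 : ℝ) T, ∀ x, |ψ t x| ≤ K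
  continuous : ∀ t ∈ Icc (0 : ℝ) T, Continuous (ψ t)
  derivs : ∀ α : Fin d → ℕ, order α ≤ m →
    ∃ K : ℝ, ∀ t ∈ Icc (0 : ℝ) T, ∃ w, IsWeakDeriv α (ψ t) w ∧ ∀ᵐ x, |w x| ≤ K

/-- The norm `‖ψ‖_m` of `ψ ∈ 𝔅^m_T`: the square root of the supremum over `[0,T] × ℝ^d` (the
essential supremum in `x`, as generalized derivatives are defined almost everywhere) of
`∑_{|α| ≤ m} |D^α ψ|^2`, written as the least admissible bound. -/
def normB (m : ℕ) (T : ℝ) (ψ : ℝ → Space d → ℝ) : ℝ :=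
  sInf {K : ℝ | 0 ≤ K ∧ ∀ t ∈ Icc (0 : ℝ) T, ∀ᵐ x,
    ∑ k ∈ Finset.range (m + 1), sqDeriv k (ψ t) x ≤ K ^ 2}

/-- The number `|Λ|`, where `|Λ|^2` is the sum of `|l|^2` over `l ∈ Λ`. -/
def dirNorm (Λ : Finset (Space d)) : ℝ := Real.sqrt (∑ l ∈ Λ, ‖l‖ ^ 2)

/-- The coefficients and data of the problem: functions `q_l ≥ 0`, `p_l` for `l` in the finite set
`Λ ∌ 0`, and `c`, `f`, `g`, all in `𝔅^m_T`, the derivatives of order `k` of the coefficients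
being bounded through the constants `M_k`. -/
structure Admissible (m : ℕ) (T : ℝ) (M : Fin (m + 1) → ℝ) (Λ : Finset (Space d))
    (q p : Space d → ℝ → Space d → ℝ) (c f : ℝ → Space d → ℝ) (g : Space d → ℝ) : Prop where
  zero_notMem : (0 : Space d) ∉ Λ
  q_nonneg : ∀ l ∈ Λ, ∀ t ∈ Icc (0 : ℝ) T, ∀ x, 0 ≤ q l t x
  q_mem : ∀ l ∈ Λ, MemB m T (q l)
  p_mem : ∀ l ∈ Λ, MemB m T (p l)
  c_mem : MemB m T c
  f_mem : MemB m T f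
  g_mem : MemB m T (fun _ => g)
  bound : ∀ k : Fin (m + 1), ∀ t ∈ Icc (0 : ℝ) T, ∀ᵐ x,
    ∑ l ∈ Λ, (sqDeriv k (q l t) x + sqDeriv k (p l t) x) + sqDeriv k (c t) x ≤ M k ^ 2

/-- The part of `𝓛u` with derivatives, at time `s`, for `v = u(s,·)`:
`∑_l (1/2 ∑_{i,j} q_l l_i l_j D_i D_j v + ∑_i p_l l_i D_i v)`. -/
def diffPart (Λ : Finset (Space d)) (q p : Space d → ℝ → Space d → ℝ) (s : ℝ)
    (v : Space d → ℝ) (x : Space d) : ℝ :=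
  ∑ l ∈ Λ, ((1 / 2 : ℝ) * ∑ i, ∑ j, q l s x * l i * l j * weakDeriv (idx i + idx j) v x
    + ∑ i, p l s x * l i * weakDeriv (idx i) v x)

/-- `u` is a solution of `∂_t u = 𝓛u + f` on `[0,T] × ℝ^d`, `u(0,·) = g`: a bounded continuous
function in `𝔅^2_T` satisfying the equation, integrated in time, in the sense of generalized
functions. -/
structure IsSolution (T : ℝ) (Λ : Finset (Space d)) (q p : Space d → ℝ → Space d → ℝ)
    (c f : ℝ → Space d → ℝ) (g : Space d → ℝ) (u : ℝ → Space d → ℝ) : Prop where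
  continuousOn : ContinuousOn (fun z : ℝ × Space d => u z.1 z.2) (Icc (0 : ℝ) T ×ˢ univ)
  mem : MemB 2 T u
  equation : ∀ t ∈ Icc (0 : ℝ) T, ∀ φ : Space d → ℝ, IsTest φ →
    ∫ x, φ x * u t x = (∫ x, φ x * g x)
      + (∫ s in (0 : ℝ)..t, ∫ x, φ x * (-(c s x * u s x) + f s x))
      + ∫ s in (0 : ℝ)..t, ∫ x, φ x * diffPart Λ q p s (u s) x

end DegenerateParabolic

end

noncomputable section
namespace DegenerateParabolic

variable {d : ℕ}

/-! ### Iterated partial derivatives along words -/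

/-! Existence comes from a discretization whose estimates do not see the mesh. The operator is
replaced by a bounded one, `approxOp`: the second derivative along `l` becomes an average of jumps
in `[-δl, δl]`, and first derivatives become one-sided difference quotients with nonnegative rates.
Coefficients are mollified in `x` and averaged over time steps, and time is discretized by the
explicit Euler scheme `ProblemData.scheme`.

The estimate is Bernstein's method for `energy m`, the sum of the squares of all derivatives up to
order `m`. The square rule `two_mul_jumpOp` leaves a good term `-qΓ`, where `Γ` is the carré du
champ `jumpGamma` summed over these derivatives; it degenerates together with `q`. Differentiating
the equation creates commutators. If one derivative falls on `q`, what remains behaves like a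
derivative of order `m + 1`. But `q ≥ 0` gives `|D_i q|² ≤ 4Kq` (`sq_partialDeriv_le`), and the jump
operator is controlled by `Γ` of derivatives one order higher (`sq_jumpOp_le`), so `qΓ` absorbs the
commutator. If two or more derivatives fall on `q`, derivatives up to order `m` suffice. The outcome
is `SmoothCoeffs.bernstein`, then `SmoothCoeffs.euler_step` and the discrete Gronwall bound
`ProblemData.Regular.energy_scheme_le`. Its constant sees `Λ` only through `∑ ‖l‖²`; the mesh and
the number of elements of `Λ` affect only how small the time step must be.

The schemes are Lipschitz in `x` and, up to one step, in `t`, so a subsequence converges pointwise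
(`exists_subseq_tendsto`). Bounds on derivatives pass to weak limits (`weakBdd_of_tendsto`). Moving
the difference operators onto test functions identifies the limit of each term
(`TimeReg.tendsto_term`), which yields `ProblemData.Regular.exists_solution`.

Uniqueness does not use the scheme. The difference of two solutions is mollified in `x`; since the
coefficients are Lipschitz and the second derivatives bounded, the commutator of the mollification
with the operator is `O(mesh n)` (`ProblemData.Regular.exists_commutator_le`). A maximum principle
on short time intervals, in a form that does not need the supremum to be attained
(`ProblemData.Regular.abs_mollify_step_le`), makes the mollified difference `O(mesh n)` as well, and
`n → ∞` gives zero. -/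

/-- The iterated partial derivative along a word of coordinate directions. -/
def wordDeriv : List (Fin d) → (Space d → ℝ) → (Space d → ℝ)
  | [], v => v
  | i :: w, v => partialDeriv i (wordDeriv w v)

@[simp] lemma wordDeriv_nil (v : Space d → ℝ) : wordDeriv [] v = v := rfl

@[simp] lemma wordDeriv_cons (i : Fin d) (w : List (Fin d)) (v : Space d → ℝ) :
    wordDeriv (i :: w) v = partialDeriv i (wordDeriv w v) := rfl

lemma wordDeriv_append (a b : List (Fin d)) (v : Space d → ℝ) :
    wordDeriv (a ++ b) v = wordDeriv a (wordDeriv b v) := by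
  induction a with
  | nil => rfl
  | cons i a ih => simp [ih]

/-- Functions all of whose iterated partial derivatives exist and are bounded. -/
def SmoothBdd (v : Space d → ℝ) : Prop :=
  ∀ w : List (Fin d), Differentiable ℝ (wordDeriv w v) ∧ ∃ K, ∀ x, |wordDeriv w v x| ≤ K

lemma SmoothBdd.differentiable {v : Space d → ℝ} (h : SmoothBdd v) : Differentiable ℝ v :=
  (h []).1

lemma SmoothBdd.iterate {v : Space d → ℝ} (h : SmoothBdd v) (b : List (Fin d)) :
    SmoothBdd (wordDeriv b v) := fun w => by
  rw [← wordDeriv_append]; exact h _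

lemma SmoothBdd.partial_ {v : Space d → ℝ} (h : SmoothBdd v) (i : Fin d) :
    SmoothBdd (partialDeriv i v) := h.iterate [i]

lemma SmoothBdd.continuous {v : Space d → ℝ} (h : SmoothBdd v) : Continuous v :=
  h.differentiable.continuous

lemma space_eq_sum (y : Space d) :
    y = ∑ i, y i • (EuclideanSpace.single i (1 : ℝ) : Space d) := by
  ext j
  simp [Finset.sum_apply, Pi.single_apply]

lemma fderiv_apply_eq_sum (v : Space d → ℝ) (x y : Space d) :
    fderiv ℝ v x y = ∑ i, y i * partialDeriv i v x := by
  conv_lhs => rw [space_eq_sum y]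
  simp [partialDeriv, map_sum]

lemma fderiv_eq_sum (v : Space d → ℝ) (x : Space d) :
    fderiv ℝ v x = ∑ i, partialDeriv i v x • (EuclideanSpace.proj i : Space d →L[ℝ] ℝ) := by
  ext y
  rw [fderiv_apply_eq_sum]
  simp [mul_comm]

lemma SmoothBdd.continuous_fderiv {v : Space d → ℝ} (h : SmoothBdd v) :
    Continuous (fderiv ℝ v) := by
  have : fderiv ℝ v =
      fun x => ∑ i, partialDeriv i v x • (EuclideanSpace.proj i : Space d →L[ℝ] ℝ) :=
    funext (fderiv_eq_sum v)
  rw [this]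
  exact continuous_finsetSum _ fun i _ => (h.partial_ i).continuous.smul continuous_const

lemma partialDeriv_add (i : Fin d) {f g : Space d → ℝ} (hf : Differentiable ℝ f)
    (hg : Differentiable ℝ g) :
    partialDeriv i (fun x => f x + g x) = fun x => partialDeriv i f x + partialDeriv i g x := by
  ext x
  simp only [partialDeriv]
  rw [fderiv_fun_add (hf x) (hg x)]; rfl

lemma partialDeriv_const_mul (i : Fin d) (c : ℝ) {f : Space d → ℝ} (hf : Differentiable ℝ f) :
    partialDeriv i (fun x => c * f x) = fun x => c * partialDeriv i f x := by
  ext x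
  simp only [partialDeriv]
  rw [fderiv_const_mul (hf x)]; rfl

lemma partialDeriv_mul (i : Fin d) {f g : Space d → ℝ} (hf : Differentiable ℝ f)
    (hg : Differentiable ℝ g) :
    partialDeriv i (fun x => f x * g x) =
      fun x => f x * partialDeriv i g x + partialDeriv i f x * g x := by
  ext x
  simp only [partialDeriv]
  rw [fderiv_fun_mul (hf x) (hg x)]
  simp [mul_comm]

lemma partialDeriv_const (i : Fin d) (c : ℝ) :
    partialDeriv i (fun _ : Space d => c) = fun _ => 0 := by
  ext x; simp [partialDeriv]

lemma partialDeriv_comp_add (i : Fin d) (f : Space d → ℝ) (y : Space d) :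
    partialDeriv i (fun x => f (x + y)) = fun x => partialDeriv i f (x + y) := by
  ext x
  simp only [partialDeriv]
  rw [fderiv_comp_add_right]

lemma partialDeriv_finset_sum {ι : Type*} (s : Finset ι) (i : Fin d) {f : ι → Space d → ℝ}
    (hf : ∀ k ∈ s, Differentiable ℝ (f k)) :
    partialDeriv i (fun x => ∑ k ∈ s, f k x) = fun x => ∑ k ∈ s, partialDeriv i (f k) x := by
  ext x
  simp only [partialDeriv]
  rw [fderiv_fun_sum fun k hk => hf k hk x]
  simp

lemma wordDeriv_add (w : List (Fin d)) {f g : Space d → ℝ} (hf : SmoothBdd f)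
    (hg : SmoothBdd g) :
    wordDeriv w (fun x => f x + g x) = fun x => wordDeriv w f x + wordDeriv w g x := by
  induction w with
  | nil => rfl
  | cons i w ih => rw [wordDeriv_cons, ih, partialDeriv_add i (hf w).1 (hg w).1]; rfl

lemma wordDeriv_const_mul (w : List (Fin d)) (c : ℝ) {f : Space d → ℝ} (hf : SmoothBdd f) :
    wordDeriv w (fun x => c * f x) = fun x => c * wordDeriv w f x := by
  induction w with
  | nil => rfl
  | cons i w ih => rw [wordDeriv_cons, ih, partialDeriv_const_mul i c (hf w).1]; rfl

lemma wordDeriv_comp_add (w : List (Fin d)) (f : Space d → ℝ) (y : Space d) :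
    wordDeriv w (fun x => f (x + y)) = fun x => wordDeriv w f (x + y) := by
  induction w with
  | nil => rfl
  | cons i w ih => rw [wordDeriv_cons, ih, partialDeriv_comp_add]; rfl

lemma wordDeriv_finset_sum {ι : Type*} (s : Finset ι) (w : List (Fin d)) {f : ι → Space d → ℝ}
    (hf : ∀ k ∈ s, SmoothBdd (f k)) :
    wordDeriv w (fun x => ∑ k ∈ s, f k x) = fun x => ∑ k ∈ s, wordDeriv w (f k) x := by
  induction w with
  | nil => rfl
  | cons i w ih =>
    rw [wordDeriv_cons, ih, partialDeriv_finset_sum s i fun k hk => (hf k hk w).1]; rfl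

lemma wordDeriv_const (w : List (Fin d)) (hw : w ≠ []) (c : ℝ) :
    wordDeriv w (fun _ : Space d => c) = fun _ => 0 := by
  induction w with
  | nil => exact absurd rfl hw
  | cons i w ih =>
    by_cases h : w = []
    · subst h; exact partialDeriv_const i c
    · rw [wordDeriv_cons, ih h]; exact partialDeriv_const i 0

lemma SmoothBdd.add {f g : Space d → ℝ} (hf : SmoothBdd f) (hg : SmoothBdd g) :
    SmoothBdd (fun x => f x + g x) := fun w => by
  rw [wordDeriv_add w hf hg]
  obtain ⟨K, hK⟩ := (hf w).2
  obtain ⟨K', hK'⟩ := (hg w).2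
  exact ⟨(hf w).1.add (hg w).1, K + K', fun x => (abs_add_le _ _).trans (add_le_add (hK x) (hK' x))⟩

lemma SmoothBdd.const_mul {f : Space d → ℝ} (hf : SmoothBdd f) (c : ℝ) :
    SmoothBdd (fun x => c * f x) := fun w => by
  rw [wordDeriv_const_mul w c hf]
  obtain ⟨K, hK⟩ := (hf w).2
  refine ⟨(hf w).1.const_mul c, |c| * K, fun x => ?_⟩
  rw [abs_mul]
  exact mul_le_mul_of_nonneg_left (hK x) (abs_nonneg c)

lemma SmoothBdd.comp_add {f : Space d → ℝ} (hf : SmoothBdd f) (y : Space d) :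
    SmoothBdd (fun x => f (x + y)) := fun w => by
  rw [wordDeriv_comp_add]
  obtain ⟨K, hK⟩ := (hf w).2
  exact ⟨(hf w).1.comp (differentiable_id.add_const y), K, fun x => hK _⟩

lemma smoothBdd_const (c : ℝ) : SmoothBdd (fun _ : Space d => c) := fun w => by
  by_cases h : w = []
  · subst h; exact ⟨differentiable_const c, |c|, fun x => le_rfl⟩
  · rw [wordDeriv_const w h]; exact ⟨differentiable_const 0, 0, fun x => by simp⟩

lemma SmoothBdd.finset_sum {ι : Type*} (s : Finset ι) {f : ι → Space d → ℝ}
    (hf : ∀ k ∈ s, SmoothBdd (f k)) : SmoothBdd (fun x => ∑ k ∈ s, f k x) := by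
  classical
  induction s using Finset.induction_on with
  | empty => simpa using smoothBdd_const 0
  | insert a s ha ih =>
    simp only [Finset.sum_insert ha]
    exact (hf a (by simp)).add (ih fun k hk => hf k (by simp [hk]))

/-! ### The Leibniz formula -/

/-- The pairs of complementary subwords of `w`, apart from `([], w)`. -/
def subwordPairs : List (Fin d) → List (List (Fin d) × List (Fin d))
  | [] => []
  | i :: w => ([i], w) :: ((subwordPairs w).map (fun p => (i :: p.1, p.2)) ++
      (subwordPairs w).map (fun p => (p.1, i :: p.2)))

lemma subwordPairs_length {w : List (Fin d)} {p : List (Fin d) × List (Fin d)}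
    (hp : p ∈ subwordPairs w) : 1 ≤ p.1.length ∧ p.1.length + p.2.length = w.length := by
  induction w generalizing p with
  | nil => simp [subwordPairs] at hp
  | cons i w ih =>
    simp only [subwordPairs, List.mem_cons, List.mem_append, List.mem_map] at hp
    rcases hp with rfl | ⟨q, hq, rfl⟩ | ⟨q, hq, rfl⟩
    · simp; omega
    · have := ih hq; simp; omega
    · have := ih hq; simp; omega

lemma differentiable_list_sum {ι : Type*} (l : List ι) {F : ι → Space d → ℝ}
    (hF : ∀ k ∈ l, Differentiable ℝ (F k)) :
    Differentiable ℝ (fun x => (l.map fun k => F k x).sum) := by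
  induction l with
  | nil => simp
  | cons a l ih =>
    simp only [List.map_cons, List.sum_cons]
    exact (hF a (by simp)).add (ih fun k hk => hF k (by simp [hk]))

lemma partialDeriv_list_sum {ι : Type*} (l : List ι) (i : Fin d) {F : ι → Space d → ℝ}
    (hF : ∀ k ∈ l, Differentiable ℝ (F k)) :
    partialDeriv i (fun x => (l.map fun k => F k x).sum) =
      fun x => (l.map fun k => partialDeriv i (F k) x).sum := by
  induction l with
  | nil => simpa using partialDeriv_const i 0
  | cons a l ih =>
    simp only [List.map_cons, List.sum_cons]
    rw [partialDeriv_add i (hF a (by simp))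
      (differentiable_list_sum l fun k hk => hF k (by simp [hk])),
      ih fun k hk => hF k (by simp [hk])]

/-- The term without derivatives on `f` is kept apart because it is the principal part; every pair
in `subwordPairs w` is a commutator, with at least one derivative on `f`. -/
theorem wordDeriv_mul (w : List (Fin d)) {f g : Space d → ℝ} (hf : SmoothBdd f)
    (hg : SmoothBdd g) :
    wordDeriv w (fun x => f x * g x) = fun x => f x * wordDeriv w g x +
      ((subwordPairs w).map fun p => wordDeriv p.1 f x * wordDeriv p.2 g x).sum := by
  induction w with
  | nil => simp [subwordPairs]
  | cons i w ih =>
    have h1 : ∀ p ∈ subwordPairs w,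
        Differentiable ℝ (fun x => wordDeriv p.1 f x * wordDeriv p.2 g x) :=
      fun p _ => (hf p.1).1.fun_mul (hg p.2).1
    rw [wordDeriv_cons, ih, partialDeriv_add i (hf.differentiable.fun_mul (hg w).1)
      (differentiable_list_sum _ h1), partialDeriv_list_sum _ i h1,
      partialDeriv_mul i hf.differentiable (hg w).1]
    ext x
    simp only [subwordPairs, List.map_cons, List.sum_cons, List.map_append, List.map_map,
      List.sum_append, Function.comp_def, wordDeriv_cons, wordDeriv_nil]
    rw [add_assoc]
    congr 2
    rw [← List.sum_map_add]
    congr 1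
    apply List.map_congr_left
    intro p _
    rw [partialDeriv_mul i (hf p.1).1 (hg p.2).1]
    ring

lemma abs_list_sum_le {ι : Type*} (l : List ι) (F : ι → ℝ) :
    |(l.map F).sum| ≤ (l.map fun k => |F k|).sum := by
  induction l with
  | nil => simp
  | cons a l ih =>
    simp only [List.map_cons, List.sum_cons]
    exact (abs_add_le _ _).trans (by gcongr)

lemma list_sum_le_length_mul {ι : Type*} (l : List ι) (F : ι → ℝ) (B : ℝ)
    (h : ∀ k ∈ l, F k ≤ B) : (l.map F).sum ≤ l.length * B := by
  have := List.sum_le_card_nsmul (l.map F) B (by simpa using h)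
  simpa using this

lemma SmoothBdd.mul {f g : Space d → ℝ} (hf : SmoothBdd f) (hg : SmoothBdd g) :
    SmoothBdd (fun x => f x * g x) := fun w => by
  rw [wordDeriv_mul w hf hg]
  refine ⟨(hf.differentiable.mul (hg w).1).add (differentiable_list_sum _
    fun p _ => (hf p.1).1.mul (hg p.2).1), ?_⟩
  choose Kf hKf using fun w => (hf w).2
  choose Kg hKg using fun w => (hg w).2
  refine ⟨Kf [] * Kg w + ((subwordPairs w).map fun p => Kf p.1 * Kg p.2).sum, fun x => ?_⟩
  refine (abs_add_le _ _).trans (add_le_add ?_ ((abs_list_sum_le _ _).trans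
    (List.sum_le_sum fun p _ => ?_)))
  · rw [abs_mul]
    exact mul_le_mul (hKf [] x) (hKg w x) (abs_nonneg _) ((abs_nonneg _).trans (hKf [] x))
  · rw [abs_mul]
    exact mul_le_mul (hKf _ x) (hKg _ x) (abs_nonneg _) ((abs_nonneg _).trans (hKf _ x))

/-! ### Averages of functions depending on a parameter -/

lemma norm_fderiv_le_sum {v : Space d → ℝ} {x : Space d} {K : Fin d → ℝ}
    (h : ∀ i, |partialDeriv i v x| ≤ K i) : ‖fderiv ℝ v x‖ ≤ ∑ i, K i := by
  have hK : ∀ i, 0 ≤ K i := fun i => (abs_nonneg _).trans (h i)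
  refine ContinuousLinearMap.opNorm_le_bound _ (Finset.sum_nonneg fun i _ => hK i) fun y => ?_
  rw [fderiv_apply_eq_sum, Finset.sum_mul]
  refine (norm_sum_le _ _).trans (Finset.sum_le_sum fun i _ => ?_)
  rw [norm_mul, mul_comm, Real.norm_eq_abs]
  exact mul_le_mul (h i) (PiLp.norm_apply_le y i) (norm_nonneg _) (hK i)

lemma hasFDerivAt_average {α : Type*} [MeasurableSpace α] {μ : Measure α} [IsFiniteMeasure μ]
    {F : α → Space d → ℝ} (hd : ∀ a, Differentiable ℝ (F a)) {K : ℝ} (hK : ∀ a x, |F a x| ≤ K)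
    {K' : Fin d → ℝ} (hK' : ∀ i a x, |partialDeriv i (F a) x| ≤ K' i)
    (hm : ∀ x, AEStronglyMeasurable (fun a => F a x) μ)
    (hm' : ∀ i x, AEStronglyMeasurable (fun a => partialDeriv i (F a) x) μ) (x : Space d) :
    HasFDerivAt (fun x => ∫ a, F a x ∂μ) (∫ a, fderiv ℝ (F a) x ∂μ) x := by
  refine hasFDerivAt_integral_of_dominated_of_fderiv_le (𝕜 := ℝ) (s := univ) (F := fun x a => F a x)
    (F' := fun x a => fderiv ℝ (F a) x)
    (bound := fun _ => ∑ i, K' i) Filter.univ_mem (Filter.Eventually.of_forall hm) ?_ ?_ ?_ ?_ ?_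
  · exact Integrable.of_bound (hm x) K (Filter.Eventually.of_forall fun a => hK a x)
  · simp_rw [fderiv_eq_sum]
    exact Finset.aestronglyMeasurable_fun_sum _ fun i _ => (hm' i x).smul_const _
  · exact Filter.Eventually.of_forall fun a y _ => norm_fderiv_le_sum fun i => hK' i a y
  · exact integrable_const _
  · exact Filter.Eventually.of_forall fun a y _ => (hd a y).hasFDerivAt

/-- Serves both averages of the proof: over the jump parameter `θ` and over a time step. -/
lemma wordDeriv_average {α : Type*} [MeasurableSpace α] {μ : Measure α} [IsFiniteMeasure μ]
    {F : α → Space d → ℝ} (hs : ∀ a, SmoothBdd (F a))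
    (hK : ∀ w, ∃ K, ∀ a x, |wordDeriv w (F a) x| ≤ K)
    (hm : ∀ w x, AEStronglyMeasurable (fun a => wordDeriv w (F a) x) μ) (w : List (Fin d)) :
    wordDeriv w (fun x => ∫ a, F a x ∂μ) = fun x => ∫ a, wordDeriv w (F a) x ∂μ := by
  choose K hK using hK
  induction w with
  | nil => rfl
  | cons i w ih =>
    rw [wordDeriv_cons, ih]
    ext x
    rw [partialDeriv, (hasFDerivAt_average (μ := μ) (fun a => (hs a w).1) (hK w)
      (K' := fun i => K (i :: w)) (fun i => hK (i :: w)) (hm w)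
      (fun i => hm (i :: w)) x).fderiv,
      ContinuousLinearMap.integral_apply]
    · rfl
    · refine Integrable.of_bound (C := ∑ i, K (i :: w)) ?_
        (Filter.Eventually.of_forall fun a => norm_fderiv_le_sum fun i => hK (i :: w) a x)
      simp_rw [fderiv_eq_sum]
      exact Finset.aestronglyMeasurable_fun_sum _ fun i _ => (hm (i :: w) x).smul_const _

lemma smoothBdd_average {α : Type*} [MeasurableSpace α] {μ : Measure α} [IsFiniteMeasure μ]
    {F : α → Space d → ℝ} (hs : ∀ a, SmoothBdd (F a))
    (hK : ∀ w, ∃ K, ∀ a x, |wordDeriv w (F a) x| ≤ K)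
    (hm : ∀ w x, AEStronglyMeasurable (fun a => wordDeriv w (F a) x) μ) :
    SmoothBdd (fun x => ∫ a, F a x ∂μ) := fun w => by
  rw [wordDeriv_average hs hK hm]
  choose K hK using hK
  refine ⟨fun x => (hasFDerivAt_average (μ := μ) (fun a => (hs a w).1) (hK w)
      (K' := fun i => K (i :: w)) (fun i => hK (i :: w)) (hm w)
      (fun i => hm (i :: w)) x).differentiableAt, μ.real univ * K w, fun x => ?_⟩
  have := norm_integral_le_of_norm_le_const (μ := μ) (f := fun a => wordDeriv w (F a) x)
    (C := K w) (Filter.Eventually.of_forall fun a => hK w a x)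
  rwa [Real.norm_eq_abs, mul_comm] at this

/-! ### Nonlocal approximations of second order directional derivatives -/

/-- The jump operator with uniformly distributed jumps in `[-δl, δl]`, which approximates the
second derivative in the direction `l`. -/
def jumpOp (δ : ℝ) (l : Space d) (v : Space d → ℝ) (x : Space d) : ℝ :=
  3 / δ ^ 2 * ∫ θ in Icc (-1 : ℝ) 1, (v (x + (δ * θ) • l) - v x)

/-- The carré du champ of `jumpOp δ l`. -/
def jumpGamma (δ : ℝ) (l : Space d) (v : Space d → ℝ) (x : Space d) : ℝ :=
  3 / δ ^ 2 * ∫ θ in Icc (-1 : ℝ) 1, (v (x + (δ * θ) • l) - v x) ^ 2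

/-- The one-sided difference quotient. -/
def diffQuot (δ : ℝ) (y : Space d) (v : Space d → ℝ) (x : Space d) : ℝ :=
  (v (x + δ • y) - v x) / δ

lemma jumpGamma_nonneg (δ : ℝ) (l : Space d) (v : Space d → ℝ) (x : Space d) :
    0 ≤ jumpGamma δ l v x :=
  mul_nonneg (by positivity) (integral_nonneg fun θ => sq_nonneg _)

lemma continuous_jump {v : Space d → ℝ} (hv : Continuous v) (δ : ℝ) (l x : Space d) :
    Continuous fun θ : ℝ => v (x + (δ * θ) • l) - v x := by
  have : Continuous fun θ : ℝ => x + (δ * θ) • l := by fun_prop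
  exact (hv.comp this).sub continuous_const

/-- The identity `2a(b - a) = (b² - a²) - (b - a)²` integrated over the jumps. The negative term
pays for the second order commutators. -/
lemma two_mul_jumpOp {v : Space d → ℝ} (hv : Continuous v) (δ : ℝ) (l x : Space d) :
    2 * v x * jumpOp δ l v x = jumpOp δ l (fun y => v y ^ 2) x - jumpGamma δ l v x := by
  have hc := continuous_jump hv δ l x
  have hc2 : Continuous fun θ : ℝ => v (x + (δ * θ) • l) ^ 2 - v x ^ 2 :=
    continuous_jump (hv.pow 2) δ l x
  have hc3 : Continuous fun θ : ℝ => (v (x + (δ * θ) • l) - v x) ^ 2 := hc.pow 2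
  simp only [jumpOp, jumpGamma]
  rw [← mul_sub, ← integral_sub hc2.integrableOn_Icc hc3.integrableOn_Icc]
  rw [mul_left_comm, ← integral_const_mul]
  congr 2
  ext θ
  ring

lemma wordDeriv_jump_integrand {v : Space d → ℝ} (hv : SmoothBdd v) (δ : ℝ) (l : Space d)
    (w : List (Fin d)) (θ : ℝ) :
    wordDeriv w (fun x => v (x + (δ * θ) • l) - v x) =
      fun x => wordDeriv w v (x + (δ * θ) • l) - wordDeriv w v x := by
  have := wordDeriv_add w (hv.comp_add ((δ * θ) • l)) (hv.const_mul (-1))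
  rw [wordDeriv_comp_add, wordDeriv_const_mul w _ hv] at this
  simpa [sub_eq_add_neg] using this

lemma smoothBdd_jump_integrand {v : Space d → ℝ} (hv : SmoothBdd v) (δ : ℝ) (l : Space d)
    (θ : ℝ) : SmoothBdd (fun x => v (x + (δ * θ) • l) - v x) := by
  have := (hv.comp_add ((δ * θ) • l)).add (hv.const_mul (-1))
  simpa [sub_eq_add_neg] using this

lemma jump_integrand_bdd {v : Space d → ℝ} (hv : SmoothBdd v) (δ : ℝ) (l : Space d)
    (w : List (Fin d)) :
    ∃ K, ∀ θ x, |wordDeriv w (fun x => v (x + (δ * θ) • l) - v x) x| ≤ K := by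
  obtain ⟨K, hK⟩ := (hv w).2
  refine ⟨K + K, fun θ x => ?_⟩
  rw [wordDeriv_jump_integrand hv]
  exact (abs_sub _ _).trans (add_le_add (hK _) (hK _))

lemma jump_integrand_measurable {v : Space d → ℝ} (hv : SmoothBdd v) (δ : ℝ) (l : Space d)
    (w : List (Fin d)) (x : Space d) (μ : Measure ℝ) :
    AEStronglyMeasurable (fun θ => wordDeriv w (fun x => v (x + (δ * θ) • l) - v x) x) μ := by
  simp_rw [wordDeriv_jump_integrand hv]
  exact (continuous_jump (hv w).1.continuous δ l x).aestronglyMeasurable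

lemma SmoothBdd.jumpOp {v : Space d → ℝ} (hv : SmoothBdd v) (δ : ℝ) (l : Space d) :
    SmoothBdd (jumpOp δ l v) :=
  (smoothBdd_average (smoothBdd_jump_integrand hv δ l) (jump_integrand_bdd hv δ l)
    (fun w x => jump_integrand_measurable hv δ l w x _)).const_mul _

lemma wordDeriv_jumpOp {v : Space d → ℝ} (hv : SmoothBdd v) (δ : ℝ) (l : Space d)
    (w : List (Fin d)) :
    wordDeriv w (DegenerateParabolic.jumpOp δ l v) =
      DegenerateParabolic.jumpOp δ l (wordDeriv w v) := by
  have h := wordDeriv_const_mul w (3 / δ ^ 2)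
    (smoothBdd_average (μ := volume.restrict (Icc (-1 : ℝ) 1))
      (smoothBdd_jump_integrand hv δ l) (jump_integrand_bdd hv δ l)
      (fun w x => jump_integrand_measurable hv δ l w x _))
  rw [wordDeriv_average (smoothBdd_jump_integrand hv δ l) (jump_integrand_bdd hv δ l)
      (fun w x => jump_integrand_measurable hv δ l w x _)] at h
  refine h.trans ?_
  ext x
  simp only [DegenerateParabolic.jumpOp, wordDeriv_jump_integrand hv]

lemma SmoothBdd.diffQuot {v : Space d → ℝ} (hv : SmoothBdd v) (δ : ℝ) (y : Space d) :
    SmoothBdd (diffQuot δ y v) := by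
  have := ((hv.comp_add (δ • y)).add (hv.const_mul (-1))).const_mul δ⁻¹
  convert this using 2
  simp only [DegenerateParabolic.diffQuot]; ring

lemma wordDeriv_diffQuot {v : Space d → ℝ} (hv : SmoothBdd v) (δ : ℝ) (y : Space d)
    (w : List (Fin d)) :
    wordDeriv w (diffQuot δ y v) = diffQuot δ y (wordDeriv w v) := by
  have h := wordDeriv_const_mul w δ⁻¹ ((hv.comp_add (δ • y)).add (hv.const_mul (-1)))
  rw [wordDeriv_add w (hv.comp_add _) (hv.const_mul _), wordDeriv_comp_add,
    wordDeriv_const_mul w _ hv] at h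
  have h1 : ∀ u : Space d → ℝ, diffQuot δ y u = fun x => δ⁻¹ * (u (x + δ • y) + -1 * u x) :=
    fun u => by ext x; rw [DegenerateParabolic.diffQuot]; ring
  rw [h1, h1, h]

/-! ### Pointwise estimates -/

lemma sq_fderiv_le (v : Space d → ℝ) (y l : Space d) :
    (fderiv ℝ v y l) ^ 2 ≤ ‖l‖ ^ 2 * ∑ i, (partialDeriv i v y) ^ 2 := by
  rw [fderiv_apply_eq_sum, EuclideanSpace.norm_sq_eq]
  simpa using Finset.sum_mul_sq_le_sq_mul_sq Finset.univ (fun i => l i)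
    (fun i => partialDeriv i v y)

lemma abs_sub_le_of_grad {v : Space d → ℝ} (hv : Differentiable ℝ v) {s : ℝ} (hs : 0 ≤ s)
    (h : ∀ y, ∑ i, (partialDeriv i v y) ^ 2 ≤ s ^ 2) (x z : Space d) :
    |v (x + z) - v x| ≤ s * ‖z‖ := by
  have := Convex.norm_image_sub_le_of_norm_fderiv_le (𝕜 := ℝ) (f := v) (s := univ) (C := s)
    (x := x) (y := x + z) (fun y _ => hv y) (fun y _ => ?_) convex_univ (mem_univ _) (mem_univ _)
  · simpa using this
  · refine ContinuousLinearMap.opNorm_le_bound _ hs fun l => abs_le_of_sq_le_sq ?_ (by positivity)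
    calc (fderiv ℝ v y l) ^ 2 ≤ ‖l‖ ^ 2 * ∑ i, (partialDeriv i v y) ^ 2 := sq_fderiv_le v y l
      _ ≤ ‖l‖ ^ 2 * s ^ 2 := by gcongr; exact h y
      _ = (s * ‖l‖) ^ 2 := by ring

/-- The increments are at most `s * δ * ‖l‖` on an interval of length two, so `δ ^ 2` cancels. -/
lemma jumpGamma_le {v : Space d → ℝ} (hv : Differentiable ℝ v) {s : ℝ} (hs : 0 ≤ s)
    (h : ∀ y, ∑ i, (partialDeriv i v y) ^ 2 ≤ s ^ 2) {δ : ℝ} (hδ : 0 < δ) (l x : Space d) :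
    jumpGamma δ l v x ≤ 6 * ‖l‖ ^ 2 * s ^ 2 := by
  have hI : ∫ θ in Icc (-1 : ℝ) 1, (v (x + (δ * θ) • l) - v x) ^ 2 ≤
      ∫ θ in Icc (-1 : ℝ) 1, (s * (δ * ‖l‖)) ^ 2 := by
    refine setIntegral_mono_on ((continuous_jump hv.continuous δ l x).pow 2).integrableOn_Icc
      continuous_const.integrableOn_Icc measurableSet_Icc fun θ hθ => ?_
    rw [← sq_abs]
    have h1 := abs_sub_le_of_grad hv hs h x ((δ * θ) • l)
    refine pow_le_pow_left₀ (abs_nonneg _) (h1.trans ?_) 2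
    rw [norm_smul, Real.norm_eq_abs, abs_mul, abs_of_pos hδ]
    have : |θ| ≤ 1 := abs_le.2 hθ
    calc s * (δ * |θ| * ‖l‖) ≤ s * (δ * 1 * ‖l‖) := by gcongr
      _ = _ := by ring
  rw [integral_const] at hI
  simp only [jumpGamma]
  have h2 : (volume.restrict (Icc (-1 : ℝ) 1)).real univ = 2 := by
    simp [Measure.real]; norm_num
  rw [h2] at hI
  calc _ ≤ 3 / δ ^ 2 * (2 * (s * (δ * ‖l‖)) ^ 2) := by gcongr; simpa using hI
    _ = _ := by field_simp; ring

/-- Cauchy–Schwarz on an interval of length two, read off from the nonnegativity of the variance of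
`|g|`. -/
lemma sq_integral_abs_le {g : ℝ → ℝ} (hg : Continuous g) :
    (∫ θ in Icc (-1 : ℝ) 1, |g θ|) ^ 2 ≤ 2 * ∫ θ in Icc (-1 : ℝ) 1, g θ ^ 2 := by
  set m := (∫ θ in Icc (-1 : ℝ) 1, |g θ|) / 2 with hm
  have h0 : 0 ≤ ∫ θ in Icc (-1 : ℝ) 1, (|g θ| - m) ^ 2 := integral_nonneg fun θ => sq_nonneg _
  have h1 : ∫ θ in Icc (-1 : ℝ) 1, (|g θ| - m) ^ 2 =
      ∫ θ in Icc (-1 : ℝ) 1, ((g θ ^ 2 - (2 * m) * |g θ|) + m ^ 2) := by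
    congr 1; ext θ; rw [← sq_abs (g θ)]; ring
  have h2 : (volume.restrict (Icc (-1 : ℝ) 1)).real univ = 2 := by
    simp [Measure.real]; norm_num
  rw [h1, integral_add, integral_sub, integral_const_mul, integral_const, h2] at h0
  · have : (∫ θ in Icc (-1 : ℝ) 1, |g θ|) = 2 * m := by rw [hm]; ring
    rw [this] at h0 ⊢
    simp only [smul_eq_mul] at h0
    nlinarith
  · exact (hg.pow 2).integrableOn_Icc
  · exact (continuous_const.mul hg.abs).integrableOn_Icc
  · exact ((hg.pow 2).sub (continuous_const.mul hg.abs)).integrableOn_Icc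
  · simp

/-- The linear term `δθ D_l v(x)` integrates to zero over the symmetric interval, so only the
increment `g` of the directional derivative matters. This gains one factor `δ`, exactly what a
comparison with the carré du champ of `D_l v` requires. -/
lemma sq_jumpOp_le_aux {v : Space d → ℝ} (hv : SmoothBdd v) {δ : ℝ} (hδ : 0 < δ)
    (l x : Space d) :
    jumpOp δ l v x ^ 2 ≤ 24 * jumpGamma δ l (fun y => fderiv ℝ v y l) x := by
  set g : ℝ → ℝ := fun r => fderiv ℝ v (x + (δ * r) • l) l - fderiv ℝ v x l with hg
  have hgc : Continuous g :=
    continuous_jump (v := fun y => fderiv ℝ v y l)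
      (hv.continuous_fderiv.clm_apply continuous_const) δ l x
  have hT : ∀ θ ∈ Icc (-1 : ℝ) 1, |v (x + (δ * θ) • l) - v x - (δ * fderiv ℝ v x l) * θ| ≤
      δ * ∫ r in Icc (-1 : ℝ) 1, |g r| := by
    intro θ hθ
    have hder : ∀ r : ℝ, HasDerivAt (fun r => v (x + (δ * r) • l) - (δ * fderiv ℝ v x l) * r)
        (δ * g r) r := by
      intro r
      have h1 : HasDerivAt (fun r : ℝ => x + (δ * r) • l) (δ • l) r := by
        have := ((hasDerivAt_id r).const_mul δ).smul_const l
        simpa using this.const_add x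
      have h2 := (hv.differentiable (x + (δ * r) • l)).hasFDerivAt.comp_hasDerivAt r h1
      have h3 := h2.fun_sub ((hasDerivAt_id r).const_mul (δ * fderiv ℝ v x l))
      refine h3.congr_deriv ?_
      simp only [hg, map_smul, smul_eq_mul]; ring
    have hint := intervalIntegral.integral_eq_sub_of_hasDerivAt (a := 0) (b := θ)
      (fun r _ => hder r) ((continuous_const.mul hgc).intervalIntegrable 0 θ)
    have heq : v (x + (δ * θ) • l) - v x - (δ * fderiv ℝ v x l) * θ =
        ∫ r in (0 : ℝ)..θ, δ * g r := by
      rw [hint]; simp; ring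
    rw [heq, intervalIntegral.integral_const_mul, abs_mul, abs_of_pos hδ]
    gcongr
    refine (intervalIntegral.norm_integral_le_integral_norm_uIoc (f := g)).trans ?_
    refine setIntegral_mono_set hgc.abs.integrableOn_Icc
      (Filter.Eventually.of_forall fun r => abs_nonneg _) ?_
    refine LE.le.eventuallyLE fun r hr => ?_
    have hr : min 0 θ < r ∧ r ≤ max 0 θ := hr
    have h0 : (-1 : ℝ) ≤ min 0 θ := le_min (by norm_num) hθ.1
    have h1 : max 0 θ ≤ 1 := max_le (by norm_num) hθ.2
    exact ⟨by linarith [hr.1], by linarith [hr.2]⟩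
  have h2 : volume.real (Icc (-1 : ℝ) 1) = 2 := by simp; norm_num
  have hodd : ∫ θ in Icc (-1 : ℝ) 1, (δ * fderiv ℝ v x l) * θ = 0 := by
    rw [integral_const_mul, integral_Icc_eq_integral_Ioc,
      ← intervalIntegral.integral_of_le (by norm_num), integral_id]
    norm_num
  have hA : |∫ θ in Icc (-1 : ℝ) 1, (v (x + (δ * θ) • l) - v x)| ≤
      (δ * ∫ r in Icc (-1 : ℝ) 1, |g r|) * 2 := by
    have h3 : ∫ θ in Icc (-1 : ℝ) 1, (v (x + (δ * θ) • l) - v x) =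
        ∫ θ in Icc (-1 : ℝ) 1, (v (x + (δ * θ) • l) - v x - (δ * fderiv ℝ v x l) * θ) := by
      rw [integral_sub (continuous_jump hv.continuous δ l x).integrableOn_Icc
        (by fun_prop : Continuous fun θ : ℝ => δ * fderiv ℝ v x l * θ).integrableOn_Icc, hodd, sub_zero]
    rw [h3, ← h2]
    exact norm_setIntegral_le_of_norm_le_const
      (f := fun θ => v (x + (δ * θ) • l) - v x - (δ * fderiv ℝ v x l) * θ) measure_Icc_lt_top hT
  have hsq := sq_integral_abs_le hgc
  set I := ∫ r in Icc (-1 : ℝ) 1, |g r|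
  have hI : 0 ≤ I := integral_nonneg fun r => abs_nonneg _
  have hG : jumpGamma δ l (fun y => fderiv ℝ v y l) x =
      3 / δ ^ 2 * ∫ r in Icc (-1 : ℝ) 1, g r ^ 2 := rfl
  rw [hG, jumpOp, mul_pow, ← sq_abs (∫ θ in Icc (-1 : ℝ) 1, (v (x + (δ * θ) • l) - v x))]
  -- The square is `36 I² / δ²`, and `I² ≤ 2 ∫ g²` gives `72 / δ² = 24 * (3 / δ²)`.
  calc (3 / δ ^ 2) ^ 2 * _ ^ 2 ≤ (3 / δ ^ 2) ^ 2 * ((δ * I) * 2) ^ 2 := by gcongr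
    _ = 36 / δ ^ 2 * I ^ 2 := by field_simp; ring
    _ ≤ 36 / δ ^ 2 * (2 * ∫ r in Icc (-1 : ℝ) 1, g r ^ 2) := by gcongr
    _ = _ := by ring

lemma jumpGamma_fderiv_le {v : Space d → ℝ} (hv : SmoothBdd v) (δ : ℝ) (l x : Space d) :
    jumpGamma δ l (fun y => fderiv ℝ v y l) x ≤
      ‖l‖ ^ 2 * ∑ i, jumpGamma δ l (partialDeriv i v) x := by
  simp only [jumpGamma]
  rw [← Finset.mul_sum, mul_left_comm]
  refine mul_le_mul_of_nonneg_left ?_ (by positivity)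
  have hc : ∀ i, Continuous fun θ : ℝ =>
      (partialDeriv i v (x + (δ * θ) • l) - partialDeriv i v x) ^ 2 :=
    fun i => (continuous_jump (hv.partial_ i).continuous δ l x).pow 2
  rw [← integral_finsetSum _ fun i _ => (hc i).integrableOn_Icc, ← integral_const_mul]
  refine integral_mono (((continuous_jump (v := fun y => fderiv ℝ v y l)
      (hv.continuous_fderiv.clm_apply continuous_const) δ l x).pow 2).integrableOn_Icc)
      ((continuous_const.mul (continuous_finsetSum _ fun i _ => hc i)).integrableOn_Icc)
      fun θ => ?_
  simp only [fderiv_apply_eq_sum]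
  rw [← Finset.sum_sub_distrib, EuclideanSpace.norm_sq_eq]
  simp_rw [← mul_sub]
  simpa using Finset.sum_mul_sq_le_sq_mul_sq Finset.univ (fun i => l i)
    (fun i => partialDeriv i v (x + (δ * θ) • l) - partialDeriv i v x)

/-- Trades a second order difference of `v` for the carré du champ of its first derivatives, which
enters the energy inequality with a minus sign. -/
theorem sq_jumpOp_le {v : Space d → ℝ} (hv : SmoothBdd v) {δ : ℝ} (hδ : 0 < δ)
    (l x : Space d) :
    jumpOp δ l v x ^ 2 ≤ 24 * ‖l‖ ^ 2 * ∑ i, jumpGamma δ l (partialDeriv i v) x := by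
  have := sq_jumpOp_le_aux hv hδ l x
  have := jumpGamma_fderiv_le hv δ l x
  linarith

lemma abs_diffQuot_le {v : Space d → ℝ} (hv : Differentiable ℝ v) {s : ℝ} (hs : 0 ≤ s)
    (h : ∀ y, ∑ i, (partialDeriv i v y) ^ 2 ≤ s ^ 2) {δ : ℝ} (hδ : 0 < δ) {y : Space d}
    (hy : ‖y‖ ≤ 1) (x : Space d) : |diffQuot δ y v x| ≤ s := by
  rw [diffQuot, abs_div, abs_of_pos hδ, div_le_iff₀ hδ]
  refine (abs_sub_le_of_grad hv hs h x (δ • y)).trans ?_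
  rw [norm_smul, Real.norm_eq_abs, abs_of_pos hδ]
  gcongr
  nlinarith

/-- The mean value inequality without the factor `1 / (n + 1)`. Iterated, it gives Taylor remainders
with constants that are not sharp but sufficient. -/
lemma abs_sub_le_of_deriv_le {φ φ' : ℝ → ℝ} (hφ : ∀ s, HasDerivAt φ (φ' s) s) {C : ℝ} (n : ℕ)
    (h : ∀ s, |φ' s| ≤ C * |s| ^ n) (s : ℝ) : |φ s - φ 0| ≤ C * |s| ^ (n + 1) := by
  have hC : 0 ≤ C := by
    have := (abs_nonneg _).trans (h 1); simpa using this
  have := Convex.norm_image_sub_le_of_norm_hasDerivWithin_le (f := φ) (f' := φ') (s := uIcc 0 s)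
    (C := C * |s| ^ n) (x := 0) (y := s) (fun r _ => (hφ r).hasDerivWithinAt) (fun r hr => ?_)
    (convex_uIcc 0 s) left_mem_uIcc right_mem_uIcc
  · simpa [pow_succ, mul_assoc] using this
  · refine (h r).trans ?_
    have h1 : |r| ≤ |s| := by simpa using abs_sub_left_of_mem_uIcc hr
    gcongr

lemma hasDerivAt_line {v : Space d → ℝ} (hv : Differentiable ℝ v) (x l : Space d) (s : ℝ) :
    HasDerivAt (fun s : ℝ => v (x + s • l)) (fderiv ℝ v (x + s • l) l) s := by
  have h1 : HasDerivAt (fun s : ℝ => x + s • l) l s := by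
    simpa using ((hasDerivAt_id s).smul_const l).const_add x
  exact (hv (x + s • l)).hasFDerivAt.comp_hasDerivAt s h1

/-- The square of the gradient of a nonnegative function is controlled by the function. -/
theorem sq_partialDeriv_le {q : Space d → ℝ} (hq : SmoothBdd q) (h0 : ∀ x, 0 ≤ q x) {i : Fin d}
    {K : ℝ} (hK : ∀ x, |partialDeriv i (partialDeriv i q) x| ≤ K) (x : Space d) :
    partialDeriv i q x ^ 2 ≤ 4 * K * q x := by
  set e : Space d := EuclideanSpace.single i 1
  have hd : ∀ s, HasDerivAt (fun s : ℝ => q (x + s • e)) (partialDeriv i q (x + s • e)) s :=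
    fun s => hasDerivAt_line hq.differentiable x e s
  have hd2 : ∀ s, HasDerivAt (fun s : ℝ => partialDeriv i q (x + s • e))
      (partialDeriv i (partialDeriv i q) (x + s • e)) s :=
    fun s => hasDerivAt_line (hq.partial_ i).differentiable x e s
  have h1 := abs_sub_le_of_deriv_le hd2 (C := K) 0 (fun s => by simpa using hK _)
  have h2 := abs_sub_le_of_deriv_le (φ := fun s : ℝ => q (x + s • e) - partialDeriv i q x * s)
    (φ' := fun s => partialDeriv i q (x + s • e) - partialDeriv i q x) (C := K)
    (fun s => by
      have h := (hd s).fun_sub ((hasDerivAt_id s).const_mul (partialDeriv i q x))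
      simpa using h) 1 (fun s => by simpa using h1 s)
  -- Taylor's inequality and `q ≥ 0` at `x + s • e` make this quadratic in `s` nonnegative, and its
  -- discriminant is the claim. The remainder is `K s²` rather than `K s² / 2`, hence the constant
  -- four.
  have h3 : ∀ s : ℝ, 0 ≤ K * (s * s) + partialDeriv i q x * s + q x := by
    intro s
    have h4 := (abs_le.1 (h2 s)).2
    have h5 := h0 (x + s • e)
    simp only [zero_smul, add_zero, mul_zero, sub_zero, sq_abs, Nat.reduceAdd] at h4
    nlinarith
  have h6 := discrim_le_zero h3
  rw [discrim] at h6
  linarith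

/-! ### The discrete Bernstein estimate -/

/-- The words of length at most `m`. -/
def words (d m : ℕ) : Finset (List (Fin d)) := (List.finite_length_le (Fin d) m).toFinset

lemma mem_words {m : ℕ} {w : List (Fin d)} : w ∈ words d m ↔ w.length ≤ m := by
  simp [words]

/-- The sum of the squares of the derivatives up to order `m`. -/
def energy (m : ℕ) (v : Space d → ℝ) (x : Space d) : ℝ := ∑ w ∈ words d m, wordDeriv w v x ^ 2

/-- The number of terms in all Leibniz formulas for derivatives up to order `m`. -/
def pairCount (d m : ℕ) : ℕ := ∑ w ∈ words d m, (subwordPairs w).length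

/-- The unit vectors `e_i` and `-e_i`. -/
def unitVec (e : Fin d × Bool) : Space d :=
  if e.2 then EuclideanSpace.single e.1 1 else -EuclideanSpace.single e.1 1

lemma norm_unitVec (e : Fin d × Bool) : ‖unitVec e‖ ≤ 1 := by
  unfold unitVec; split_ifs <;> simp

/-- The bounded operator approximating a degenerate elliptic operator. -/
def approxOp (δ : ℝ) (Λ : Finset (Space d)) (q : Space d → Space d → ℝ)
    (r : Fin d × Bool → Space d → ℝ) (c : Space d → ℝ) (v : Space d → ℝ) (x : Space d) : ℝ :=
  (∑ l ∈ Λ, 1 / 2 * (q l x * jumpOp δ l v x)) + (∑ e, r e x * diffQuot δ (unitVec e) v x)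
    + c x * v x

/-- Smooth coefficients with bounds on the derivatives up to order `m`. -/
structure SmoothCoeffs (m : ℕ) (K : ℝ) (Λ : Finset (Space d)) (q : Space d → Space d → ℝ)
    (r : Fin d × Bool → Space d → ℝ) (c : Space d → ℝ) : Prop where
  q_smooth : ∀ l ∈ Λ, SmoothBdd (q l)
  q_nonneg : ∀ l ∈ Λ, ∀ x, 0 ≤ q l x
  q_bound : ∀ l ∈ Λ, ∀ a : List (Fin d), a.length ≤ m → ∀ x, |wordDeriv a (q l) x| ≤ K
  r_smooth : ∀ e, SmoothBdd (r e)
  r_nonneg : ∀ e x, 0 ≤ r e x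
  r_bound : ∀ e, ∀ a : List (Fin d), a.length ≤ m → ∀ x, |wordDeriv a (r e) x| ≤ K
  c_smooth : SmoothBdd c
  c_bound : ∀ a : List (Fin d), a.length ≤ m → ∀ x, |wordDeriv a c x| ≤ K

section

variable {m : ℕ} {K : ℝ} {Λ : Finset (Space d)} {q : Space d → Space d → ℝ}
  {r : Fin d × Bool → Space d → ℝ} {c : Space d → ℝ}

lemma SmoothCoeffs.K_nonneg (h : SmoothCoeffs m K Λ q r c) : 0 ≤ K :=
  (abs_nonneg _).trans (h.c_bound [] (by simp) 0)

lemma SmoothCoeffs.smoothBdd_approxOp (h : SmoothCoeffs m K Λ q r c) (δ : ℝ)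
    {v : Space d → ℝ} (hv : SmoothBdd v) : SmoothBdd (approxOp δ Λ q r c v) :=
  ((SmoothBdd.finset_sum _ fun l hl => ((h.q_smooth l hl).mul (hv.jumpOp δ l)).const_mul _).add
    (SmoothBdd.finset_sum _ fun e _ => (h.r_smooth e).mul (hv.diffQuot δ _))).add
    (h.c_smooth.mul hv)

lemma SmoothCoeffs.wordDeriv_approxOp (h : SmoothCoeffs m K Λ q r c) (δ : ℝ)
    {v : Space d → ℝ} (hv : SmoothBdd v) (w : List (Fin d)) (x : Space d) :
    wordDeriv w (approxOp δ Λ q r c v) x =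
      (∑ l ∈ Λ, 1 / 2 * (q l x * jumpOp δ l (wordDeriv w v) x + ((subwordPairs w).map fun p =>
        wordDeriv p.1 (q l) x * jumpOp δ l (wordDeriv p.2 v) x).sum)) +
      (∑ e, (r e x * diffQuot δ (unitVec e) (wordDeriv w v) x + ((subwordPairs w).map fun p =>
        wordDeriv p.1 (r e) x * diffQuot δ (unitVec e) (wordDeriv p.2 v) x).sum)) +
      (c x * wordDeriv w v x + ((subwordPairs w).map fun p =>
        wordDeriv p.1 c x * wordDeriv p.2 v x).sum) := by
  have hq : ∀ l ∈ Λ, SmoothBdd (fun x => q l x * jumpOp δ l v x) :=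
    fun l hl => (h.q_smooth l hl).mul (hv.jumpOp δ l)
  have hr : ∀ e ∈ Finset.univ, SmoothBdd (fun x => r e x * diffQuot δ (unitVec e) v x) :=
    fun e _ => (h.r_smooth e).mul (hv.diffQuot δ _)
  have h1 : approxOp δ Λ q r c v = fun x => ((∑ l ∈ Λ, 1 / 2 * (q l x * jumpOp δ l v x)) +
    (∑ e, r e x * diffQuot δ (unitVec e) v x)) + c x * v x := rfl
  rw [h1, wordDeriv_add w ((SmoothBdd.finset_sum _ fun l hl => (hq l hl).const_mul _).add
    (SmoothBdd.finset_sum _ hr)) (h.c_smooth.mul hv),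
    wordDeriv_add w (SmoothBdd.finset_sum _ fun l hl => (hq l hl).const_mul _)
    (SmoothBdd.finset_sum _ hr), wordDeriv_finset_sum _ _ fun l hl => (hq l hl).const_mul _,
    wordDeriv_finset_sum _ _ hr, wordDeriv_mul w h.c_smooth hv]
  dsimp only
  congr 2
  · refine Finset.sum_congr rfl fun l hl => ?_
    rw [wordDeriv_const_mul w _ (hq l hl), wordDeriv_mul w (h.q_smooth l hl) (hv.jumpOp δ l)]
    simp_rw [wordDeriv_jumpOp hv]
  · refine Finset.sum_congr rfl fun e _ => ?_
    rw [wordDeriv_mul w (h.r_smooth e) (hv.diffQuot δ _)]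
    simp_rw [wordDeriv_diffQuot hv]

end

/-! ### Energy inequalities for the terms of second, first and zero order. -/

section

variable {m : ℕ} {v : Space d → ℝ} {s : ℝ}

lemma abs_wordDeriv_le (hs : 0 ≤ s) {x : Space d} (hE : energy m v x ≤ s ^ 2) {w : List (Fin d)}
    (hw : w.length ≤ m) : |wordDeriv w v x| ≤ s := by
  refine abs_le_of_sq_le_sq (le_trans ?_ hE) hs
  exact Finset.single_le_sum (f := fun w => wordDeriv w v x ^ 2) (fun _ _ => sq_nonneg _)
    (mem_words.2 hw)

/-- Makes the gradient of `D^b v`, or its carré du champ, a part of the full sum over `words d m`.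
-/
lemma sum_cons_le_sum_words {F : List (Fin d) → ℝ} (hF : ∀ w, 0 ≤ F w) {b : List (Fin d)}
    (hb : b.length + 1 ≤ m) : ∑ i, F (i :: b) ≤ ∑ w ∈ words d m, F w := by
  have hinj : Set.InjOn (fun i : Fin d => i :: b) (Finset.univ : Finset (Fin d)) :=
    fun i _ j _ hij => (List.cons.inj hij).1
  rw [← Finset.sum_image hinj]
  refine Finset.sum_le_sum_of_subset_of_nonneg (fun w hw => ?_) fun _ _ _ => hF _
  obtain ⟨i, _, rfl⟩ := Finset.mem_image.1 hw
  exact mem_words.2 (by simpa using hb)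

lemma grad_wordDeriv_le (hE : ∀ x, energy m v x ≤ s ^ 2) {b : List (Fin d)}
    (hb : b.length + 1 ≤ m) (x : Space d) :
    ∑ i, partialDeriv i (wordDeriv b v) x ^ 2 ≤ s ^ 2 :=
  (sum_cons_le_sum_words (F := fun w => wordDeriv w v x ^ 2) (fun _ => sq_nonneg _) hb).trans
    (hE x)

lemma abs_jumpOp_le {u : Space d → ℝ} {B : ℝ}
    (hB : ∀ x, |u x| ≤ B) (δ : ℝ) (l x : Space d) : |jumpOp δ l u x| ≤ 12 / δ ^ 2 * B := by
  have h2 : volume.real (Icc (-1 : ℝ) 1) = 2 := by simp; norm_num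
  rw [jumpOp, abs_mul, abs_of_nonneg (by positivity : (0:ℝ) ≤ 3 / δ ^ 2)]
  have := norm_setIntegral_le_of_norm_le_const (μ := volume) (s := Icc (-1 : ℝ) 1) (C := B + B)
      (f := fun θ => u (x + (δ * θ) • l) - u x) measure_Icc_lt_top
      (fun θ _ => (abs_sub _ _).trans (add_le_add (hB _) (hB _)))
  rw [h2] at this
  calc _ ≤ 3 / δ ^ 2 * ((B + B) * 2) := by gcongr; exact this
    _ = _ := by ring

lemma abs_diffQuot_le_of_bdd {u : Space d → ℝ} {B : ℝ} (hB : ∀ x, |u x| ≤ B) {δ : ℝ} (hδ : 0 < δ)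
    (y x : Space d) : |diffQuot δ y u x| ≤ 2 / δ * B := by
  rw [diffQuot, abs_div, abs_of_pos hδ, div_le_iff₀ hδ]
  calc _ ≤ B + B := (abs_sub _ _).trans (add_le_add (hB _) (hB _))
    _ = _ := by field_simp; ring

/-- The commutator terms of second order are absorbed by the carré du champ. -/
lemma second_order_commutator_le (hm : 2 ≤ m) (hv : SmoothBdd v) (hs : 0 ≤ s)
    (hE : ∀ x, energy m v x ≤ s ^ 2) {q : Space d → ℝ} (hq : SmoothBdd q) (hq0 : ∀ x, 0 ≤ q x)
    {K : ℝ} (hK : ∀ a : List (Fin d), a.length ≤ m → ∀ x, |wordDeriv a q x| ≤ K)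
    {δ : ℝ} (hδ : 0 < δ) (l x : Space d) {w : List (Fin d)} (hw : w.length ≤ m)
    {p : List (Fin d) × List (Fin d)} (hp : p ∈ subwordPairs w) {η : ℝ} (hη : 0 < η) :
    |wordDeriv w v x * (wordDeriv p.1 q x * jumpOp δ l (wordDeriv p.2 v) x)| ≤
      η * (q x * ∑ w ∈ words d m, jumpGamma δ l (wordDeriv w v) x) +
        (24 * K / η + 12 * (d + 1) * K) * (‖l‖ ^ 2 * s ^ 2) := by
  obtain ⟨hp1, hp2⟩ := subwordPairs_length hp
  have hK0 : 0 ≤ K := (abs_nonneg _).trans (hK [] (by simp) x)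
  set G := ∑ w ∈ words d m, jumpGamma δ l (wordDeriv w v) x with hG
  have hG0 : 0 ≤ G := Finset.sum_nonneg fun _ _ => jumpGamma_nonneg _ _ _ _
  have hqx := hq0 x
  have hZ := abs_wordDeriv_le hs (hE x) hw
  have hY := sq_jumpOp_le (hv.iterate p.2) hδ l x
  rw [abs_mul]
  refine (mul_le_mul_of_nonneg_right hZ (abs_nonneg _)).trans ?_
  -- One derivative on `q` leaves up to `m - 1` on `v`, and with the jump operator this has order `m
  -- + 1`: only the carré du champ can pay. Two or more derivatives on `q` leave at most `m - 2` on
  -- `v`, and the energy bound suffices.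
  rcases hp1.eq_or_lt with h1 | h1
  · obtain ⟨i, hi⟩ := List.length_eq_one_iff.1 h1.symm
    have hX : wordDeriv p.1 q x ^ 2 ≤ 4 * K * q x := by
      rw [hi]
      exact sq_partialDeriv_le hq hq0 (fun y => hK [i, i] (by simpa using hm) y) x
    have hY' : jumpOp δ l (wordDeriv p.2 v) x ^ 2 ≤ 24 * ‖l‖ ^ 2 * G := by
      refine hY.trans (mul_le_mul_of_nonneg_left ?_ (by positivity))
      exact sum_cons_le_sum_words (F := fun w => jumpGamma δ l (wordDeriv w v) x)
        (fun _ => jumpGamma_nonneg _ _ _ _) (by omega)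
    have h2 : s * |wordDeriv p.1 q x * jumpOp δ l (wordDeriv p.2 v) x| ≤
        η * (q x * G) + 24 * K / η * (‖l‖ ^ 2 * s ^ 2) := by
      -- Young's inequality in squared form, `4ab ≤ (a + b)²` with `a` and `b` the two terms on the
      -- right; `η` cancels in their product.
      refine le_of_sq_le_sq ?_ (by positivity)
      rw [mul_pow, sq_abs, mul_pow]
      calc s ^ 2 * (wordDeriv p.1 q x ^ 2 * jumpOp δ l (wordDeriv p.2 v) x ^ 2)
          ≤ s ^ 2 * ((4 * K * q x) * (24 * ‖l‖ ^ 2 * G)) := by gcongr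
        _ = 4 * (η * (q x * G)) * (24 * K / η * (‖l‖ ^ 2 * s ^ 2)) := by field_simp
        _ ≤ _ := by
          nlinarith [sq_nonneg (η * (q x * G) - 24 * K / η * (‖l‖ ^ 2 * s ^ 2))]
    have h3 : 0 ≤ 12 * (d + 1) * K * (‖l‖ ^ 2 * s ^ 2) := by positivity
    linarith
  · have hY' : |jumpOp δ l (wordDeriv p.2 v) x| ≤ 12 * (d + 1) * ‖l‖ ^ 2 * s := by
      refine abs_le_of_sq_le_sq (hY.trans ?_) (by positivity)
      have h4 : ∀ i, jumpGamma δ l (partialDeriv i (wordDeriv p.2 v)) x ≤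
          6 * ‖l‖ ^ 2 * s ^ 2 := fun i =>
        jumpGamma_le ((hv.iterate p.2).partial_ i).differentiable hs
          (fun y => grad_wordDeriv_le (b := i :: p.2) hE (by simp; omega) y) hδ l x
      calc _ ≤ 24 * ‖l‖ ^ 2 * ∑ i : Fin d, 6 * ‖l‖ ^ 2 * s ^ 2 := by
            gcongr with i; exact h4 i
        _ = 144 * (‖l‖ ^ 2 * s) ^ 2 * d := by simp; ring
        _ ≤ 144 * (‖l‖ ^ 2 * s) ^ 2 * (d + 1) ^ 2 := by gcongr; nlinarith [(Nat.cast_nonneg d : (0:ℝ) ≤ d)]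
        _ = _ := by ring
    have hX := hK p.1 (by omega) x
    have h5 : 0 ≤ η * (q x * G) := by positivity
    have h6 : 0 ≤ 24 * K / η * (‖l‖ ^ 2 * s ^ 2) := by positivity
    rw [abs_mul]
    calc s * (|wordDeriv p.1 q x| * |jumpOp δ l (wordDeriv p.2 v) x|)
        ≤ s * (K * (12 * (d + 1) * ‖l‖ ^ 2 * s)) := by gcongr
      _ = 12 * (d + 1) * K * (‖l‖ ^ 2 * s ^ 2) := by ring
      _ ≤ _ := by linarith

lemma list_sum_commutator_le {ι : Type*} (l : List ι) (a : ℝ) (F : ι → ℝ) (B : ℝ)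
    (h : ∀ k ∈ l, |a * F k| ≤ B) : a * (l.map F).sum ≤ l.length * B := by
  rw [← List.sum_map_mul_left]
  exact list_sum_le_length_mul l _ B fun k hk => (le_abs_self _).trans (h k hk)

lemma sum_words_list_le (F : List (Fin d) → ℝ) (B : ℝ)
    (h : ∀ w, w.length ≤ m → F w ≤ (subwordPairs w).length * B) :
    ∑ w ∈ words d m, F w ≤ pairCount d m * B := by
  rw [pairCount, Nat.cast_sum, Finset.sum_mul]
  exact Finset.sum_le_sum fun w hw => h w (mem_words.1 hw)

/-- There is no factor two before `wordDeriv w v x` because `approxOp` carries `1 / 2`. The term of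
size `1 / δ²` is harmless: it multiplies the deficit `s ^ 2 - energy m v x`, which a small time step
absorbs. -/
lemma second_order_energy_le (hm : 2 ≤ m) (hv : SmoothBdd v) (hs : 0 ≤ s)
    (hE : ∀ x, energy m v x ≤ s ^ 2) {q : Space d → ℝ} (hq : SmoothBdd q) (hq0 : ∀ x, 0 ≤ q x)
    {K : ℝ} (hK : ∀ a : List (Fin d), a.length ≤ m → ∀ x, |wordDeriv a q x| ≤ K)
    {δ : ℝ} (hδ : 0 < δ) (l x : Space d) :
    ∑ w ∈ words d m, wordDeriv w v x * (q x * jumpOp δ l (wordDeriv w v) x +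
      ((subwordPairs w).map fun p =>
        wordDeriv p.1 q x * jumpOp δ l (wordDeriv p.2 v) x).sum) ≤
      3 / δ ^ 2 * K * (s ^ 2 - energy m v x) + pairCount d m *
        ((24 * K * (2 * (pairCount d m + 1)) + 12 * (d + 1) * K) * (‖l‖ ^ 2 * s ^ 2)) := by
  set P : ℝ := (pairCount d m : ℝ) with hP
  have hP0 : 0 ≤ P := Nat.cast_nonneg _
  set G := ∑ w ∈ words d m, jumpGamma δ l (wordDeriv w v) x with hG
  have hG0 : 0 ≤ G := Finset.sum_nonneg fun _ _ => jumpGamma_nonneg _ _ _ _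
  have hqx := hq0 x
  have hqK : q x ≤ K := (le_abs_self _).trans (hK [] (by simp) x)
  -- With this `η` the `P` commutators together use the fraction `P / (2(P + 1)) ≤ 1 / 2` of `q x *
  -- G`, no more than the good term provides.
  have hη : (0 : ℝ) < 1 / (2 * (P + 1)) := by positivity
  have h1 := sum_words_list_le (m := m) (fun w => wordDeriv w v x * ((subwordPairs w).map fun p =>
        wordDeriv p.1 q x * jumpOp δ l (wordDeriv p.2 v) x).sum) _ (fun w hw =>
    list_sum_commutator_le _ _ _ _ fun p hp =>
      second_order_commutator_le hm hv hs hE hq hq0 hK hδ l x hw hp hη)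
  rw [← hP, ← hG] at h1
  have h2 : ∑ w ∈ words d m, wordDeriv w v x * (q x * jumpOp δ l (wordDeriv w v) x) =
      1 / 2 * q x * (∑ w ∈ words d m, jumpOp δ l (fun y => wordDeriv w v y ^ 2) x) -
        1 / 2 * (q x * G) := by
    rw [hG, Finset.mul_sum, Finset.mul_sum, Finset.mul_sum, ← Finset.sum_sub_distrib]
    refine Finset.sum_congr rfl fun w _ => ?_
    have := two_mul_jumpOp (hv w).1.continuous δ l x
    linear_combination (1 / 2 * q x) * this
  -- Summed over the words, the jump operator acts on the energy, which is at most `s ^ 2` at every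
  -- landing point.
  have h3 : ∑ w ∈ words d m, jumpOp δ l (fun y => wordDeriv w v y ^ 2) x ≤
      6 / δ ^ 2 * (s ^ 2 - energy m v x) := by
    simp only [jumpOp]
    have hc : ∀ w ∈ words d m, Continuous fun θ : ℝ =>
        wordDeriv w v (x + (δ * θ) • l) ^ 2 - wordDeriv w v x ^ 2 :=
      fun w _ => continuous_jump ((hv w).1.continuous.pow 2) δ l x
    rw [← Finset.mul_sum, ← integral_finsetSum _ fun w hw => (hc w hw).integrableOn_Icc]
    have h4 : ∫ θ in Icc (-1 : ℝ) 1, ∑ w ∈ words d m,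
        (wordDeriv w v (x + (δ * θ) • l) ^ 2 - wordDeriv w v x ^ 2) ≤
        ∫ θ in Icc (-1 : ℝ) 1, (s ^ 2 - energy m v x) := by
      refine integral_mono (continuous_finsetSum _ hc).integrableOn_Icc
        (by simp) fun θ => ?_
      dsimp only
      rw [Finset.sum_sub_distrib]
      exact sub_le_sub_right (hE _) _
    have h5 : (volume.restrict (Icc (-1 : ℝ) 1)).real univ = 2 := by
      simp [Measure.real]; norm_num
    rw [integral_const, h5, smul_eq_mul] at h4
    calc _ ≤ 3 / δ ^ 2 * (2 * (s ^ 2 - energy m v x)) := by gcongr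
      _ = _ := by ring
  have h6 : 1 / 2 * q x * (∑ w ∈ words d m, jumpOp δ l (fun y => wordDeriv w v y ^ 2) x) ≤
      3 / δ ^ 2 * K * (s ^ 2 - energy m v x) := by
    have h7 : 0 ≤ s ^ 2 - energy m v x := sub_nonneg.2 (hE x)
    calc _ ≤ 1 / 2 * q x * (6 / δ ^ 2 * (s ^ 2 - energy m v x)) := by gcongr
      _ = 3 / δ ^ 2 * q x * (s ^ 2 - energy m v x) := by ring
      _ ≤ _ := by gcongr
  have h8 : P * (1 / (2 * (P + 1)) * (q x * G)) ≤ 1 / 2 * (q x * G) := by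
    rw [← mul_assoc]
    refine mul_le_mul_of_nonneg_right ?_ (by positivity)
    rw [mul_one_div, div_le_iff₀ (by positivity)]
    linarith
  have h9 : 24 * K / (1 / (2 * (P + 1))) = 24 * K * (2 * (P + 1)) := by
    rw [div_div_eq_mul_div, div_one]
  rw [h9, mul_add] at h1
  simp_rw [mul_add (wordDeriv _ v x), Finset.sum_add_distrib]
  rw [h2]
  linarith

/-- The principal term uses `2a(b - a) ≤ b² - a²` and the sign of the rate. In the commutators at
most `m - 1` derivatives remain on `v`, so the difference quotient is bounded through a gradient,
uniformly in `δ`. -/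
lemma first_order_energy_le (hv : SmoothBdd v) (hs : 0 ≤ s)
    (hE : ∀ x, energy m v x ≤ s ^ 2) {r : Space d → ℝ} (hr0 : ∀ x, 0 ≤ r x)
    {K : ℝ} (hK : ∀ a : List (Fin d), a.length ≤ m → ∀ x, |wordDeriv a r x| ≤ K)
    {δ : ℝ} (hδ : 0 < δ) (x : Space d) {y : Space d} (hy : ‖y‖ ≤ 1) :
    ∑ w ∈ words d m, 2 * wordDeriv w v x * (r x * diffQuot δ y (wordDeriv w v) x +
      ((subwordPairs w).map fun p =>
        wordDeriv p.1 r x * diffQuot δ y (wordDeriv p.2 v) x).sum) ≤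
      1 / δ * K * (s ^ 2 - energy m v x) + pairCount d m * (2 * K * s ^ 2) := by
  have hrx := hr0 x
  have hrK : r x ≤ K := (le_abs_self _).trans (hK [] (by simp) x)
  have h1 := sum_words_list_le (m := m) (fun w => 2 * wordDeriv w v x *
      ((subwordPairs w).map fun p =>
        wordDeriv p.1 r x * diffQuot δ y (wordDeriv p.2 v) x).sum) (2 * K * s ^ 2) (fun w hw =>
    list_sum_commutator_le _ _ _ _ fun p hp => by
      obtain ⟨hp1, hp2⟩ := subwordPairs_length hp
      have h2 := abs_wordDeriv_le hs (hE x) hw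
      have h3 := hK p.1 (by omega) x
      have h4 := abs_diffQuot_le (hv p.2).1 hs
        (fun z => grad_wordDeriv_le hE (by omega) z) hδ hy x
      have h5 : 0 ≤ K := (abs_nonneg _).trans h3
      rw [abs_mul, abs_mul, abs_mul, abs_two]
      calc 2 * |wordDeriv w v x| * (|wordDeriv p.1 r x| * |diffQuot δ y (wordDeriv p.2 v) x|)
          ≤ 2 * s * (K * s) := by gcongr
        _ = _ := by ring)
  have h2 : ∑ w ∈ words d m, 2 * wordDeriv w v x * (r x * diffQuot δ y (wordDeriv w v) x) ≤
      1 / δ * K * (s ^ 2 - energy m v x) := by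
    have h7 : 0 ≤ s ^ 2 - energy m v x := sub_nonneg.2 (hE x)
    calc _ ≤ ∑ w ∈ words d m, 1 / δ * r x *
          (wordDeriv w v (x + δ • y) ^ 2 - wordDeriv w v x ^ 2) := by
          refine Finset.sum_le_sum fun w _ => ?_
          have : 2 * wordDeriv w v x * (r x * diffQuot δ y (wordDeriv w v) x) = 1 / δ * r x *
            (2 * wordDeriv w v x * (wordDeriv w v (x + δ • y) - wordDeriv w v x)) := by
            rw [diffQuot]; ring
          rw [this]
          refine mul_le_mul_of_nonneg_left ?_ (by positivity)
          nlinarith [sq_nonneg (wordDeriv w v (x + δ • y) - wordDeriv w v x)]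
      _ = 1 / δ * r x * (energy m v (x + δ • y) - energy m v x) := by
          rw [← Finset.mul_sum, Finset.sum_sub_distrib]; rfl
      _ ≤ 1 / δ * r x * (s ^ 2 - energy m v x) := by gcongr; exact hE _
      _ ≤ _ := by gcongr
  simp_rw [mul_add (2 * wordDeriv _ v x), Finset.sum_add_distrib]
  linarith

lemma zero_order_energy_le (hs : 0 ≤ s)
    (hE : ∀ x, energy m v x ≤ s ^ 2) {c : Space d → ℝ}
    {K : ℝ} (hK : ∀ a : List (Fin d), a.length ≤ m → ∀ x, |wordDeriv a c x| ≤ K) (x : Space d) :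
    ∑ w ∈ words d m, 2 * wordDeriv w v x * (c x * wordDeriv w v x +
      ((subwordPairs w).map fun p => wordDeriv p.1 c x * wordDeriv p.2 v x).sum) ≤
      ((words d m).card + pairCount d m) * (2 * K * s ^ 2) := by
  have h1 := sum_words_list_le (m := m) (fun w => 2 * wordDeriv w v x *
      ((subwordPairs w).map fun p =>
        wordDeriv p.1 c x * wordDeriv p.2 v x).sum) (2 * K * s ^ 2) (fun w hw =>
    list_sum_commutator_le _ _ _ _ fun p hp => by
      obtain ⟨hp1, hp2⟩ := subwordPairs_length hp
      have h2 := abs_wordDeriv_le hs (hE x) hw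
      have h3 := hK p.1 (by omega) x
      have h4 := abs_wordDeriv_le hs (hE x) (w := p.2) (by omega)
      have h5 : 0 ≤ K := (abs_nonneg _).trans h3
      rw [abs_mul, abs_mul, abs_mul, abs_two]
      calc 2 * |wordDeriv w v x| * (|wordDeriv p.1 c x| * |wordDeriv p.2 v x|)
          ≤ 2 * s * (K * s) := by gcongr
        _ = _ := by ring)
  have h2 : ∑ w ∈ words d m, 2 * wordDeriv w v x * (c x * wordDeriv w v x) ≤
      (words d m).card * (2 * K * s ^ 2) := by
    rw [← nsmul_eq_mul]
    refine Finset.sum_le_card_nsmul _ _ _ fun w hw => (le_abs_self _).trans ?_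
    have h2 := abs_wordDeriv_le hs (hE x) (mem_words.1 hw)
    have h3 := hK [] (by simp) x
    rw [wordDeriv_nil] at h3
    have h5 : 0 ≤ K := (abs_nonneg _).trans h3
    rw [abs_mul, abs_mul, abs_mul, abs_two]
    calc 2 * |wordDeriv w v x| * (|c x| * |wordDeriv w v x|) ≤ 2 * s * (K * s) := by gcongr
      _ = _ := by ring
  simp_rw [mul_add (2 * wordDeriv _ v x), Finset.sum_add_distrib]
  linarith

end

/-! ### The discrete Bernstein inequality and one Euler step. -/

section

variable {m : ℕ} {K : ℝ} {Λ : Finset (Space d)} {q : Space d → Space d → ℝ}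
  {r : Fin d × Bool → Space d → ℝ} {c : Space d → ℝ} {v : Space d → ℝ} {s : ℝ}

/-- The constant in the Bernstein estimate; `L2` stands for the sum of `‖l‖ ^ 2`. -/
def bernsteinConst (d m : ℕ) (K L2 : ℝ) : ℝ :=
  pairCount d m * (24 * K * (2 * (pairCount d m + 1)) + 12 * (d + 1) * K) * L2 +
    d * 2 * (pairCount d m * (2 * K)) + ((words d m).card + pairCount d m) * (2 * K)

/-- The coefficient of the deficit blows up as `δ → 0`, while that of `s ^ 2` depends neither on `δ`
nor on the number of elements of `Λ`. The deficit therefore must not be replaced by `s ^ 2`. -/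
theorem SmoothCoeffs.bernstein (h : SmoothCoeffs m K Λ q r c) (hm : 2 ≤ m) (hv : SmoothBdd v)
    (hs : 0 ≤ s) (hE : ∀ x, energy m v x ≤ s ^ 2) {δ : ℝ} (hδ : 0 < δ) (x : Space d) :
    ∑ w ∈ words d m, 2 * wordDeriv w v x * wordDeriv w (approxOp δ Λ q r c v) x ≤
      (Λ.card * (3 / δ ^ 2 * K) + d * 2 * (1 / δ * K)) * (s ^ 2 - energy m v x) +
        bernsteinConst d m K (∑ l ∈ Λ, ‖l‖ ^ 2) * s ^ 2 := by
  have h2 := Finset.sum_le_sum fun l hl => second_order_energy_le hm hv hs hE (h.q_smooth l hl)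
    (h.q_nonneg l hl) (h.q_bound l hl) hδ l x
  have h1 := Finset.sum_le_sum fun e (_ : e ∈ Finset.univ) => first_order_energy_le hv hs hE
    (h.r_nonneg e) (h.r_bound e) hδ x (norm_unitVec e)
  have h0 := zero_order_energy_le hs hE h.c_bound x
  rw [Finset.sum_add_distrib, ← Finset.mul_sum, ← Finset.mul_sum, ← Finset.mul_sum,
    ← Finset.sum_mul, Finset.sum_const, nsmul_eq_mul] at h2
  rw [Finset.sum_const, nsmul_eq_mul, Finset.card_univ, Fintype.card_prod, Fintype.card_fin,
    Fintype.card_bool] at h1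
  have heq : ∑ w ∈ words d m, 2 * wordDeriv w v x * wordDeriv w (approxOp δ Λ q r c v) x =
      (∑ l ∈ Λ, ∑ w ∈ words d m, wordDeriv w v x * (q l x * jumpOp δ l (wordDeriv w v) x +
      ((subwordPairs w).map fun p =>
        wordDeriv p.1 (q l) x * jumpOp δ l (wordDeriv p.2 v) x).sum)) +
      (∑ e, ∑ w ∈ words d m, 2 * wordDeriv w v x *
        (r e x * diffQuot δ (unitVec e) (wordDeriv w v) x +
      ((subwordPairs w).map fun p =>
        wordDeriv p.1 (r e) x * diffQuot δ (unitVec e) (wordDeriv p.2 v) x).sum)) +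
      ∑ w ∈ words d m, 2 * wordDeriv w v x * (c x * wordDeriv w v x +
      ((subwordPairs w).map fun p => wordDeriv p.1 c x * wordDeriv p.2 v x).sum) := by
    rw [Finset.sum_comm, Finset.sum_comm (s := Finset.univ), ← Finset.sum_add_distrib,
      ← Finset.sum_add_distrib]
    refine Finset.sum_congr rfl fun w _ => ?_
    rw [h.wordDeriv_approxOp δ hv, mul_add, mul_add, Finset.mul_sum, Finset.mul_sum]
    congr 2
    refine Finset.sum_congr rfl fun l _ => ?_
    ring
  rw [heq, bernsteinConst]
  push_cast at h1
  linarith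

/-- A crude bound for the norm of `approxOp`. -/
def crudeConst (d m : ℕ) (K δ : ℝ) (n : ℕ) : ℝ :=
  n * (1 / 2 * ((1 + pairCount d m) * (K * (12 / δ ^ 2)))) +
    d * 2 * ((1 + pairCount d m) * (K * (2 / δ))) + (1 + pairCount d m) * K

lemma length_subwordPairs_le {w : List (Fin d)} (hw : w.length ≤ m) :
    ((subwordPairs w).length : ℝ) ≤ pairCount d m := by
  exact_mod_cast Finset.single_le_sum (f := fun w : List (Fin d) => (subwordPairs w).length)
    (fun _ _ => Nat.zero_le _) (mem_words.2 hw)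

lemma abs_leibniz_le {B K : ℝ} (hB : 0 ≤ B) {w : List (Fin d)} (hw : w.length ≤ m) {f : Space d → ℝ}
    {F : List (Fin d) → ℝ} {x : Space d}
    (hK : ∀ a : List (Fin d), a.length ≤ m → |wordDeriv a f x| ≤ K)
    (hF : ∀ b : List (Fin d), b.length ≤ m → |F b| ≤ B) :
    |f x * F w + ((subwordPairs w).map fun p => wordDeriv p.1 f x * F p.2).sum| ≤
      (1 + pairCount d m) * (K * B) := by
  have hK0 : 0 ≤ K := (abs_nonneg _).trans (hK [] (by simp))
  refine (abs_add_le _ _).trans ?_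
  rw [add_mul, one_mul]
  refine add_le_add ?_ ((abs_list_sum_le _ _).trans ((list_sum_le_length_mul _ _ (K * B)
    fun p hp => ?_).trans (mul_le_mul_of_nonneg_right (length_subwordPairs_le hw) (by positivity))))
  · rw [abs_mul]
    exact mul_le_mul (hK [] (by simp)) (hF w hw) (abs_nonneg _) hK0
  · obtain ⟨hp1, hp2⟩ := subwordPairs_length hp
    rw [abs_mul]
    exact mul_le_mul (hK _ (by omega)) (hF _ (by omega)) (abs_nonneg _) hK0

/-- This bound grows as `δ → 0`. It is used only in the term of an Euler step quadratic in `τ`,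
where `τ` may be chosen small depending on `δ`. -/
theorem SmoothCoeffs.crude (h : SmoothCoeffs m K Λ q r c) (hv : SmoothBdd v)
    (hs : 0 ≤ s) (hE : ∀ x, energy m v x ≤ s ^ 2) {δ : ℝ} (hδ : 0 < δ) (x : Space d)
    {w : List (Fin d)} (hw : w.length ≤ m) :
    |wordDeriv w (approxOp δ Λ q r c v) x| ≤ crudeConst d m K δ Λ.card * s := by
  rw [h.wordDeriv_approxOp δ hv]
  have hb : ∀ b : List (Fin d), b.length ≤ m → ∀ y, |wordDeriv b v y| ≤ s :=
    fun b hb y => abs_wordDeriv_le hs (hE y) hb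
  have h2 : ∀ l ∈ Λ, |1 / 2 * (q l x * jumpOp δ l (wordDeriv w v) x + ((subwordPairs w).map fun p =>
        wordDeriv p.1 (q l) x * jumpOp δ l (wordDeriv p.2 v) x).sum)| ≤
      1 / 2 * ((1 + pairCount d m) * (K * (12 / δ ^ 2 * s))) := fun l hl => by
    rw [abs_mul, abs_of_pos (by norm_num : (0:ℝ) < 1 / 2)]
    gcongr
    exact abs_leibniz_le (F := fun b => jumpOp δ l (wordDeriv b v) x) (by positivity) hw
      (fun a ha => h.q_bound l hl a ha x)
      fun b hb' => abs_jumpOp_le (hb b hb') δ l x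
  have h1 : ∀ e ∈ Finset.univ, |r e x * diffQuot δ (unitVec e) (wordDeriv w v) x +
      ((subwordPairs w).map fun p =>
        wordDeriv p.1 (r e) x * diffQuot δ (unitVec e) (wordDeriv p.2 v) x).sum| ≤
      (1 + pairCount d m) * (K * (2 / δ * s)) := fun e _ =>
    abs_leibniz_le (F := fun b => diffQuot δ (unitVec e) (wordDeriv b v) x) (by positivity) hw
      (fun a ha => h.r_bound e a ha x)
      fun b hb' => abs_diffQuot_le_of_bdd (hb b hb') hδ _ x
  have h0 := abs_leibniz_le (F := fun b => wordDeriv b v x) hs hw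
      (fun a ha => h.c_bound a ha x) (fun b hb' => hb b hb' x)
  have h2' := (Finset.abs_sum_le_sum_abs _ _).trans (Finset.sum_le_sum h2)
  have h1' := (Finset.abs_sum_le_sum_abs _ _).trans (Finset.sum_le_sum h1)
  rw [Finset.sum_const, nsmul_eq_mul] at h1' h2'
  rw [Finset.card_univ, Fintype.card_prod, Fintype.card_fin, Fintype.card_bool] at h1'
  push_cast at h1'
  refine (abs_add_le _ _).trans ((add_le_add ((abs_add_le _ _).trans (add_le_add h2' h1'))
    h0).trans (le_of_eq ?_))
  rw [crudeConst]
  ring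

/-- For each word the square expands as `a² + 2τa(b + e) + τ²(b + e)²`. The Bernstein inequality
handles `2τab`, with `hτ2` absorbing the deficit, and `hτ3` reduces the quadratic term to order `τ`.
-/
theorem SmoothCoeffs.euler_step (h : SmoothCoeffs m K Λ q r c) (hm : 2 ≤ m) (hv : SmoothBdd v)
    {S F : ℝ} (hS : 0 ≤ S) (hE : ∀ x, energy m v x ≤ S) {f : Space d → ℝ} (hf : SmoothBdd f)
    (hF : ∀ a : List (Fin d), a.length ≤ m → ∀ x, |wordDeriv a f x| ≤ F) {δ : ℝ} (hδ : 0 < δ)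
    {τ : ℝ} (hτ : 0 ≤ τ) (hτ1 : τ ≤ 1)
    (hτ2 : τ * (Λ.card * (3 / δ ^ 2 * K) + d * 2 * (1 / δ * K)) ≤ 1)
    (hτ3 : τ * crudeConst d m K δ Λ.card ^ 2 ≤ 1) (x : Space d) :
    energy m (fun y => v y + τ * (approxOp δ Λ q r c v y + f y)) x ≤
      (1 + τ * (bernsteinConst d m K (∑ l ∈ Λ, ‖l‖ ^ 2) + 3 * (words d m).card)) * S +
        τ * (3 * (words d m).card) * F ^ 2 := by
  set s := Real.sqrt S with hs_def
  have hs : 0 ≤ s := Real.sqrt_nonneg S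
  have hsS : s ^ 2 = S := Real.sq_sqrt hS
  rw [← hsS] at hE ⊢
  have hF0 : 0 ≤ F := (abs_nonneg _).trans (hF [] (by simp) x)
  set R := crudeConst d m K δ Λ.card
  set N : ℝ := ((words d m).card : ℝ)
  have hop := h.smoothBdd_approxOp δ hv
  have hB := h.bernstein hm hv hs hE hδ x
  set ρ := Λ.card * (3 / δ ^ 2 * K) + d * 2 * (1 / δ * K)
  set C := bernsteinConst d m K (∑ l ∈ Λ, ‖l‖ ^ 2)
  have h1 : energy m (fun y => v y + τ * (approxOp δ Λ q r c v y + f y)) x ≤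
      energy m v x +
      τ * (∑ w ∈ words d m, 2 * wordDeriv w v x * wordDeriv w (approxOp δ Λ q r c v) x) +
      ∑ w ∈ words d m, (τ * (s ^ 2 + F ^ 2) + τ * (2 * s ^ 2 + 2 * F ^ 2)) := by
    rw [energy, energy, Finset.mul_sum, ← Finset.sum_add_distrib, ← Finset.sum_add_distrib]
    refine Finset.sum_le_sum fun w hw => ?_
    rw [mem_words] at hw
    rw [wordDeriv_add w hv ((hop.add hf).const_mul τ), wordDeriv_const_mul w τ (hop.add hf),
      wordDeriv_add w hop hf]
    dsimp only
    have ha := abs_wordDeriv_le hs (hE x) hw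
    have hb := h.crude hv hs hE hδ x hw
    have hc := hF w hw x
    set a := wordDeriv w v x
    set b := wordDeriv w (approxOp δ Λ q r c v) x
    set e := wordDeriv w f x
    have ha2 : a ^ 2 ≤ s ^ 2 := sq_le_sq' (abs_le.1 ha).1 (abs_le.1 ha).2
    have he2 : e ^ 2 ≤ F ^ 2 := sq_le_sq' (abs_le.1 hc).1 (abs_le.1 hc).2
    have hb2 : b ^ 2 ≤ R ^ 2 * s ^ 2 := by
      rw [← mul_pow]; exact sq_le_sq' (abs_le.1 hb).1 (abs_le.1 hb).2
    have h2 : 2 * a * e ≤ s ^ 2 + F ^ 2 := by nlinarith [sq_nonneg (a - e)]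
    -- One factor `τ` of the quadratic term is spent here on `R ^ 2`; the other one stays outside.
    have h3 : τ * (b + e) ^ 2 ≤ 2 * s ^ 2 + 2 * F ^ 2 := by
      calc τ * (b + e) ^ 2 ≤ τ * (2 * (R ^ 2 * s ^ 2) + 2 * F ^ 2) := by
            gcongr; nlinarith [sq_nonneg (b - e)]
        _ = 2 * (τ * R ^ 2) * s ^ 2 + 2 * τ * F ^ 2 := by ring
        _ ≤ 2 * 1 * s ^ 2 + 2 * 1 * F ^ 2 := by gcongr
        _ = _ := by ring
    calc (a + τ * (b + e)) ^ 2
        = a ^ 2 + τ * (2 * a * b) + (τ * (2 * a * e) + τ * (τ * (b + e) ^ 2)) := by ring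
      _ ≤ _ := by gcongr
  -- Because `τ * ρ ≤ 1`, adding this multiple of the deficit cannot lift the energy above `s ^ 2`.
  have h2 : energy m v x + τ * ρ * (s ^ 2 - energy m v x) ≤ s ^ 2 := by
    have := sub_nonneg.2 (hE x)
    nlinarith
  have h3 : τ * (∑ w ∈ words d m, 2 * wordDeriv w v x * wordDeriv w (approxOp δ Λ q r c v) x) ≤
      τ * (ρ * (s ^ 2 - energy m v x) + C * s ^ 2) := by gcongr
  rw [Finset.sum_const, nsmul_eq_mul] at h1
  nlinarith

end

/-! ### Test functions and words -/

lemma IsTest.partialDeriv {η : Space d → ℝ} (h : IsTest η) (i : Fin d) :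
    IsTest (partialDeriv i η) :=
  ⟨(h.1.fderiv_right (m := ∞) (by simp)).clm_apply contDiff_const, h.2.fderiv_apply ℝ _⟩

lemma IsTest.wordDeriv {η : Space d → ℝ} (h : IsTest η) (w : List (Fin d)) :
    IsTest (wordDeriv w η) := by
  induction w with
  | nil => exact h
  | cons i w ih => exact ih.partialDeriv i

lemma IsTest.differentiable {η : Space d → ℝ} (h : IsTest η) : Differentiable ℝ η :=
  h.1.differentiable (by simp)

lemma IsTest.continuous {η : Space d → ℝ} (h : IsTest η) : Continuous η := h.1.continuous

lemma IsTest.integrable {η : Space d → ℝ} (h : IsTest η) : Integrable η :=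
  h.continuous.integrable_of_hasCompactSupport h.2

lemma IsTest.smoothBdd {η : Space d → ℝ} (h : IsTest η) : SmoothBdd η := fun w =>
  ⟨(h.wordDeriv w).differentiable, by
    obtain ⟨K, hK⟩ := (h.wordDeriv w).2.exists_bound_of_continuous (h.wordDeriv w).continuous
    exact ⟨K, hK⟩⟩

lemma IsTest.comp_sub {η : Space d → ℝ} (h : IsTest η) (x : Space d) :
    IsTest (fun y => η (x - y)) :=
  ⟨h.1.comp (contDiff_const.sub contDiff_id),
    h.2.comp_homeomorph (Homeomorph.subLeft x)⟩

lemma wordDeriv_comp_sub {η : Space d → ℝ} (h : IsTest η) (x : Space d) (w : List (Fin d)) :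
    wordDeriv w (fun y => η (x - y)) = fun y => (-1) ^ w.length * wordDeriv w η (x - y) := by
  induction w with
  | nil => simp
  | cons i w ih =>
    rw [wordDeriv_cons, ih, partialDeriv_const_mul i _ ((h.wordDeriv w).comp_sub x).differentiable]
    ext y
    have : HasFDerivAt (fun y => wordDeriv w η (x - y))
        ((fderiv ℝ (wordDeriv w η) (x - y)).comp (-ContinuousLinearMap.id ℝ (Space d))) y :=
      ((h.wordDeriv w).differentiable (x - y)).hasFDerivAt.comp y
        ((hasFDerivAt_id y).const_sub x)
    simp only [partialDeriv, this.fderiv, wordDeriv_cons, List.length_cons, pow_succ]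
    simp

lemma partialDeriv_comm {η : Space d → ℝ} (h : IsTest η) (i j : Fin d) :
    partialDeriv i (partialDeriv j η) = partialDeriv j (partialDeriv i η) := by
  have key : ∀ (i j : Fin d) (x : Space d), partialDeriv i (partialDeriv j η) x =
      fderiv ℝ (fderiv ℝ η) x (EuclideanSpace.single i 1) (EuclideanSpace.single j 1) := by
    intro i j x
    have h1 : DifferentiableAt ℝ (fderiv ℝ η) x :=
      (h.1.fderiv_right (m := ∞) (by simp)).differentiable (by simp) x
    have h2 : partialDeriv j η = fun y => fderiv ℝ η y (EuclideanSpace.single j 1) := rfl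
    rw [partialDeriv, h2, fderiv_clm_apply h1 (differentiableAt_const _)]
    simp
  ext x
  rw [key, key]
  exact (h.1.contDiffAt.isSymmSndFDerivAt (by
    rw [minSmoothness_of_isRCLikeNormedField]; exact WithTop.coe_le_coe.2 le_top)) _ _

/-- Symmetry of second derivatives is needed for test functions only; this suffices to pass between
words and multi-indices in the definition of weak derivatives. -/
lemma wordDeriv_perm {η : Space d → ℝ} (h : IsTest η) {w w' : List (Fin d)} (hp : w.Perm w') :
    wordDeriv w η = wordDeriv w' η := by
  induction hp with
  | nil => rfl
  | cons i _ ih => simp [ih]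
  | swap i j w => exact partialDeriv_comm (h.wordDeriv w) _ _
  | trans _ _ ih1 ih2 => exact ih1.trans ih2

/-- The word listing the indices of a multi-index. -/
def idxWord (α : Fin d → ℕ) : List (Fin d) :=
  (List.finRange d).flatMap fun i => List.replicate (α i) i

lemma wordDeriv_replicate (n : ℕ) (i : Fin d) (v : Space d → ℝ) :
    wordDeriv (List.replicate n i) v = (partialDeriv i)^[n] v := by
  induction n with
  | zero => rfl
  | succ n ih => rw [List.replicate_succ, wordDeriv_cons, ih, Function.iterate_succ_apply']

lemma multiDeriv_eq_wordDeriv (α : Fin d → ℕ) (v : Space d → ℝ) :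
    multiDeriv α v = wordDeriv (idxWord α) v := by
  rw [multiDeriv, idxWord]
  induction List.finRange d with
  | nil => rfl
  | cons i l ih => rw [List.foldr_cons, List.flatMap_cons, wordDeriv_append, ih,
      wordDeriv_replicate]

lemma length_idxWord (α : Fin d → ℕ) : (idxWord α).length = order α := by
  simp [idxWord, order, List.length_flatMap, Fin.sum_univ_def]

lemma count_idxWord (α : Fin d → ℕ) (i : Fin d) : (idxWord α).count i = α i := by
  rw [idxWord, List.count_flatMap]
  have : (List.count i ∘ fun i => List.replicate (α i) i) =
      fun j => if j = i then α j else 0 := by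
    ext j; simp [List.count_replicate]
  rw [this, ← Fin.sum_univ_def]
  simp

lemma wordDeriv_eq_multiDeriv {η : Space d → ℝ} (h : IsTest η) (w : List (Fin d)) :
    wordDeriv w η = multiDeriv (fun i => w.count i) η := by
  rw [multiDeriv_eq_wordDeriv]
  exact wordDeriv_perm h (List.perm_iff_count.2 fun i => (count_idxWord (fun i => w.count i) i).symm)

lemma order_count (w : List (Fin d)) : order (fun i => w.count i) = w.length := by
  rw [← length_idxWord]
  exact (List.perm_iff_count.2 fun i => count_idxWord _ i).length_eq

/-! ### Weak derivatives -/

lemma IsWeakDeriv.integral_wordDeriv {φ g : Space d → ℝ} {w : List (Fin d)}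
    (h : IsWeakDeriv (fun i => w.count i) φ g) {η : Space d → ℝ} (hη : IsTest η) :
    ∫ x, φ x * wordDeriv w η x = (-1) ^ w.length * ∫ x, g x * η x := by
  rw [wordDeriv_eq_multiDeriv hη, h.2.2 η hη, order_count]

lemma isWeakDeriv_of_wordDeriv {φ g : Space d → ℝ} (α : Fin d → ℕ) (hφ : LocallyIntegrable φ)
    (hg : LocallyIntegrable g) (h : ∀ η : Space d → ℝ, IsTest η →
      ∫ x, φ x * wordDeriv (idxWord α) η x = (-1) ^ (idxWord α).length * ∫ x, g x * η x) :
    IsWeakDeriv α φ g :=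
  ⟨hφ, hg, fun η hη => by rw [multiDeriv_eq_wordDeriv, h η hη, length_idxWord]⟩

lemma LocallyIntegrable.mul_test {f η : Space d → ℝ} (hf : LocallyIntegrable f)
    (hη : Continuous η) (hc : HasCompactSupport η) : Integrable fun x => f x * η x := by
  simpa [mul_comm] using hf.integrable_smul_left_of_hasCompactSupport hη hc

lemma ae_eq_of_integral_test {f g : Space d → ℝ} (hf : LocallyIntegrable f)
    (hg : LocallyIntegrable g) (h : ∀ η : Space d → ℝ, IsTest η →
      ∫ x, f x * η x = ∫ x, g x * η x) : f =ᵐ[volume] g := by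
  have h1 := ae_eq_zero_of_integral_contDiff_smul_eq_zero (hf.sub hg) (μ := volume)
    fun η h1 h2 => by
      have e : ∀ x, η x • (f - g) x = f x * η x - g x * η x := fun x => by
        simp; ring
      simp_rw [e]
      rw [integral_sub (LocallyIntegrable.mul_test hf h1.continuous h2)
        (LocallyIntegrable.mul_test hg h1.continuous h2), h η ⟨h1, h2⟩, sub_self]
  filter_upwards [h1] with x hx
  simpa [sub_eq_zero] using hx

lemma IsWeakDeriv.ae_eq {α : Fin d → ℕ} {φ g g' : Space d → ℝ} (h : IsWeakDeriv α φ g)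
    (h' : IsWeakDeriv α φ g') : g =ᵐ[volume] g' :=
  ae_eq_of_integral_test h.2.1 h'.2.1 fun η hη => by
    have := (h.2.2 η hη).symm.trans (h'.2.2 η hη)
    exact mul_left_cancel₀ (pow_ne_zero _ (by norm_num)) this

lemma IsWeakDeriv.weakDeriv {α : Fin d → ℕ} {φ g : Space d → ℝ} (h : IsWeakDeriv α φ g) :
    IsWeakDeriv α φ (weakDeriv α φ) := by
  have h' : ∃ w, IsWeakDeriv α φ w := ⟨g, h⟩
  rw [DegenerateParabolic.weakDeriv, dif_pos h']
  exact h'.choose_spec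

lemma IsWeakDeriv.weakDeriv_ae_eq {α : Fin d → ℕ} {φ g : Space d → ℝ} (h : IsWeakDeriv α φ g) :
    DegenerateParabolic.weakDeriv α φ =ᵐ[volume] g :=
  h.weakDeriv.ae_eq h

lemma IsWeakDeriv.add {α : Fin d → ℕ} {φ φ' g g' : Space d → ℝ} (h : IsWeakDeriv α φ g)
    (h' : IsWeakDeriv α φ' g') :
    IsWeakDeriv α (fun x => φ x + φ' x) (fun x => g x + g' x) := by
  refine ⟨h.1.add h'.1, h.2.1.add h'.2.1, fun η hη => ?_⟩
  have hm : IsTest (multiDeriv α η) := by rw [multiDeriv_eq_wordDeriv]; exact hη.wordDeriv _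
  simp_rw [add_mul]
  rw [integral_add (LocallyIntegrable.mul_test h.1 hm.continuous hm.2)
    (LocallyIntegrable.mul_test h'.1 hm.continuous hm.2),
    integral_add (LocallyIntegrable.mul_test h.2.1 hη.continuous hη.2)
    (LocallyIntegrable.mul_test h'.2.1 hη.continuous hη.2), h.2.2 η hη, h'.2.2 η hη, mul_add]

lemma IsWeakDeriv.const_mul {α : Fin d → ℕ} {φ g : Space d → ℝ} (h : IsWeakDeriv α φ g) (c : ℝ) :
    IsWeakDeriv α (fun x => c * φ x) (fun x => c * g x) := by
  refine ⟨h.1.smul c, h.2.1.smul c, fun η hη => ?_⟩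
  simp_rw [mul_assoc]
  rw [integral_const_mul, integral_const_mul, h.2.2 η hη]
  ring

lemma IsWeakDeriv.finset_sum {ι : Type*} (s : Finset ι) {α : Fin d → ℕ} {φ g : ι → Space d → ℝ}
    (h : ∀ k ∈ s, IsWeakDeriv α (φ k) (g k)) :
    IsWeakDeriv α (fun x => ∑ k ∈ s, φ k x) (fun x => ∑ k ∈ s, g k x) := by
  classical
  induction s using Finset.induction_on with
  | empty =>
    simp only [Finset.sum_empty]
    exact ⟨locallyIntegrable_const 0, locallyIntegrable_const 0, fun η _ => by simp⟩
  | insert a s ha ih =>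
    simp only [Finset.sum_insert ha]
    exact (h a (by simp)).add (ih fun k hk => h k (by simp [hk]))

lemma integral_mul_partialDeriv {u : Space d → ℝ} (hu : SmoothBdd u) {η : Space d → ℝ}
    (hη : IsTest η) (i : Fin d) :
    ∫ x, u x * partialDeriv i η x = -∫ x, partialDeriv i u x * η x := by
  have hi := hη.partialDeriv i
  refine integral_mul_fderiv_eq_neg_fderiv_mul_of_integrable ?_ ?_ ?_
    (fun x _ => hu.differentiable x) (fun x _ => hη.differentiable x)
  · exact LocallyIntegrable.mul_test (hu.partial_ i).continuous.locallyIntegrable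
      hη.continuous hη.2
  · exact LocallyIntegrable.mul_test hu.continuous.locallyIntegrable hi.continuous hi.2
  · exact LocallyIntegrable.mul_test hu.continuous.locallyIntegrable hη.continuous hη.2

/-- The outermost letter moves to `u` first, so the letters act on `u` in reverse order; symmetry of
the derivatives of `u` is never invoked. -/
lemma integral_mul_wordDeriv {u : Space d → ℝ} (hu : SmoothBdd u) {η : Space d → ℝ}
    (hη : IsTest η) (w : List (Fin d)) :
    ∫ x, u x * wordDeriv w η x = (-1) ^ w.length * ∫ x, wordDeriv w.reverse u x * η x := by
  induction w generalizing u with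
  | nil => simp
  | cons i w ih =>
    rw [wordDeriv_cons, integral_mul_partialDeriv hu (hη.wordDeriv w), ih (hu.partial_ i),
      List.length_cons, pow_succ, List.reverse_cons, wordDeriv_append]
    simp

/-! ### Mollification -/

/-- A sequence of bump functions with shrinking supports. -/
def bump (d n : ℕ) : ContDiffBump (0 : Space d) :=
  ⟨1 / (2 * (n + 1)), 1 / (n + 1), by positivity,
    one_div_lt_one_div_of_lt (by positivity) (by linarith [(Nat.cast_nonneg n : (0:ℝ) ≤ n)])⟩

/-- The mollifying kernel. -/
def kernel (d n : ℕ) : Space d → ℝ := (bump d n).normed volume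

/-- The mollification of a function. -/
def mollify (n : ℕ) (ψ : Space d → ℝ) (x : Space d) : ℝ := ∫ y, kernel d n (x - y) * ψ y

lemma isTest_kernel (n : ℕ) : IsTest (kernel d n) :=
  ⟨(bump d n).contDiff_normed, (bump d n).hasCompactSupport_normed⟩

lemma kernel_nonneg (n : ℕ) (x : Space d) : 0 ≤ kernel d n x := (bump d n).nonneg_normed x

lemma integral_kernel (n : ℕ) : ∫ x, kernel d n x = 1 := (bump d n).integral_normed

lemma kernel_eq_zero {n : ℕ} {x : Space d} (h : 1 / ((n : ℝ) + 1) ≤ ‖x‖) : kernel d n x = 0 := by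
  have : x ∉ Function.support (kernel d n) := by
    rw [kernel, ContDiffBump.support_normed_eq]
    simpa [bump] using h
  simpa using this

lemma mollify_eq_convolution (n : ℕ) (ψ : Space d → ℝ) (x : Space d) :
    mollify n ψ x = convolution (kernel d n) ψ (ContinuousLinearMap.lsmul ℝ ℝ) volume x := by
  rw [convolution_eq_swap]; rfl

lemma tendsto_bump_rOut (d : ℕ) :
    Filter.Tendsto (fun n => (bump d n).rOut) Filter.atTop (nhds 0) :=
  tendsto_one_div_add_atTop_nhds_zero_nat

/-- Lebesgue differentiation. The fixed ratio two of the radii of the bumps keeps the kernels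
comparable with averages over balls. -/
lemma ae_tendsto_mollify {g : Space d → ℝ} (hg : LocallyIntegrable g) :
    ∀ᵐ x, Filter.Tendsto (fun n => mollify n g x) Filter.atTop (nhds (g x)) := by
  have := ContDiffBump.ae_convolution_tendsto_right_of_locallyIntegrable (φ := fun n => bump d n)
    (K := 2) (tendsto_bump_rOut d) (Filter.Eventually.of_forall fun n => ?_) hg
  · simpa only [mollify_eq_convolution, kernel] using this
  · simp only [bump]
    apply le_of_eq
    field_simp

lemma tendsto_mollify {g : Space d → ℝ} (hg : Continuous g) (x : Space d) :
    Filter.Tendsto (fun n => mollify n g x) Filter.atTop (nhds (g x)) := by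
  have := ContDiffBump.convolution_tendsto_right_of_continuous (φ := fun n => bump d n)
    (μ := volume) (tendsto_bump_rOut d) hg x
  simpa only [mollify_eq_convolution, kernel] using this

lemma convKernel_integrable {κ ψ : Space d → ℝ} (hκ : IsTest κ) (hψ : LocallyIntegrable ψ)
    (x : Space d) : Integrable fun y => κ (x - y) * ψ y := by
  simpa [mul_comm] using
    LocallyIntegrable.mul_test hψ (hκ.comp_sub x).continuous (hκ.comp_sub x).2

lemma hasFDerivAt_conv {κ ψ : Space d → ℝ} (hκ : IsTest κ) (hψ : LocallyIntegrable ψ)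
    (x : Space d) : DifferentiableAt ℝ (fun x => ∫ y, κ (x - y) * ψ y) x ∧
      ∀ i, partialDeriv i (fun x => ∫ y, κ (x - y) * ψ y) x =
        ∫ y, partialDeriv i κ (x - y) * ψ y := by
  have h := hκ.2.hasFDerivAt_convolution_left (ContinuousLinearMap.lsmul ℝ ℝ)
    (μ := volume) (hκ.1.of_le (by simp)) hψ x
  have he : convolution κ ψ (ContinuousLinearMap.lsmul ℝ ℝ) volume =
      fun x => ∫ y, κ (x - y) * ψ y := by
    ext x; rw [convolution_eq_swap]; rfl
  rw [he] at h
  refine ⟨h.differentiableAt, fun i => ?_⟩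
  rw [partialDeriv, h.fderiv, convolution_eq_swap, ContinuousLinearMap.integral_apply]
  · rfl
  · have hc : Continuous (fderiv ℝ κ) := hκ.1.continuous_fderiv (by simp)
    have h1 : Integrable fun y => ψ y • fderiv ℝ κ (x - y) :=
      hψ.integrable_smul_right_of_hasCompactSupport (hc.comp (continuous_const.sub continuous_id))
        ((hκ.2.fderiv ℝ).comp_homeomorph (Homeomorph.subLeft x))
    convert h1 using 1
    ext y z
    simp [ContinuousLinearMap.precompL_apply, mul_comm]

lemma wordDeriv_conv {κ ψ : Space d → ℝ} (hκ : IsTest κ) (hψ : LocallyIntegrable ψ)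
    (w : List (Fin d)) : wordDeriv w (fun x => ∫ y, κ (x - y) * ψ y) =
      fun x => ∫ y, wordDeriv w κ (x - y) * ψ y := by
  induction w with
  | nil => rfl
  | cons i w ih =>
    rw [wordDeriv_cons, ih]
    ext x
    exact (hasFDerivAt_conv (hκ.wordDeriv w) hψ x).2 i

lemma abs_conv_le {κ ψ : Space d → ℝ} (hκ : IsTest κ) {K : ℝ} (hK : ∀ᵐ x, |ψ x| ≤ K)
    (x : Space d) : |∫ y, κ (x - y) * ψ y| ≤ (∫ y, |κ y|) * K := by
  have h1 : ∫ y, |κ y| = ∫ y, |κ (x - y)| := (integral_sub_left_eq_self (fun y => |κ y|) volume x).symm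
  rw [h1, ← integral_mul_const]
  refine norm_integral_le_of_norm_le (f := fun y => κ (x - y) * ψ y) ((hκ.comp_sub x).integrable.abs.mul_const K) ?_
  filter_upwards [hK] with y hy
  rw [norm_mul]
  exact mul_le_mul_of_nonneg_left hy (norm_nonneg _)

lemma abs_wordDeriv_mollify_le {ψ : Space d → ℝ} (hψ : LocallyIntegrable ψ) {K : ℝ}
    (hK : ∀ᵐ x, |ψ x| ≤ K) (n : ℕ) (w : List (Fin d)) (x : Space d) :
    |wordDeriv w (mollify n ψ) x| ≤ (∫ y, |wordDeriv w (kernel d n) y|) * K := by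
  have := wordDeriv_conv (isTest_kernel n) hψ w
  change |wordDeriv w (fun x => ∫ y, kernel d n (x - y) * ψ y) x| ≤ _
  rw [this]
  exact abs_conv_le ((isTest_kernel n).wordDeriv w) hK x

lemma smoothBdd_mollify {ψ : Space d → ℝ} (hψ : LocallyIntegrable ψ) {K : ℝ}
    (hK : ∀ᵐ x, |ψ x| ≤ K) (n : ℕ) : SmoothBdd (mollify n ψ) := fun w => by
  refine ⟨?_, _, abs_wordDeriv_mollify_le hψ hK n w⟩
  change Differentiable ℝ (wordDeriv w (fun x => ∫ y, kernel d n (x - y) * ψ y))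
  rw [wordDeriv_conv (isTest_kernel n) hψ w]
  exact fun x => (hasFDerivAt_conv ((isTest_kernel n).wordDeriv w) hψ x).1

/-- The derivatives go to the kernel, and testing with `y ↦ kernel d n (x - y)` hands them to the
weak derivative; the two signs cancel. -/
lemma wordDeriv_mollify {ψ g : Space d → ℝ} {w : List (Fin d)}
    (h : IsWeakDeriv (fun i => w.count i) ψ g) (n : ℕ) :
    wordDeriv w (mollify n ψ) = mollify n g := by
  change wordDeriv w (fun x => ∫ y, kernel d n (x - y) * ψ y) = _
  rw [wordDeriv_conv (isTest_kernel n) h.1 w]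
  ext x
  have h1 := h.integral_wordDeriv ((isTest_kernel n).comp_sub x)
  rw [wordDeriv_comp_sub (isTest_kernel n)] at h1
  simp_rw [mul_left_comm _ ((-1 : ℝ) ^ w.length)] at h1
  rw [integral_const_mul] at h1
  have h2 := mul_left_cancel₀ (pow_ne_zero _ (by norm_num)) h1
  rw [mollify]
  simpa only [mul_comm] using h2

lemma abs_mollify_le {g : Space d → ℝ} {K : ℝ} (hK : ∀ᵐ x, |g x| ≤ K) (n : ℕ) (x : Space d) :
    |mollify n g x| ≤ K := by
  have := abs_conv_le (isTest_kernel n) hK x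
  simp_rw [abs_of_nonneg (kernel_nonneg n _)] at this
  rwa [integral_kernel, one_mul] at this

lemma mollify_nonneg {g : Space d → ℝ} (h : ∀ x, 0 ≤ g x) (n : ℕ) (x : Space d) :
    0 ≤ mollify n g x :=
  integral_nonneg fun y => mul_nonneg (kernel_nonneg n _) (h y)

/-- Continuous functions with weak derivatives up to order `m` bounded by `K`. -/
structure WeakBdd (m : ℕ) (K : ℝ) (φ : Space d → ℝ) : Prop where
  continuous : Continuous φ
  derivs : ∀ α : Fin d → ℕ, order α ≤ m → ∃ g, IsWeakDeriv α φ g ∧ ∀ᵐ x, |g x| ≤ K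

section

variable {m : ℕ} {K : ℝ} {φ : Space d → ℝ}

lemma WeakBdd.isWeakDeriv (h : WeakBdd m K φ) {α : Fin d → ℕ} (hα : order α ≤ m) :
    IsWeakDeriv α φ (weakDeriv α φ) := by
  obtain ⟨g, hg, _⟩ := h.derivs α hα
  exact hg.weakDeriv

lemma WeakBdd.abs_weakDeriv_le (h : WeakBdd m K φ) {α : Fin d → ℕ} (hα : order α ≤ m) :
    ∀ᵐ x, |weakDeriv α φ x| ≤ K := by
  obtain ⟨g, hg, hK⟩ := h.derivs α hα
  filter_upwards [hg.weakDeriv_ae_eq, hK] with x hx hx'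
  rwa [hx]

lemma isWeakDeriv_zero (hφ : LocallyIntegrable φ) : IsWeakDeriv (0 : Fin d → ℕ) φ φ := by
  refine isWeakDeriv_of_wordDeriv _ hφ hφ fun η _ => ?_
  have : idxWord (0 : Fin d → ℕ) = [] := by
    rw [← List.length_eq_zero_iff, length_idxWord]; simp [order]
  simp [this]

/-- Mollifications obey the almost everywhere bound at every point, and they converge pointwise to a
continuous function. -/
lemma WeakBdd.abs_le (h : WeakBdd m K φ) (x : Space d) : |φ x| ≤ K := by
  obtain ⟨g, hg, hK⟩ := h.derivs 0 (by simp [order])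
  have h1 := hg.ae_eq (isWeakDeriv_zero h.continuous.locallyIntegrable)
  have h2 : ∀ᵐ x, |φ x| ≤ K := by
    filter_upwards [h1, hK] with x hx hx'
    rwa [← hx]
  exact le_of_tendsto (tendsto_mollify h.continuous x).abs
    (Filter.Eventually.of_forall fun n => abs_mollify_le h2 n x)

lemma WeakBdd.smoothBdd_mollify (h : WeakBdd m K φ) (n : ℕ) : SmoothBdd (mollify n φ) :=
  DegenerateParabolic.smoothBdd_mollify h.continuous.locallyIntegrable
    (Filter.Eventually.of_forall h.abs_le) n

lemma WeakBdd.abs_wordDeriv_mollify_le (h : WeakBdd m K φ) (n : ℕ) {w : List (Fin d)}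
    (hw : w.length ≤ m) (x : Space d) : |wordDeriv w (mollify n φ) x| ≤ K := by
  obtain ⟨g, hg, hK⟩ := h.derivs (fun i => w.count i) (by rwa [order_count])
  rw [wordDeriv_mollify hg]
  exact abs_mollify_le hK n x

end

/-! ### Time-dependent coefficients and their regularization -/

/-- Measurable functions of time and space whose weak space derivatives up to order `m` are
bounded by `K`. -/
structure TimeReg (m : ℕ) (K : ℝ) (ψ : ℝ → Space d → ℝ) : Prop where
  measurable : Measurable fun z : ℝ × Space d => ψ z.1 z.2
  weakBdd : ∀ s, WeakBdd m K (ψ s)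

lemma measurable_conv {κ : Space d → ℝ} (hκ : Continuous κ) {ψ : ℝ → Space d → ℝ}
    (hψ : Measurable fun z : ℝ × Space d => ψ z.1 z.2) :
    Measurable fun z : ℝ × Space d => ∫ y, κ (z.2 - y) * ψ z.1 y := by
  have h1 : Measurable fun z : (ℝ × Space d) × Space d => κ (z.1.2 - z.2) * ψ z.1.1 z.2 :=
    (hκ.measurable.comp ((measurable_snd.comp measurable_fst).sub measurable_snd)).mul
      (hψ.comp ((measurable_fst.comp measurable_fst).prodMk measurable_snd))
  exact (h1.stronglyMeasurable.integral_prod_right').measurable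

lemma TimeReg.measurable_mollify {m : ℕ} {K : ℝ} {ψ : ℝ → Space d → ℝ} (h : TimeReg m K ψ)
    (n : ℕ) : Measurable fun z : ℝ × Space d => mollify n (ψ z.1) z.2 :=
  measurable_conv (isTest_kernel n).continuous h.measurable

lemma TimeReg.measurable_wordDeriv_mollify {m : ℕ} {K : ℝ} {ψ : ℝ → Space d → ℝ}
    (h : TimeReg m K ψ) (n : ℕ) (w : List (Fin d)) (x : Space d) :
    Measurable fun s => wordDeriv w (mollify n (ψ s)) x := by
  have h1 : ∀ s, wordDeriv w (mollify n (ψ s)) x =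
      ∫ y, wordDeriv w (kernel d n) (x - y) * ψ s y := fun s =>
    congrFun (wordDeriv_conv (isTest_kernel n) (h.weakBdd s).continuous.locallyIntegrable w) x
  simp_rw [h1]
  exact (measurable_conv ((isTest_kernel n).wordDeriv w).continuous h.measurable).comp
    (measurable_id.prodMk measurable_const)

/-- Average of the mollified function over the `k`-th time step. -/
def stepAvg (n : ℕ) (τ : ℝ) (k : ℕ) (ψ : ℝ → Space d → ℝ) (x : Space d) : ℝ :=
  τ⁻¹ * ∫ s in Ioc (k * τ) ((k + 1) * τ), mollify n (ψ s) x

section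

variable {m : ℕ} {K : ℝ} {ψ : ℝ → Space d → ℝ} {τ : ℝ}

lemma TimeReg.mollify_unif (h : TimeReg m K ψ) (n : ℕ) (w : List (Fin d)) :
    ∃ B, ∀ s x, |wordDeriv w (mollify n (ψ s)) x| ≤ B :=
  ⟨_, fun s x => DegenerateParabolic.abs_wordDeriv_mollify_le
    (h.weakBdd s).continuous.locallyIntegrable
    (Filter.Eventually.of_forall (h.weakBdd s).abs_le) n w x⟩

lemma TimeReg.smoothBdd_stepAvg (h : TimeReg m K ψ) (n : ℕ) (τ : ℝ) (k : ℕ) :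
    SmoothBdd (stepAvg n τ k ψ) :=
  (smoothBdd_average (fun s => (h.weakBdd s).smoothBdd_mollify n) (h.mollify_unif n)
    (fun w x => (h.measurable_wordDeriv_mollify n w x).aestronglyMeasurable)).const_mul _

/-- Mollifying and averaging in time are both means with total weight one, so the bound survives
without any dependence on `n` or `τ`. -/
lemma TimeReg.abs_wordDeriv_stepAvg_le (h : TimeReg m K ψ) (n : ℕ) (hτ : 0 < τ) (k : ℕ)
    {w : List (Fin d)} (hw : w.length ≤ m) (x : Space d) :
    |wordDeriv w (stepAvg n τ k ψ) x| ≤ K := by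
  have h1 := wordDeriv_const_mul w τ⁻¹
    (smoothBdd_average (μ := volume.restrict (Ioc (k * τ) ((k + 1) * τ)))
    (fun s => (h.weakBdd s).smoothBdd_mollify n) (h.mollify_unif n)
    (fun w x => (h.measurable_wordDeriv_mollify n w x).aestronglyMeasurable))
  rw [wordDeriv_average (fun s => (h.weakBdd s).smoothBdd_mollify n) (h.mollify_unif n)
    (fun w x => (h.measurable_wordDeriv_mollify n w x).aestronglyMeasurable)] at h1
  change |wordDeriv w (fun x => τ⁻¹ * ∫ s in Ioc (k * τ) ((k + 1) * τ), mollify n (ψ s) x) x| ≤ K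
  rw [h1, abs_mul, abs_of_pos (inv_pos.2 hτ), inv_mul_le_iff₀ hτ]
  have h2 := norm_setIntegral_le_of_norm_le_const (μ := volume) (C := K)
    (s := Ioc (k * τ) ((k + 1) * τ)) (f := fun s => wordDeriv w (mollify n (ψ s)) x)
    measure_Ioc_lt_top fun s _ => (h.weakBdd s).abs_wordDeriv_mollify_le n hw x
  refine h2.trans (le_of_eq ?_)
  rw [Real.volume_real_Ioc_of_le (by nlinarith)]
  ring

lemma stepAvg_nonneg (h : ∀ s x, 0 ≤ ψ s x) (n : ℕ) (hτ : 0 < τ) (k : ℕ) (x : Space d) :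
    0 ≤ stepAvg n τ k ψ x :=
  mul_nonneg (inv_nonneg.2 hτ.le) (integral_nonneg fun s => mollify_nonneg (h s) n x)

end

/-! ### The regularized problem, its explicit scheme and the energy bound. -/

/-- Coefficients and data of a degenerate parabolic Cauchy problem, given for all times, with
first order part `∑ b_i D_i` and zero order part `+ c`. -/
structure ProblemData (d : ℕ) where
  Λ : Finset (Space d)
  q : Space d → ℝ → Space d → ℝ
  b : Fin d → ℝ → Space d → ℝ
  c : ℝ → Space d → ℝ
  f : ℝ → Space d → ℝ
  g : Space d → ℝ

/-- Regularity of the coefficients and data. -/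
structure ProblemData.Regular (D : ProblemData d) (m : ℕ) (K F G : ℝ) : Prop where
  q_nonneg : ∀ l ∈ D.Λ, ∀ s x, 0 ≤ D.q l s x
  q_reg : ∀ l ∈ D.Λ, TimeReg m K (D.q l)
  b_reg : ∀ i, TimeReg m K (D.b i)
  c_reg : TimeReg m K D.c
  f_reg : TimeReg m F D.f
  g_reg : WeakBdd m G D.g

/-- The space step. -/
def mesh (n : ℕ) : ℝ := 1 / (n + 1)

lemma mesh_pos (n : ℕ) : 0 < mesh n := by unfold mesh; positivity

/-- The rates of the one-sided difference quotients. -/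
def rates (K : ℝ) (n : ℕ) (τ : ℝ) (k : ℕ) (b : Fin d → ℝ → Space d → ℝ) (e : Fin d × Bool)
    (x : Space d) : ℝ :=
  (if e.2 then stepAvg n τ k (b e.1) x else 0) + K

/-- The regularized operator on the `k`-th time step. -/
def ProblemData.stepOp (D : ProblemData d) (K : ℝ) (n : ℕ) (τ : ℝ) (k : ℕ) :
    (Space d → ℝ) → Space d → ℝ :=
  approxOp (mesh n) D.Λ (fun l => stepAvg n τ k (D.q l)) (rates K n τ k D.b)
    (stepAvg n τ k D.c)

/-- The explicit Euler scheme for the regularized problem. -/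
def ProblemData.scheme (D : ProblemData d) (K : ℝ) (n : ℕ) (τ : ℝ) : ℕ → Space d → ℝ
  | 0 => mollify n D.g
  | k + 1 => fun x => D.scheme K n τ k x +
      τ * (D.stepOp K n τ k (D.scheme K n τ k) x + stepAvg n τ k D.f x)

section

variable {m : ℕ} {K F G : ℝ} {D : ProblemData d}

lemma ProblemData.Regular.K_nonneg (h : D.Regular m K F G) : 0 ≤ K :=
  (abs_nonneg _).trans ((h.c_reg.weakBdd 0).abs_le 0)

lemma ProblemData.Regular.F_nonneg (h : D.Regular m K F G) : 0 ≤ F :=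
  (abs_nonneg _).trans ((h.f_reg.weakBdd 0).abs_le 0)

/-- Adding `K` to all rates makes the forward rates `b_i + K` nonnegative, at the price of the bound
`2 * K`. The equal additions for `e_i` and `-e_i` cancel in the limit, so the limiting operator is
unaffected. -/
lemma ProblemData.Regular.smoothCoeffs (h : D.Regular m K F G) (n : ℕ) {τ : ℝ} (hτ : 0 < τ)
    (k : ℕ) : SmoothCoeffs m (2 * K) D.Λ (fun l => stepAvg n τ k (D.q l)) (rates K n τ k D.b)
      (stepAvg n τ k D.c) := by
  have hK := h.K_nonneg
  refine ⟨fun l hl => (h.q_reg l hl).smoothBdd_stepAvg n τ k,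
    fun l hl x => stepAvg_nonneg (h.q_nonneg l hl) n hτ k x,
    fun l hl a ha x => ((h.q_reg l hl).abs_wordDeriv_stepAvg_le n hτ k ha x).trans (by linarith),
    fun e => ?_, fun e x => ?_, fun e a ha x => ?_, h.c_reg.smoothBdd_stepAvg n τ k,
    fun a ha x => (h.c_reg.abs_wordDeriv_stepAvg_le n hτ k ha x).trans (by linarith)⟩
  · rcases e with ⟨i, _ | _⟩
    · have : rates K n τ k D.b (i, false) = fun _ : Space d => K := by ext; simp [rates]
      rw [this]; exact smoothBdd_const K
    · exact ((h.b_reg i).smoothBdd_stepAvg n τ k).add (smoothBdd_const K)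
  · rcases e with ⟨i, _ | _⟩
    · simpa [rates] using hK
    · have := (h.b_reg i).abs_wordDeriv_stepAvg_le n hτ k (w := []) (by simp) x
      rw [wordDeriv_nil] at this
      simp only [rates, if_true]
      linarith [(abs_le.1 this).1]
  · have hc : |wordDeriv a (fun _ : Space d => K) x| ≤ K := by
      by_cases ha0 : a = []
      · simp [ha0, abs_of_nonneg hK]
      · rw [wordDeriv_const a ha0]; simpa using hK
    rcases e with ⟨i, _ | _⟩
    · have : rates K n τ k D.b (i, false) = fun _ : Space d => K := by ext; simp [rates]
      rw [this]; linarith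
    · have h1 := congrFun (wordDeriv_add a ((h.b_reg i).smoothBdd_stepAvg n τ k)
        (smoothBdd_const (d := d) K)) x
      change |wordDeriv a (fun x => stepAvg n τ k (D.b i) x + K) x| ≤ 2 * K
      rw [h1]
      have h2 := (h.b_reg i).abs_wordDeriv_stepAvg_le n hτ k ha x
      refine (abs_add_le _ _).trans ?_
      linarith

lemma ProblemData.Regular.smoothBdd_scheme (h : D.Regular m K F G) (n : ℕ) {τ : ℝ} (hτ : 0 < τ)
    (k : ℕ) : SmoothBdd (D.scheme K n τ k) := by
  induction k with
  | zero => exact h.g_reg.smoothBdd_mollify n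
  | succ k ih =>
    exact ih.add ((((h.smoothCoeffs n hτ k).smoothBdd_approxOp _ ih).add
      (h.f_reg.smoothBdd_stepAvg n τ k)).const_mul τ)

/-- The growth rate of the energy. -/
def growthRate (d m : ℕ) (K L2 : ℝ) : ℝ := bernsteinConst d m (2 * K) L2 + 3 * (words d m).card

lemma growthRate_nonneg (d m : ℕ) {K L2 : ℝ} (hK : 0 ≤ K) (hL : 0 ≤ L2) :
    0 ≤ growthRate d m K L2 := by
  unfold growthRate bernsteinConst; positivity

/-- The a priori bound for the energy. -/
def energyBound (d m : ℕ) (K L2 F G T : ℝ) : ℝ :=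
  Real.exp (growthRate d m K L2 * T) *
    ((words d m).card * G ^ 2 + T * (3 * (words d m).card) * F ^ 2)

/-- The time step is small compared with the space step. -/
structure SmallStep (d m : ℕ) (K δ τ : ℝ) (N : ℕ) : Prop where
  pos : 0 < τ
  le_one : τ ≤ 1
  monotone : τ * (N * (3 / δ ^ 2 * (2 * K)) + d * 2 * (1 / δ * (2 * K))) ≤ 1
  crude : τ * crudeConst d m (2 * K) δ N ^ 2 ≤ 1

/-- The reciprocal of a sum of four nonnegative terms meets the four upper bounds at once. -/
lemma exists_smallStep (d m : ℕ) {K δ : ℝ} (hK : 0 ≤ K) (hδ : 0 < δ) (N : ℕ) {ε : ℝ} (hε : 0 < ε) :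
    ∃ τ, SmallStep d m K δ τ N ∧ τ ≤ ε := by
  set A := (N * (3 / δ ^ 2 * (2 * K)) + d * 2 * (1 / δ * (2 * K)) : ℝ)
  have hA : 0 ≤ A := by positivity
  set B := crudeConst d m (2 * K) δ N ^ 2
  have hB : 0 ≤ B := sq_nonneg _
  have hp : 0 < 1 + A + B + 1 / ε := by positivity
  refine ⟨1 / (1 + A + B + 1 / ε), ⟨by positivity, ?_, ?_, ?_⟩, ?_⟩
  · rw [div_le_one hp]; have : 0 < 1 / ε := by positivity
    linarith
  · rw [one_div_mul_eq_div, div_le_one hp]; have : 0 < 1 / ε := by positivity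
    linarith
  · rw [one_div_mul_eq_div, div_le_one hp]; have : 0 < 1 / ε := by positivity
    linarith
  · rw [one_div_le hp hε]; linarith

theorem ProblemData.Regular.energy_scheme_le (h : D.Regular m K F G) (hm : 2 ≤ m) {n : ℕ} {τ : ℝ}
    (hτ : SmallStep d m K (mesh n) τ D.Λ.card) {T : ℝ} {k : ℕ} (hk : k * τ ≤ T) (x : Space d) :
    energy m (D.scheme K n τ k) x ≤ energyBound d m K (∑ l ∈ D.Λ, ‖l‖ ^ 2) F G T := by
  have hK := h.K_nonneg
  set C := growthRate d m K (∑ l ∈ D.Λ, ‖l‖ ^ 2) with hC_def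
  have hC : 0 ≤ C := growthRate_nonneg d m hK (Finset.sum_nonneg fun _ _ => sq_nonneg _)
  have hτ0 := hτ.pos
  -- Discrete Gronwall inequality: since `1 + τ * C ≥ 1`, each new source contribution may be given
  -- the full power as a factor.
  have main : ∀ k x, energy m (D.scheme K n τ k) x ≤ (1 + τ * C) ^ k *
      ((words d m).card * G ^ 2 + k * τ * (3 * (words d m).card) * F ^ 2) := by
    intro k
    induction k with
    | zero =>
      intro x
      have h1 : ∀ w ∈ words d m, wordDeriv w (D.scheme K n τ 0) x ^ 2 ≤ G ^ 2 := fun w hw => by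
        have := h.g_reg.abs_wordDeriv_mollify_le n (mem_words.1 hw) x
        exact sq_le_sq' (abs_le.1 this).1 (abs_le.1 this).2
      have h2 := Finset.sum_le_card_nsmul _ _ _ h1
      rw [nsmul_eq_mul] at h2
      simpa [energy] using h2
    | succ k ih =>
      intro x
      have h1 := (h.smoothCoeffs n hτ0 k).euler_step hm (h.smoothBdd_scheme n hτ0 k)
        (by positivity) ih (h.f_reg.smoothBdd_stepAvg n τ k)
        (fun a ha x => h.f_reg.abs_wordDeriv_stepAvg_le n hτ0 k ha x) (mesh_pos n) hτ0.le
        hτ.le_one hτ.monotone hτ.crude x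
      refine h1.trans ?_
      have h2 : (1:ℝ) ≤ (1 + τ * C) ^ (k + 1) := one_le_pow₀ (by nlinarith)
      have h3 : 0 ≤ τ * (3 * (words d m).card) * F ^ 2 := by positivity
      have h4 := mul_le_mul_of_nonneg_right h2 h3
      change (1 + τ * C) * _ + _ ≤ _
      push_cast
      rw [pow_succ (1 + τ * C)] at h4 ⊢
      linarith
  refine (main k x).trans ?_
  have h5 : (1 + τ * C) ^ k ≤ Real.exp (C * T) := by
    calc (1 + τ * C) ^ k ≤ Real.exp (τ * C) ^ k := by
          gcongr; linarith [Real.add_one_le_exp (τ * C)]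
      _ = Real.exp (C * (k * τ)) := by rw [← Real.exp_nat_mul]; ring_nf
      _ ≤ _ := by gcongr
  have h6 : (0:ℝ) ≤ k * τ := by positivity
  unfold energyBound
  gcongr

end

/-! ### Increments of the scheme in time. -/

/-- A bound for the regularized operators that does not depend on the mesh. -/
def incrementBound (d : ℕ) (K L2 s : ℝ) : ℝ :=
  (1 / 2 * (K * (12 * (d + 1))) * L2 + d * 2 * K + K) * s

/-- Two derivatives of `v` control the jump operator uniformly in `δ`; the constants combine as `24
* 6 * d ≤ (12 * (d + 1)) ^ 2`. -/
lemma abs_jumpOp_le_of_energy {m : ℕ} (hm : 2 ≤ m) {v : Space d → ℝ} (hv : SmoothBdd v) {s : ℝ}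
    (hs : 0 ≤ s) (hE : ∀ x, energy m v x ≤ s ^ 2) {δ : ℝ} (hδ : 0 < δ) (l x : Space d) :
    |jumpOp δ l v x| ≤ 12 * (d + 1) * ‖l‖ ^ 2 * s := by
  refine abs_le_of_sq_le_sq ((sq_jumpOp_le hv hδ l x).trans ?_) (by positivity)
  have h4 : ∀ i, jumpGamma δ l (partialDeriv i v) x ≤ 6 * ‖l‖ ^ 2 * s ^ 2 := fun i =>
    jumpGamma_le (hv.partial_ i).differentiable hs
      (fun y => grad_wordDeriv_le (b := [i]) hE (by simpa using hm) y) hδ l x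
  calc _ ≤ 24 * ‖l‖ ^ 2 * ∑ i : Fin d, 6 * ‖l‖ ^ 2 * s ^ 2 := by
        gcongr with i; exact h4 i
    _ = 144 * (‖l‖ ^ 2 * s) ^ 2 * d := by simp; ring
    _ ≤ 144 * (‖l‖ ^ 2 * s) ^ 2 * (d + 1) ^ 2 := by
        gcongr; nlinarith [(Nat.cast_nonneg d : (0:ℝ) ≤ d)]
    _ = _ := by ring

lemma SmoothCoeffs.abs_approxOp_le {m : ℕ} {K : ℝ} {Λ : Finset (Space d)}
    {q : Space d → Space d → ℝ} {r : Fin d × Bool → Space d → ℝ} {c : Space d → ℝ}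
    (h : SmoothCoeffs m K Λ q r c) (hm : 2 ≤ m) {v : Space d → ℝ} (hv : SmoothBdd v)
    {s : ℝ} (hs : 0 ≤ s) (hE : ∀ x, energy m v x ≤ s ^ 2) {δ : ℝ} (hδ : 0 < δ) (x : Space d) :
    |approxOp δ Λ q r c v x| ≤ incrementBound d K (∑ l ∈ Λ, ‖l‖ ^ 2) s := by
  have hK := h.K_nonneg
  have h2 : ∀ l ∈ Λ, |1 / 2 * (q l x * jumpOp δ l v x)| ≤
      1 / 2 * (K * (12 * (d + 1))) * s * ‖l‖ ^ 2 := fun l hl => by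
    rw [abs_mul, abs_mul, abs_of_pos (by norm_num : (0:ℝ) < 1 / 2)]
    calc _ ≤ 1 / 2 * (K * (12 * (d + 1) * ‖l‖ ^ 2 * s)) := by
          gcongr
          · exact h.q_bound l hl [] (by simp) x
          · exact abs_jumpOp_le_of_energy hm hv hs hE hδ l x
      _ = _ := by ring
  have h1 : ∀ e ∈ Finset.univ, |r e x * diffQuot δ (unitVec e) v x| ≤ K * s := fun e _ => by
    rw [abs_mul]
    gcongr
    · exact h.r_bound e [] (by simp) x
    · exact abs_diffQuot_le hv.differentiable hs
        (fun z => grad_wordDeriv_le (b := []) hE (by simp; omega) z) hδ (norm_unitVec e) x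
  have h0 : |c x * v x| ≤ K * s := by
    rw [abs_mul]
    gcongr
    · exact h.c_bound [] (by simp) x
    · exact abs_wordDeriv_le (w := []) hs (hE x) (by simp)
  have h2' := (Finset.abs_sum_le_sum_abs _ _).trans (Finset.sum_le_sum h2)
  have h1' := (Finset.abs_sum_le_sum_abs _ _).trans (Finset.sum_le_sum h1)
  rw [← Finset.mul_sum _ (fun l => ‖l‖ ^ 2)] at h2'
  rw [Finset.sum_const, nsmul_eq_mul, Finset.card_univ, Fintype.card_prod, Fintype.card_fin,
    Fintype.card_bool] at h1'
  push_cast at h1'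
  refine (abs_add_le _ _).trans ((add_le_add ((abs_add_le _ _).trans (add_le_add h2' h1'))
    h0).trans (le_of_eq ?_))
  rw [incrementBound]
  ring

lemma energyBound_nonneg (d m : ℕ) {K L2 F G T : ℝ} (hT : 0 ≤ T) :
    0 ≤ energyBound d m K L2 F G T := by
  unfold energyBound; positivity

/-- In contrast to `SmoothCoeffs.crude` nothing here depends on the mesh. This is the Lipschitz
continuity in time that compactness needs. -/
theorem ProblemData.Regular.scheme_increment_le {m : ℕ} {K F G : ℝ} {D : ProblemData d}
    (h : D.Regular m K F G) (hm : 2 ≤ m) {n : ℕ} {τ : ℝ}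
    (hτ : SmallStep d m K (mesh n) τ D.Λ.card) {T : ℝ} (hT : 0 ≤ T) {k : ℕ} (hk : k * τ ≤ T)
    (x : Space d) :
    |D.scheme K n τ (k + 1) x - D.scheme K n τ k x| ≤
      τ * (incrementBound d (2 * K) (∑ l ∈ D.Λ, ‖l‖ ^ 2)
        (Real.sqrt (energyBound d m K (∑ l ∈ D.Λ, ‖l‖ ^ 2) F G T)) + F) := by
  have h1 := (h.smoothCoeffs n hτ.pos k).abs_approxOp_le hm (h.smoothBdd_scheme n hτ.pos k)
    (Real.sqrt_nonneg (energyBound d m K (∑ l ∈ D.Λ, ‖l‖ ^ 2) F G T))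
    (fun y => by rw [Real.sq_sqrt (energyBound_nonneg d m hT)]; exact h.energy_scheme_le hm hτ hk y)
    (mesh_pos n) x
  have h2 := h.f_reg.abs_wordDeriv_stepAvg_le n hτ.pos k (w := []) (by simp) x
  rw [ProblemData.scheme, add_sub_cancel_left, abs_mul, abs_of_pos hτ.pos]
  refine mul_le_mul_of_nonneg_left ((abs_add_le _ _).trans (add_le_add h1 h2)) hτ.pos.le

/-! ### Compactness -/

open Filter in
/-- A uniformly bounded, asymptotically equicontinuous sequence on a separable space has a
pointwise convergent subsequence. -/
theorem exists_subseq_tendsto {X : Type*} [PseudoMetricSpace X] [TopologicalSpace.SeparableSpace X]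
    [Nonempty X] {V : ℕ → X → ℝ} {B C : ℝ} (hC : 0 ≤ C) {τ : ℕ → ℝ}
    (hτ : Tendsto τ atTop (nhds 0))
    (hB : ∀ n z, |V n z| ≤ B) (hV : ∀ n z z', |V n z - V n z'| ≤ C * (dist z z' + τ n)) :
    ∃ φ : ℕ → ℕ, StrictMono φ ∧ ∃ u : X → ℝ,
      ∀ z, Tendsto (fun n => V (φ n) z) atTop (nhds (u z)) := by
  set a := TopologicalSpace.denseSeq X
  have hcomp : IsCompact (Set.pi univ fun _ : ℕ => Icc (-B) B) :=
    isCompact_univ_pi fun _ => isCompact_Icc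
  -- Diagonal extraction in the form of compactness of a countable product of intervals: the
  -- subsequence converges at all points of a dense sequence.
  obtain ⟨y, -, φ, hφ, hlim⟩ := hcomp.tendsto_subseq (x := fun n k => V n (a k))
    fun n => mem_univ_pi.2 fun k => abs_le.1 (hB n (a k))
  rw [tendsto_pi_nhds] at hlim
  have hcau : ∀ z, CauchySeq fun n => V (φ n) z := by
    intro z
    rw [Metric.cauchySeq_iff']
    intro ε hε
    obtain ⟨k, hk⟩ := (TopologicalSpace.denseRange_denseSeq X).exists_dist_lt z
      (show 0 < ε / (8 * (C + 1)) by positivity)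
    have h1 : ∀ᶠ n in atTop, τ (φ n) < ε / (8 * (C + 1)) :=
      (hτ.comp hφ.tendsto_atTop).eventually_lt_const (by positivity)
    have h2 : ∀ᶠ n in atTop, dist (V (φ n) (a k)) (y k) < ε / 4 :=
      (hlim k).eventually (Metric.ball_mem_nhds _ (by positivity))
    obtain ⟨N, hN⟩ := eventually_atTop.1 (h1.and h2)
    refine ⟨N, fun n hn => ?_⟩
    -- The modulus `C * (dist + τ)` carries the convergence from `a k` to `z`; the denominators
    -- contain `C + 1` since `C` may vanish.
    have key : ∀ n ≥ N, |V (φ n) z - V (φ n) (a k)| < ε / 4 := fun n hn => by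
      refine (hV _ _ _).trans_lt ?_
      have h3 : dist z (a k) + τ (φ n) < ε / (4 * (C + 1)) := by
        have e : ε / (4 * (C + 1)) = ε / (8 * (C + 1)) + ε / (8 * (C + 1)) := by
          field_simp; ring
        rw [e]; exact add_lt_add hk (hN n hn).1
      calc C * (dist z (a k) + τ (φ n)) ≤ C * (ε / (4 * (C + 1))) := by gcongr
        _ < (C + 1) * (ε / (4 * (C + 1))) := by gcongr; linarith
        _ = ε / 4 := by field_simp
    have h4 := key n hn
    have h5 := key N le_rfl
    have h6 := (hN n hn).2
    have h7 := (hN N le_rfl).2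
    rw [Real.dist_eq] at h6 h7 ⊢
    rw [abs_lt] at *
    constructor <;> linarith [h4.1, h4.2, h5.1, h5.2, h6.1, h6.2, h7.1, h7.2]
  choose u hu using fun z => cauchySeq_tendsto_of_complete (hcau z)
  exact ⟨φ, hφ, u, hu⟩

/-! ### Weak-star compactness of bounded functions. -/

lemma exists_test_approx {ψ : Space d → ℝ} (hψ : Integrable ψ) {ε : ℝ} (hε : 0 < ε) :
    ∃ η, IsTest η ∧ ∫ x, |ψ x - η x| ≤ ε := by
  obtain ⟨η, h1, h2, h3⟩ := MemLp.exist_eLpNorm_sub_le (p := 1) (by simp) le_rfl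
    (memLp_one_iff_integrable.2 hψ) hε
  refine ⟨η, ⟨h2, h1⟩, ?_⟩
  have hi : Integrable (ψ - η) := hψ.sub (IsTest.integrable ⟨h2, h1⟩)
  rw [eLpNorm_one_eq_lintegral_enorm, ← ofReal_integral_norm_eq_lintegral_enorm hi,
    ENNReal.ofReal_le_ofReal_iff hε.le] at h3
  exact h3

lemma integrable_bdd_mul {B ψ : Space d → ℝ} (hB : AEStronglyMeasurable B) {K : ℝ}
    (hK : ∀ᵐ x, |B x| ≤ K) (hψ : Integrable ψ) : Integrable fun x => B x * ψ x :=
  hψ.bdd_mul hB hK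

lemma abs_integral_bdd_mul_le {B ψ : Space d → ℝ} {K : ℝ}
    (hK : ∀ᵐ x, |B x| ≤ K) (hψ : Integrable ψ) : |∫ x, B x * ψ x| ≤ K * ∫ x, |ψ x| := by
  rw [← integral_const_mul]
  refine norm_integral_le_of_norm_le (f := fun x => B x * ψ x) (hψ.abs.const_mul K) ?_
  filter_upwards [hK] with x hx
  rw [norm_mul]
  exact mul_le_mul_of_nonneg_right hx (norm_nonneg _)

open Filter in
/-- For uniformly bounded functions, convergence against test functions implies convergence
against integrable functions. -/
theorem tendsto_integral_of_test {ι : Type*} {l : Filter ι} {B : ι → Space d → ℝ}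
    {B' : Space d → ℝ} (hB : ∀ i, AEStronglyMeasurable (B i)) (hB' : AEStronglyMeasurable B')
    {K : ℝ} (hK : ∀ i, ∀ᵐ x, |B i x| ≤ K) (hK' : ∀ᵐ x, |B' x| ≤ K)
    (h : ∀ η : Space d → ℝ, IsTest η →
      Tendsto (fun i => ∫ x, B i x * η x) l (nhds (∫ x, B' x * η x)))
    {ψ : Space d → ℝ} (hψ : Integrable ψ) :
    Tendsto (fun i => ∫ x, B i x * ψ x) l (nhds (∫ x, B' x * ψ x)) := by
  have hK0 : 0 ≤ K := by
    obtain ⟨x, hx⟩ := hK'.exists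
    exact (abs_nonneg _).trans hx
  rw [Metric.tendsto_nhds]
  intro ε hε
  obtain ⟨η, hη, hηε⟩ := exists_test_approx hψ (show 0 < ε / (4 * (K + 1)) by positivity)
  filter_upwards [Metric.tendsto_nhds.1 (h η hη) (ε / 4) (by positivity)] with i hi
  have key : ∀ b : Space d → ℝ, AEStronglyMeasurable b → (∀ᵐ x, |b x| ≤ K) →
      |(∫ x, b x * ψ x) - ∫ x, b x * η x| ≤ ε / 4 := fun b hb hbK => by
    rw [← integral_sub (integrable_bdd_mul hb hbK hψ) (integrable_bdd_mul hb hbK hη.integrable)]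
    simp_rw [← mul_sub]
    refine (abs_integral_bdd_mul_le hbK (hψ.sub hη.integrable)).trans ?_
    calc K * ∫ x, |(ψ - η) x| ≤ K * (ε / (4 * (K + 1))) := by gcongr; exact hηε
      _ ≤ (K + 1) * (ε / (4 * (K + 1))) := by gcongr; linarith
      _ = ε / 4 := by field_simp
  have h1 := key _ (hB i) (hK i)
  have h2 := key _ hB' hK'
  rw [Real.dist_eq] at hi ⊢
  rw [abs_le] at h1 h2
  rw [abs_lt] at hi ⊢
  constructor <;> linarith [h1.1, h1.2, h2.1, h2.2, hi.1, hi.2]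

/-- A positive continuous square integrable weight. -/
def weight (d : ℕ) (x : Space d) : ℝ := (1 + ‖x‖) ^ (-((d : ℝ) + 1))

lemma weight_pos (x : Space d) : 0 < weight d x := Real.rpow_pos_of_pos (by positivity) _

lemma continuous_weight : Continuous (weight d) :=
  (continuous_const.add continuous_norm).rpow_const fun x =>
    Or.inl (show (0 : ℝ) < 1 + ‖x‖ by positivity).ne'

lemma memLp_weight : MemLp (weight d) 2 := by
  rw [memLp_two_iff_integrable_sq continuous_weight.aestronglyMeasurable]
  -- The decay exponent exceeds the dimension, so the weight is integrable; being at most one, it is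
  -- then square integrable.
  have h1 : Integrable (weight d) := integrable_one_add_norm (by simp)
  refine h1.mono (continuous_weight.pow 2).aestronglyMeasurable
    (Filter.Eventually.of_forall fun x => ?_)
  have h0 := (weight_pos x).le
  have h2 : weight d x ≤ 1 := Real.rpow_le_one_of_one_le_of_nonpos (by simp)
    (by linarith [(Nat.cast_nonneg d : (0:ℝ) ≤ d)])
  rw [Real.norm_of_nonneg (sq_nonneg _), Real.norm_of_nonneg h0]
  nlinarith

open Filter in
/-- Weak-star compactness of bounded sequences of functions. -/
theorem exists_weak_limit {B : ℕ → Space d → ℝ} (hB : ∀ n, Continuous (B n)) {K : ℝ}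
    (hK : ∀ n x, |B n x| ≤ K) :
    ∃ g : Space d → ℝ, LocallyIntegrable g ∧ (∀ᵐ x, |g x| ≤ K) ∧
      ∀ η : Space d → ℝ, IsTest η →
        Tendsto (fun n => ∫ x, B n x * η x) (hyperfilter ℕ) (nhds (∫ x, g x * η x)) := by
  have hK0 : 0 ≤ K := (abs_nonneg _).trans (hK 0 0)
  -- The weight places bounded functions in a ball of `L²`, where weak compactness is available.
  have hmem : ∀ n, MemLp (fun x => B n x * weight d x) 2 := fun n =>
    MemLp.of_le_mul (c := K) memLp_weight
      ((hB n).mul continuous_weight).aestronglyMeasurable (Eventually.of_forall fun x => by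
        rw [norm_mul]
        exact mul_le_mul_of_nonneg_right (hK n x) (norm_nonneg _))
  set b : ℕ → Lp ℝ 2 (volume : Measure (Space d)) := fun n => (hmem n).toLp
  have hb : ∀ n, ‖b n‖ ≤ K * (eLpNorm (weight d) 2 volume).toReal := fun n => by
    have h1 := eLpNorm_le_mul_eLpNorm_of_ae_le_mul (f := fun x => B n x * weight d x)
      (g := weight d) (c := K) (μ := volume) (p := 2) (Eventually.of_forall fun x => by
        rw [norm_mul]
        exact mul_le_mul_of_nonneg_right (hK n x) (norm_nonneg _))
    rw [Lp.norm_toLp]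
    refine (ENNReal.toReal_mono (ENNReal.mul_ne_top (by simp) memLp_weight.eLpNorm_ne_top)
      h1).trans ?_
    rw [ENNReal.toReal_mul, ENNReal.toReal_ofReal hK0]
  set R := K * (eLpNorm (weight d) 2 volume).toReal
  set Φ : ℕ → WeakDual ℝ (Lp ℝ 2 (volume : Measure (Space d))) := fun n =>
    StrongDual.toWeakDual (InnerProductSpace.toDual ℝ _ (b n))
  have hΦ : ∀ n, Φ n ∈ WeakDual.toStrongDual ⁻¹'
      Metric.closedBall (0 : StrongDual ℝ (Lp ℝ 2 (volume : Measure (Space d)))) R := fun n => by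
    rw [mem_preimage, mem_closedBall_zero_iff]
    change ‖InnerProductSpace.toDual ℝ _ (b n)‖ ≤ R
    rw [LinearIsometryEquiv.norm_map]
    exact hb n
  -- Banach–Alaoglu along an ultrafilter, so that no subsequence has to be extracted.
  obtain ⟨F, -, hF⟩ := (WeakDual.isCompact_closedBall (𝕜 := ℝ)
    (0 : StrongDual ℝ (Lp ℝ 2 (volume : Measure (Space d)))) R).ultrafilter_le_nhds
    ((hyperfilter ℕ).map Φ) (by
      rw [le_principal_iff]
      exact mem_map.2 (Eventually.of_forall hΦ))
  have hev : ∀ z : Lp ℝ 2 (volume : Measure (Space d)),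
      Tendsto (fun n => inner ℝ (b n) z) (hyperfilter ℕ) (nhds (F z)) := fun z => by
    have h1 : Tendsto Φ (hyperfilter ℕ) (nhds F) := hF
    exact ((WeakDual.eval_continuous z).tendsto F).comp h1
  set e := (InnerProductSpace.toDual ℝ (Lp ℝ 2 (volume : Measure (Space d)))).symm
    (WeakDual.toStrongDual F) with he
  have hFe : ∀ z, F z = inner ℝ e z := fun z => by
    rw [he, InnerProductSpace.toDual_symm_apply]; rfl
  have hg : LocallyIntegrable fun x => (weight d x)⁻¹ * e x := by
    have h1 : LocallyIntegrable (e : Space d → ℝ) := (Lp.memLp e).locallyIntegrable (by norm_num)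
    exact h1.continuous_smul (g := fun x => (weight d x)⁻¹)
      (continuous_weight.inv₀ fun x => (weight_pos x).ne')
  have htest : ∀ η : Space d → ℝ, Continuous η → HasCompactSupport η →
      Tendsto (fun n => ∫ x, B n x * η x) (hyperfilter ℕ)
        (nhds (∫ x, ((weight d x)⁻¹ * e x) * η x)) := by
    intro η hη hηc
    have hc : Continuous fun x => η x * (weight d x)⁻¹ :=
      hη.mul (continuous_weight.inv₀ fun x => (weight_pos x).ne')
    have hm : MemLp (fun x => η x * (weight d x)⁻¹) 2 :=
      hc.memLp_of_hasCompactSupport hηc.mul_right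
    have h1 := hev hm.toLp
    rw [hFe] at h1
    convert h1 using 2
    · rw [L2.inner_def]
      refine integral_congr_ae ?_
      filter_upwards [(hmem _).coeFn_toLp, hm.coeFn_toLp] with x hx1 hx2
      rw [hx1, hx2, Real.inner_apply]
      have := (weight_pos x).ne'
      field_simp
    · rw [L2.inner_def]
      refine integral_congr_ae ?_
      filter_upwards [hm.coeFn_toLp] with x hx2
      rw [hx2, Real.inner_apply]
      ring
  refine ⟨_, hg, ?_, fun η hη => htest η hη.continuous hη.2⟩
  -- Mollifying `g` means testing it, so its mollifications are limits of those of `B n` and are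
  -- bounded by `K`; Lebesgue differentiation returns the bound to `g`.
  filter_upwards [ae_tendsto_mollify hg] with x hx
  refine le_of_tendsto hx.abs (Eventually.of_forall fun k => ?_)
  have ht := (isTest_kernel (d := d) k).comp_sub x
  have h1 := (htest _ ht.continuous ht.2).abs
  simp_rw [mul_comm _ (kernel d k _)] at h1
  refine le_of_tendsto h1 (Eventually.of_forall fun n => ?_)
  exact abs_mollify_le (Eventually.of_forall (hK n)) k x

open Filter in
/-- Pointwise limits of uniformly bounded functions against test functions. -/
lemma tendsto_integral_mul {ι : Type*} {l : Filter ι} [l.IsCountablyGenerated]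
    {v : ι → Space d → ℝ} {u ψ : Space d → ℝ}
    (hv : ∀ n, AEStronglyMeasurable (v n)) {K : ℝ} (hK : ∀ n x, |v n x| ≤ K)
    (hlim : ∀ x, Tendsto (fun n => v n x) l (nhds (u x))) (hψ : Integrable ψ) :
    Tendsto (fun n => ∫ x, v n x * ψ x) l (nhds (∫ x, u x * ψ x)) := by
  refine tendsto_integral_filter_of_dominated_convergence (fun x => K * |ψ x|) ?_ ?_
    (hψ.abs.const_mul K) ?_
  · exact Eventually.of_forall fun n => (hv n).mul hψ.aestronglyMeasurable
  · refine Eventually.of_forall fun n => Eventually.of_forall fun x => ?_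
    rw [norm_mul]
    exact mul_le_mul_of_nonneg_right (hK n x) (norm_nonneg _)
  · exact Eventually.of_forall fun x => (hlim x).mul tendsto_const_nhds

open Filter in
/-- Bounds of derivatives pass to pointwise limits. -/
theorem weakBdd_of_tendsto {m : ℕ} {K : ℝ} {v : ℕ → Space d → ℝ} (hv : ∀ n, SmoothBdd (v n))
    (hK : ∀ n, ∀ w : List (Fin d), w.length ≤ m → ∀ x, |wordDeriv w (v n) x| ≤ K)
    {u : Space d → ℝ} (hu : Continuous u)
    (hlim : ∀ x, Tendsto (fun n => v n x) atTop (nhds (u x))) : WeakBdd m K u := by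
  refine ⟨hu, fun α hα => ?_⟩
  obtain ⟨g, hg, hgK, hgt⟩ := exists_weak_limit
    (B := fun n => wordDeriv (idxWord α).reverse (v n)) (fun n => (hv n _).1.continuous)
    (fun n => hK n _ (by rw [List.length_reverse, length_idxWord]; exact hα))
  refine ⟨g, isWeakDeriv_of_wordDeriv α hu.locallyIntegrable hg fun η hη => ?_, hgK⟩
  have h1 := tendsto_integral_mul (fun n => (hv n).continuous.aestronglyMeasurable)
    (fun n => hK n [] (by simp)) hlim (hη.wordDeriv (idxWord α)).integrable
  have h2 := (hgt η hη).const_mul ((-1 : ℝ) ^ (idxWord α).length)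
  simp_rw [← integral_mul_wordDeriv (hv _) hη] at h2
  -- The pointwise limit is along `atTop`, hence also along the finer ultrafilter, where it meets
  -- the weak limit of the derivatives.
  exact tendsto_nhds_unique (h1.mono_left Nat.hyperfilter_le_atTop) h2

/-! ### Passage to the limit in the scheme -/

open Filter

/-- The index of the time step containing `t`. -/
def stepIdx (τ t : ℝ) : ℕ := ⌈t / τ⌉₊ - 1

lemma stepIdx_mul_le {τ t : ℝ} (hτ : 0 < τ) (ht : 0 ≤ t) : stepIdx τ t * τ ≤ t := by
  rw [stepIdx]
  rcases Nat.eq_zero_or_pos ⌈t / τ⌉₊ with h | h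
  -- The ceiling is zero only for `t = 0`, and truncated subtraction then gives the index zero.
  · simp [h, ht]
  · rw [Nat.cast_sub h, ← le_div_iff₀ hτ]
    have := Nat.ceil_lt_add_one (div_nonneg ht hτ.le)
    push_cast
    linarith

lemma le_stepIdx_mul {τ t : ℝ} (hτ : 0 < τ) : t ≤ (stepIdx τ t + 1) * τ := by
  rw [stepIdx, ← div_le_iff₀ hτ]
  have h1 := Nat.le_ceil (t / τ)
  have h2 : (⌈t / τ⌉₊ : ℝ) ≤ ((⌈t / τ⌉₊ - 1 : ℕ) : ℝ) + 1 := by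
    have : ⌈t / τ⌉₊ ≤ ⌈t / τ⌉₊ - 1 + 1 := by omega
    exact_mod_cast this
  linarith

/-- The steps are open on the left, `(kτ, (k + 1)τ]`, which is why the index is a ceiling minus one.
-/
lemma stepIdx_eq {τ t : ℝ} (hτ : 0 < τ) {k : ℕ} (h : t ∈ Ioc (k * τ) ((k + 1) * τ)) :
    stepIdx τ t = k := by
  have h1 : ⌈t / τ⌉₊ = k + 1 := by
    rw [Nat.ceil_eq_iff (by omega)]
    push_cast
    rw [lt_div_iff₀ hτ, div_le_iff₀ hτ]
    simpa using h
  rw [stepIdx, h1]; rfl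

lemma measurable_stepIdx (τ : ℝ) : Measurable (stepIdx τ) :=
  (measurable_from_nat (f := fun n : ℕ => n - 1)).comp
    (Nat.measurable_ceil.comp (measurable_id.div_const τ))

section

variable {m : ℕ} {K : ℝ} {ψ : ℝ → Space d → ℝ}

/-- Fubini's theorem; the factor `τ` cancels that of the average, so Euler sums turn into time
integrals. -/
lemma TimeReg.integral_step (h : TimeReg m K ψ) (n : ℕ) {τ : ℝ} (hτ : 0 < τ) (k : ℕ)
    {ζ : Space d → ℝ} (hζ : Integrable ζ) :
    τ * ∫ x, stepAvg n τ k ψ x * ζ x =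
      ∫ s in (k * τ)..((k + 1) * τ), ∫ x, mollify n (ψ s) x * ζ x := by
  have hle : (k : ℝ) * τ ≤ (k + 1) * τ := by nlinarith
  rw [intervalIntegral.integral_of_le hle, ← integral_const_mul]
  have h1 : ∀ x, τ * (stepAvg n τ k ψ x * ζ x) =
      ∫ s in Ioc (k * τ) ((k + 1) * τ), mollify n (ψ s) x * ζ x := fun x => by
    rw [stepAvg, integral_mul_const]
    field_simp
  simp_rw [h1]
  have hm := (h.measurable_mollify n).comp
    (measurable_swap (α := Space d) (β := ℝ))
  refine integral_integral_swap (f := fun x s => mollify n (ψ s) x * ζ x)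
    (Integrable.bdd_mul (c := K) ?_ hm.aestronglyMeasurable
      (Eventually.of_forall fun z => ?_))
  · exact hζ.comp_fst _
  · have := (h.weakBdd z.2).abs_wordDeriv_mollify_le n (w := []) (by simp) z.1
    exact this

lemma measurable_piecewise_time {h : ℕ → Space d → ℝ} (hc : ∀ k, Continuous (h k)) (τ : ℝ) :
    Measurable fun z : ℝ × Space d => h (stepIdx τ z.1) z.2 := by
  have h1 : Measurable fun z : ℕ × Space d => h z.1 z.2 :=
    measurable_from_prod_countable_right fun k => (hc k).measurable
  exact h1.comp (((measurable_stepIdx τ).comp measurable_fst).prodMk measurable_snd)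

/-- Convergence of the terms of the scheme. -/
theorem TimeReg.tendsto_term (hψ : TimeReg m K ψ) {ν : ℕ → ℕ} (hν : Tendsto ν atTop atTop)
    {τ : ℕ → ℝ} (hτ0 : ∀ n, 0 < τ n) (hτ : Tendsto τ atTop (nhds 0)) {T : ℝ}
    {h : ℕ → ℕ → Space d → ℝ} (hc : ∀ n k, Continuous (h n k)) {B : ℝ}
    (hB : ∀ n (k : ℕ), k * τ n ≤ T → ∀ x, |h n k x| ≤ B) {H : ℝ → Space d → ℝ}
    (hHm : ∀ s ∈ Icc 0 T, AEStronglyMeasurable (H s))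
    (hHB : ∀ s ∈ Icc 0 T, ∀ᵐ x, |H s x| ≤ B)
    (hlim : ∀ s ∈ Icc 0 T, ∀ η : Space d → ℝ, IsTest η →
      Tendsto (fun n => ∫ x, h n (stepIdx (τ n) s) x * η x) atTop (nhds (∫ x, H s x * η x)))
    {η : Space d → ℝ} (hη : IsTest η) {t : ℝ} (ht : t ∈ Icc 0 T) :
    Tendsto (fun n => ∑ k ∈ Finset.range (stepIdx (τ n) t),
      τ n * ∫ x, stepAvg (ν n) (τ n) k ψ x * (h n k x * η x)) atTop
      (nhds (∫ s in (0 : ℝ)..t, ∫ x, ψ s x * H s x * η x)) := by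
  have hKb : ∀ s n x, |mollify n (ψ s) x| ≤ K := fun s n x =>
    (hψ.weakBdd s).abs_wordDeriv_mollify_le n (w := []) (by simp) x
  have hK0 : 0 ≤ K := (abs_nonneg _).trans (hKb 0 0 0)
  have hB0 : 0 ≤ B := (abs_nonneg _).trans (hB 0 0 (by simpa using ht.1.trans ht.2) 0)
  have hint : ∀ n k, Integrable fun x => h n k x * η x := fun n k =>
    LocallyIntegrable.mul_test (hc n k).locallyIntegrable hη.continuous hη.2
  set g : ℕ → ℝ → ℝ := fun n s =>
    ∫ x, mollify (ν n) (ψ s) x * (h n (stepIdx (τ n) s) x * η x) with hg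
  have hgm : ∀ n, Measurable (g n) := fun n => by
    have h1 : Measurable fun z : ℝ × Space d =>
        mollify (ν n) (ψ z.1) z.2 * (h n (stepIdx (τ n) z.1) z.2 * η z.2) :=
      (hψ.measurable_mollify (ν n)).mul ((measurable_piecewise_time (hc n) (τ n)).mul
        (hη.continuous.measurable.comp measurable_snd))
    exact h1.stronglyMeasurable.integral_prod_right'.measurable
  set Q := K * (B * ∫ x, |η x|) with hQ
  have hgb : ∀ n, ∀ s ∈ Icc 0 T, |g n s| ≤ Q := fun n s hs => by
    have h0 : ∀ x, |h n (stepIdx (τ n) s) x| ≤ B :=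
      hB n _ ((stepIdx_mul_le (hτ0 n) hs.1).trans hs.2)
    refine (abs_integral_bdd_mul_le (Eventually.of_forall (hKb s (ν n))) (hint n _)).trans ?_
    refine mul_le_mul_of_nonneg_left ?_ hK0
    rw [← integral_const_mul]
    refine integral_mono (hint n _).abs (hη.integrable.abs.const_mul B) fun x => ?_
    dsimp only
    rw [abs_mul]
    exact mul_le_mul_of_nonneg_right (h0 x) (abs_nonneg _)
  have hgi : ∀ n a b, a ∈ Icc 0 T → b ∈ Icc 0 T → IntervalIntegrable (g n) volume a b := by
    intro n a b ha hb
    rw [intervalIntegrable_iff]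
    have : IsFiniteMeasure (volume.restrict (uIoc a b)) :=
      ⟨by rw [Measure.restrict_apply_univ]; exact measure_Ioc_lt_top⟩
    refine Integrable.of_bound (C := Q) (hgm n).aestronglyMeasurable ?_
    rw [ae_restrict_iff' measurableSet_uIoc]
    exact Eventually.of_forall fun s hs => hgb n s
      ((convex_Icc (0:ℝ) T).ordConnected.uIcc_subset ha hb (uIoc_subset_uIcc hs))
  -- `stepIdx` is constant on each step, so the sum is a single integral up to the grid point
  -- `stepIdx (τ n) t * τ n`.
  have hsum : ∀ n, ∑ k ∈ Finset.range (stepIdx (τ n) t),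
      τ n * ∫ x, stepAvg (ν n) (τ n) k ψ x * (h n k x * η x) =
      ∫ s in (0 : ℝ)..(stepIdx (τ n) t * τ n), g n s := fun n => by
    have hmem : ∀ k ≤ stepIdx (τ n) t, (k : ℝ) * τ n ∈ Icc 0 T := fun k hk =>
      ⟨mul_nonneg (Nat.cast_nonneg _) (hτ0 n).le,
        (mul_le_mul_of_nonneg_right (by exact_mod_cast hk) (hτ0 n).le).trans
          ((stepIdx_mul_le (hτ0 n) ht.1).trans ht.2)⟩
    have h1 := intervalIntegral.sum_integral_adjacent_intervals (f := g n) (μ := volume)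
      (a := fun k : ℕ => (k : ℝ) * τ n) (n := stepIdx (τ n) t)
      (fun k hk => hgi n _ _ (hmem k hk.le) (hmem (k + 1) hk))
    simp only [Nat.cast_zero, zero_mul] at h1
    rw [← h1]
    refine Finset.sum_congr rfl fun k _ => ?_
    rw [hψ.integral_step (ν n) (hτ0 n) k (hint n k)]
    have hle : (k : ℝ) * τ n ≤ (k + 1) * τ n := by nlinarith [hτ0 n]
    push_cast
    rw [intervalIntegral.integral_of_le hle, intervalIntegral.integral_of_le hle]
    refine setIntegral_congr_fun measurableSet_Ioc fun s hs => ?_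
    simp only [hg, stepIdx_eq (hτ0 n) hs]
  -- A strong limit times a weak one: `h` converges against the fixed integrable function `ψ s * η`,
  -- and `mollify (ν n) (ψ s) - ψ s` tends to zero pointwise beside bounded factors.
  have hpt : ∀ s ∈ Icc 0 T, Tendsto (fun n => g n s) atTop
      (nhds (∫ x, ψ s x * H s x * η x)) := by
    intro s hs
    have hψc := (hψ.weakBdd s).continuous
    have hψη : Integrable fun x => ψ s x * η x :=
      LocallyIntegrable.mul_test hψc.locallyIntegrable hη.continuous hη.2
    have h0 : ∀ n x, |h n (stepIdx (τ n) s) x| ≤ B := fun n =>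
      hB n _ ((stepIdx_mul_le (hτ0 n) hs.1).trans hs.2)
    have h1 := tendsto_integral_of_test (l := atTop)
      (B := fun n => h n (stepIdx (τ n) s)) (fun n => (hc n _).aestronglyMeasurable) (hHm s hs)
      (fun n => Eventually.of_forall (h0 n)) (hHB s hs) (hlim s hs) hψη
    have h2 : Tendsto (fun n => ∫ x, (mollify (ν n) (ψ s) x - ψ s x) *
        (h n (stepIdx (τ n) s) x * η x)) atTop (nhds 0) := by
      have h3 : Tendsto (fun n => ∫ x, (mollify (ν n) (ψ s) x - ψ s x) *
          (h n (stepIdx (τ n) s) x * η x)) atTop (nhds (∫ _ : Space d, (0 : ℝ))) := by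
        refine tendsto_integral_of_dominated_convergence (fun x => (K + K) * (B * |η x|)) ?_
          ((hη.integrable.abs.const_mul B).const_mul _) ?_ ?_
        · exact fun n => ((((hψ.weakBdd s).smoothBdd_mollify _).continuous.sub hψc).mul
            ((hc n _).mul hη.continuous)).aestronglyMeasurable
        · refine fun n => Eventually.of_forall fun x => ?_
          rw [norm_mul, norm_mul]
          refine mul_le_mul ?_ (mul_le_mul_of_nonneg_right (h0 n x) (norm_nonneg _))
            (by positivity) (by positivity)
          exact (abs_sub _ _).trans (add_le_add (hKb s _ x) ((hψ.weakBdd s).abs_le x))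
        · refine Eventually.of_forall fun x => ?_
          have h4 : Tendsto (fun n => mollify (ν n) (ψ s) x - ψ s x) atTop (nhds 0) := by
            simpa using ((tendsto_mollify hψc x).comp hν).sub_const (ψ s x)
          refine squeeze_zero_norm (fun n => ?_)
            (by simpa using h4.abs.mul_const (B * |η x|))
          rw [norm_mul, norm_mul]
          exact mul_le_mul_of_nonneg_left
            (mul_le_mul_of_nonneg_right (h0 n x) (norm_nonneg _)) (norm_nonneg _)
      simpa using h3
    have h5 := h1.add h2
    rw [add_zero] at h5
    convert h5 using 1
    · ext n
      have hi1 : Integrable fun x => h n (stepIdx (τ n) s) x * (ψ s x * η x) :=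
        integrable_bdd_mul (hc n _).aestronglyMeasurable (Eventually.of_forall (h0 n)) hψη
      have hi2 : Integrable fun x => (mollify (ν n) (ψ s) x - ψ s x) *
          (h n (stepIdx (τ n) s) x * η x) :=
        integrable_bdd_mul (K := K + K)
          (((hψ.weakBdd s).smoothBdd_mollify _).continuous.sub hψc).aestronglyMeasurable
          (Eventually.of_forall fun x => (abs_sub _ _).trans
            (add_le_add (hKb s _ x) ((hψ.weakBdd s).abs_le x))) (hint n _)
      rw [← integral_add hi1 hi2]
      refine integral_congr_ae (Eventually.of_forall fun x => ?_)
      dsimp only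
      ring
    · refine congrArg nhds (integral_congr_ae (Eventually.of_forall fun x => ?_))
      dsimp only
      ring
  have hmain : Tendsto (fun n => ∫ s in (0 : ℝ)..t, g n s) atTop
      (nhds (∫ s in (0 : ℝ)..t, ∫ x, ψ s x * H s x * η x)) := by
    have hsub : uIoc 0 t ⊆ Icc 0 T := by
      rw [uIoc_of_le ht.1]
      exact fun s hs => ⟨hs.1.le, hs.2.trans ht.2⟩
    refine intervalIntegral.tendsto_integral_filter_of_dominated_convergence (fun _ => Q)
      (Eventually.of_forall fun n => (hgm n).aestronglyMeasurable)
      (Eventually.of_forall fun n => Eventually.of_forall fun s hs => hgb n s (hsub hs))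
      intervalIntegrable_const (Eventually.of_forall fun s hs => hpt s (hsub hs))
  -- The part of `[0, t]` not covered by whole steps has length at most `τ n`.
  have hrest : Tendsto (fun n => ∫ s in (stepIdx (τ n) t * τ n)..t, g n s) atTop (nhds 0) := by
    refine squeeze_zero_norm (fun n => ?_) (by simpa using hτ.const_mul Q)
    have h1 := stepIdx_mul_le (hτ0 n) ht.1
    have h2 := le_stepIdx_mul (t := t) (hτ0 n)
    have h0 : 0 ≤ (stepIdx (τ n) t : ℝ) * τ n := mul_nonneg (Nat.cast_nonneg _) (hτ0 n).le
    refine (intervalIntegral.norm_integral_le_of_norm_le_const (C := Q) fun s hs => ?_).trans ?_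
    · rw [uIoc_of_le h1] at hs
      exact hgb n s ⟨h0.trans hs.1.le, hs.2.trans ht.2⟩
    · have hQ0 : 0 ≤ Q := (abs_nonneg _).trans (hgb 0 t ht)
      rw [abs_of_nonneg (by linarith)]
      refine mul_le_mul_of_nonneg_left ?_ hQ0
      linarith
  have := hmain.sub hrest
  rw [sub_zero] at this
  refine this.congr fun n => ?_
  rw [hsum n, sub_eq_iff_eq_add]
  have h1 := stepIdx_mul_le (hτ0 n) ht.1
  have h0 : 0 ≤ (stepIdx (τ n) t : ℝ) * τ n := mul_nonneg (Nat.cast_nonneg _) (hτ0 n).le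
  have hT : (0:ℝ) ≤ T := ht.1.trans ht.2
  exact (intervalIntegral.integral_add_adjacent_intervals
    (hgi n _ _ ⟨le_rfl, hT⟩ ⟨h0, h1.trans ht.2⟩) (hgi n _ _ ⟨h0, h1.trans ht.2⟩ ht)).symm

end

/-! ### Weak limits of difference operators -/

/-- The directional derivative. -/
def dirDeriv (l : Space d) (v : Space d → ℝ) (x : Space d) : ℝ := fderiv ℝ v x l

lemma dirDeriv_eq (l : Space d) (v : Space d → ℝ) :
    dirDeriv l v = fun x => ∑ i, l i * partialDeriv i v x :=
  funext fun x => fderiv_apply_eq_sum v x l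

lemma SmoothBdd.dirDeriv {v : Space d → ℝ} (hv : SmoothBdd v) (l : Space d) :
    SmoothBdd (dirDeriv l v) := by
  rw [dirDeriv_eq]
  exact SmoothBdd.finset_sum _ fun i _ => (hv.partial_ i).const_mul _

lemma dirDeriv_dirDeriv_eq {v : Space d → ℝ} (hv : SmoothBdd v) (l : Space d) (x : Space d) :
    dirDeriv l (dirDeriv l v) x = ∑ i, ∑ j, l i * l j * wordDeriv [i, j] v x := by
  rw [dirDeriv_eq l (dirDeriv l v)]
  refine Finset.sum_congr rfl fun i _ => ?_
  rw [dirDeriv_eq l v, partialDeriv_finset_sum _ _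
    fun j _ => ((hv.partial_ j).const_mul _).differentiable, Finset.mul_sum]
  refine Finset.sum_congr rfl fun j _ => ?_
  rw [partialDeriv_const_mul i _ (hv.partial_ j).differentiable, mul_assoc]
  rfl

/-- Taylor's formula of second order along a line. -/
lemma SmoothBdd.taylor_two {v : Space d → ℝ} (hv : SmoothBdd v) (l : Space d) {C : ℝ}
    (hC : ∀ x, |DegenerateParabolic.dirDeriv l (DegenerateParabolic.dirDeriv l
      (DegenerateParabolic.dirDeriv l v)) x| ≤ C) (x : Space d) (s : ℝ) :
    |v (x + s • l) - v x - (DegenerateParabolic.dirDeriv l v x * s +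
      DegenerateParabolic.dirDeriv l (DegenerateParabolic.dirDeriv l v) x * (s ^ 2 / 2))| ≤
      C * |s| ^ 3 := by
  set v1 := DegenerateParabolic.dirDeriv l v
  set v2 := DegenerateParabolic.dirDeriv l v1
  have hv1 : SmoothBdd v1 := hv.dirDeriv l
  have hv2 : SmoothBdd v2 := hv1.dirDeriv l
  have hd0 : ∀ s, HasDerivAt (fun s : ℝ => v (x + s • l)) (v1 (x + s • l)) s :=
    hasDerivAt_line hv.differentiable x l
  have hd1 : ∀ s, HasDerivAt (fun s : ℝ => v1 (x + s • l)) (v2 (x + s • l)) s :=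
    hasDerivAt_line hv1.differentiable x l
  have hd2 : ∀ s, HasDerivAt (fun s : ℝ => v2 (x + s • l))
      (DegenerateParabolic.dirDeriv l v2 (x + s • l)) s :=
    hasDerivAt_line hv2.differentiable x l
  have e2 := abs_sub_le_of_deriv_le hd2 (C := C) 0 (fun s => by simpa using hC _)
  have e1 := abs_sub_le_of_deriv_le (φ := fun s : ℝ => v1 (x + s • l) - v2 x * s)
    (φ' := fun s => v2 (x + s • l) - v2 x) (C := C)
    (fun s => by
      have h := (hd1 s).fun_sub ((hasDerivAt_id s).const_mul (v2 x))
      simpa using h) 1 (fun s => by simpa using e2 s)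
  have e0 := abs_sub_le_of_deriv_le
    (φ := fun s : ℝ => v (x + s • l) - (v1 x * s + v2 x * (s ^ 2 / 2)))
    (φ' := fun s => v1 (x + s • l) - (v1 x + v2 x * s)) (C := C)
    (fun s => by
      have h := (hd0 s).fun_sub (((hasDerivAt_id s).const_mul (v1 x)).fun_add
        (((hasDerivAt_pow 2 s).div_const 2).const_mul (v2 x)))
      simpa using h) 2 (fun s => by
      have := e1 s
      simp only [zero_smul, add_zero, mul_zero, sub_zero, Nat.reduceAdd] at this
      rwa [sub_right_comm, sub_sub] at this)
  simp only [zero_smul, add_zero, mul_zero, sub_zero, Nat.reduceAdd, ne_eq, OfNat.ofNat_ne_zero,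
    not_false_eq_true, zero_pow, zero_div] at e0
  rw [sub_right_comm]
  exact e0 s

/-- The linear Taylor term is odd in `θ` and drops out; the quadratic one integrates to `v2 x * δ ^
2 / 3`, which explains the normalization `3 / δ ^ 2`. The cubic remainder leaves `O(δ)`. -/
lemma exists_jumpOp_sub_le {v : Space d → ℝ} (hv : SmoothBdd v) (l : Space d) :
    ∃ C, ∀ δ > 0, ∀ x, |jumpOp δ l v x - dirDeriv l (dirDeriv l v) x| ≤ C * δ := by
  obtain ⟨C, hC⟩ := (((hv.dirDeriv l).dirDeriv l).dirDeriv l []).2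
  refine ⟨6 * C, fun δ hδ x => ?_⟩
  have e0 := hv.taylor_two l hC x
  set v1 := dirDeriv l v
  set v2 := dirDeriv l v1
  have hvol : volume.real (Icc (-1 : ℝ) 1) = 2 := by simp; norm_num
  have hI : ∫ θ in Icc (-1 : ℝ) 1, (v1 x * (δ * θ) + v2 x * ((δ * θ) ^ 2 / 2)) =
      v2 x * δ ^ 2 / 3 := by
    rw [integral_Icc_eq_integral_Ioc, ← intervalIntegral.integral_of_le (by norm_num)]
    have e : ∀ θ : ℝ, v1 x * (δ * θ) + v2 x * ((δ * θ) ^ 2 / 2) =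
        (v1 x * δ) * θ + (v2 x * δ ^ 2 / 2) * θ ^ 2 := fun θ => by ring
    simp_rw [e]
    rw [intervalIntegral.integral_add
      (Continuous.intervalIntegrable (by fun_prop) _ _)
      (Continuous.intervalIntegrable (by fun_prop) _ _), intervalIntegral.integral_const_mul,
      intervalIntegral.integral_const_mul, integral_id, integral_pow]
    norm_num
    ring
  have hA : jumpOp δ l v x - v2 x = 3 / δ ^ 2 * ∫ θ in Icc (-1 : ℝ) 1,
      (v (x + (δ * θ) • l) - v x - (v1 x * (δ * θ) + v2 x * ((δ * θ) ^ 2 / 2))) := by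
    rw [integral_sub (continuous_jump hv.continuous δ l x).integrableOn_Icc
      (by fun_prop : Continuous fun θ : ℝ => v1 x * (δ * θ) + v2 x * ((δ * θ) ^ 2 / 2)
        ).integrableOn_Icc, hI, jumpOp]
    field_simp
  have hC0 : 0 ≤ C := (abs_nonneg _).trans (hC 0)
  have hb := norm_setIntegral_le_of_norm_le_const (μ := volume) (s := Icc (-1 : ℝ) 1)
    (C := C * δ ^ 3)
    (f := fun θ => v (x + (δ * θ) • l) - v x - (v1 x * (δ * θ) + v2 x * ((δ * θ) ^ 2 / 2)))
    measure_Icc_lt_top (fun θ hθ => by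
      refine (e0 (δ * θ)).trans (mul_le_mul_of_nonneg_left ?_ hC0)
      rw [abs_mul, abs_of_pos hδ]
      have : |θ| ≤ 1 := abs_le.2 hθ
      calc (δ * |θ|) ^ 3 ≤ (δ * 1) ^ 3 := by gcongr
        _ = _ := by ring)
  rw [hvol] at hb
  rw [hA, abs_mul, abs_of_pos (by positivity : (0:ℝ) < 3 / δ ^ 2)]
  calc _ ≤ 3 / δ ^ 2 * (C * δ ^ 3 * 2) := by gcongr; exact hb
    _ = _ := by field_simp; ring

lemma IsTest.eq_zero_of_notMem {η : Space d → ℝ} {R : ℝ} {x z : Space d} (hz : ‖z‖ ≤ R)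
    (hx : x ∉ Metric.cthickening R (tsupport η)) : η (x + z) = 0 := by
  by_contra hne
  refine hx (Metric.mem_cthickening_of_dist_le x (x + z) R _ (subset_tsupport _ hne) ?_)
  simpa [dist_eq_norm] using hz

lemma IsTest.integrable_indicator {η : Space d → ℝ} (hη : IsTest η) (R C : ℝ) :
    Integrable ((Metric.cthickening R (tsupport η)).indicator fun _ => C) := by
  have hc : IsCompact (Metric.cthickening R (tsupport η)) := hη.2.cthickening
  rw [integrable_indicator_iff hc.measurableSet]
  exact integrableOn_const hc.measure_lt_top.ne

/-- Translation invariance turns a jump `θ` of `v` into the jump `-θ` of `η`, and `[-1, 1]` is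
symmetric: the jump operator is its own adjoint. -/
lemma integral_jumpOp_mul {v : Space d → ℝ} (hv : Continuous v) {B : ℝ} (hB : ∀ x, |v x| ≤ B)
    {η : Space d → ℝ} (hη : IsTest η) (δ : ℝ) (l : Space d) :
    ∫ x, jumpOp δ l v x * η x = ∫ x, v x * jumpOp δ l η x := by
  obtain ⟨M, hM⟩ := (hη.smoothBdd []).2
  simp only [wordDeriv_nil] at hM
  have hB0 : 0 ≤ B := (abs_nonneg _).trans (hB 0)
  have hM0 : 0 ≤ M := (abs_nonneg _).trans (hM 0)
  set S := Metric.cthickening (|δ| * ‖l‖) (tsupport η)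
  have hvη : ∀ y, Integrable fun x => v (x + y) * η x := fun y =>
    LocallyIntegrable.mul_test (hv.comp (continuous_id.add continuous_const)).locallyIntegrable
      hη.continuous hη.2
  have h1 : Integrable (Function.uncurry fun x θ => (v (x + (δ * θ) • l) - v x) * η x)
      (volume.prod (volume.restrict (Icc (-1 : ℝ) 1))) := by
    have hη' : Integrable (fun z : Space d × ℝ => η z.1)
      (volume.prod (volume.restrict (Icc (-1 : ℝ) 1))) := hη.integrable.comp_fst _
    refine hη'.bdd_mul (c := B + B) ?_ (Eventually.of_forall fun z =>
      (abs_sub _ _).trans (add_le_add (hB _) (hB _)))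
    have : Continuous fun z : Space d × ℝ => v (z.1 + (δ * z.2) • l) - v z.1 := by fun_prop
    exact this.aestronglyMeasurable
  -- Here `v` is only bounded; integrability holds because the increments of `η` vanish outside a
  -- thickening of its support.
  have h2 : Integrable (Function.uncurry fun x θ => v x * (η (x + (δ * -θ) • l) - η x))
      (volume.prod (volume.restrict (Icc (-1 : ℝ) 1))) := by
    have hS : Integrable (fun z : Space d × ℝ => S.indicator (fun _ => B * (M + M)) z.1)
      (volume.prod (volume.restrict (Icc (-1 : ℝ) 1))) :=
      (hη.integrable_indicator (|δ| * ‖l‖) (B * (M + M))).comp_fst _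
    refine hS.mono' ?_ ?_
    · have hηc := hη.continuous
      have : Continuous fun z : Space d × ℝ => v z.1 * (η (z.1 + (δ * -z.2) • l) - η z.1) := by
        fun_prop
      exact this.aestronglyMeasurable
    · have hae : ∀ᵐ z : Space d × ℝ ∂(volume.prod (volume.restrict (Icc (-1 : ℝ) 1))),
          z.2 ∈ Icc (-1 : ℝ) 1 :=
        Measure.quasiMeasurePreserving_snd.ae (ae_restrict_mem measurableSet_Icc)
      filter_upwards [hae] with z hz
      by_cases hx : z.1 ∈ S
      · rw [indicator_of_mem hx, Function.uncurry, norm_mul]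
        exact mul_le_mul (hB _) ((abs_sub _ _).trans (add_le_add (hM _) (hM _)))
          (norm_nonneg _) hB0
      · have e1 : η (z.1 + (δ * -z.2) • l) = 0 := IsTest.eq_zero_of_notMem (by
          rw [norm_smul, norm_mul, norm_neg]
          have : ‖z.2‖ ≤ 1 := abs_le.2 hz
          calc ‖δ‖ * ‖z.2‖ * ‖l‖ ≤ ‖δ‖ * 1 * ‖l‖ := by gcongr
            _ = _ := by rw [mul_one]; rfl) hx
        have e2 : η (z.1 + 0) = 0 := IsTest.eq_zero_of_notMem (by rw [norm_zero]; positivity) hx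
        rw [add_zero] at e2
        rw [indicator_of_notMem hx, Function.uncurry, e1, e2]
        simp
  have e1 : ∀ x, jumpOp δ l v x * η x =
      3 / δ ^ 2 * ∫ θ in Icc (-1 : ℝ) 1, (v (x + (δ * θ) • l) - v x) * η x := fun x => by
    rw [jumpOp, integral_mul_const, mul_assoc]
  have e2 : ∀ x, v x * jumpOp δ l η x =
      3 / δ ^ 2 * ∫ θ in Icc (-1 : ℝ) 1, v x * (η (x + (δ * -θ) • l) - η x) := fun x => by
    rw [jumpOp, integral_const_mul, mul_left_comm]
    congr 2
    rw [integral_Icc_eq_integral_Ioc, integral_Icc_eq_integral_Ioc,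
      ← intervalIntegral.integral_of_le (by norm_num),
      ← intervalIntegral.integral_of_le (by norm_num),
      intervalIntegral.integral_comp_neg (fun θ => η (x + (δ * θ) • l) - η x), neg_neg]
  simp_rw [e1, e2]
  rw [integral_const_mul, integral_const_mul, integral_integral_swap h1, integral_integral_swap h2]
  congr 1
  refine integral_congr_ae (Eventually.of_forall fun θ => ?_)
  dsimp only
  simp_rw [sub_mul, mul_sub]
  have i1 : Integrable fun x => v x * η x := by simpa using hvη 0
  have e3 : ∫ x, v (x + (δ * θ) • l) * η x = ∫ x, v x * η (x + (δ * -θ) • l) := by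
    rw [← integral_add_right_eq_self (fun x => v x * η (x + (δ * -θ) • l)) ((δ * θ) • l)]
    congr 1
    ext x
    rw [mul_neg, neg_smul, add_neg_cancel_right]
  have i2 : Integrable fun x => v x * η (x + (δ * -θ) • l) := by
    have := (hvη ((δ * θ) • l)).comp_add_right ((δ * -θ) • l)
    refine this.congr (Eventually.of_forall fun x => ?_)
    dsimp only
    rw [mul_neg, neg_smul, neg_add_cancel_right]
  rw [integral_sub (hvη _) i1, integral_sub i2 i1, e3]

lemma integral_diffQuot_mul {v : Space d → ℝ} (hv : Continuous v)
    {η : Space d → ℝ} (hη : IsTest η) (δ : ℝ) (y : Space d) :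
    ∫ x, diffQuot δ y v x * η x = ∫ x, v x * diffQuot δ (-y) η x := by
  have hvη : ∀ z, Integrable fun x => v (x + z) * η x := fun z =>
    LocallyIntegrable.mul_test (hv.comp (continuous_id.add continuous_const)).locallyIntegrable
      hη.continuous hη.2
  have i1 : Integrable fun x => v x * η x := by simpa using hvη 0
  have e3 : ∫ x, v (x + δ • y) * η x = ∫ x, v x * η (x + δ • -y) := by
    rw [← integral_add_right_eq_self (fun x => v x * η (x + δ • -y)) (δ • y)]
    congr 1
    ext x
    rw [smul_neg, add_neg_cancel_right]
  have i2 : Integrable fun x => v x * η (x + δ • -y) := by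
    have := (hvη (δ • y)).comp_add_right (δ • -y)
    refine this.congr (Eventually.of_forall fun x => ?_)
    dsimp only
    rw [smul_neg, neg_add_cancel_right]
  have e1 : ∀ x, diffQuot δ y v x * η x = δ⁻¹ * (v (x + δ • y) * η x - v x * η x) :=
    fun x => by rw [diffQuot]; ring
  have e2 : ∀ x, v x * diffQuot δ (-y) η x = δ⁻¹ * (v x * η (x + δ • -y) - v x * η x) :=
    fun x => by rw [diffQuot]; ring
  simp_rw [e1, e2]
  rw [integral_const_mul, integral_const_mul, integral_sub (hvη _) i1, integral_sub i2 i1, e3]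

/-- Only pointwise convergence of `v n` is known, so the operator is moved to `η`, where it
converges uniformly. As `δ n ≤ 1`, one thickening of the support serves all `n` and gives the
dominating function. -/
lemma tendsto_jumpOp_test {η : Space d → ℝ} (hη : IsTest η) (l : Space d) {δ : ℕ → ℝ}
    (hδ0 : ∀ n, 0 < δ n) (hδ1 : ∀ n, δ n ≤ 1) (hδ : Tendsto δ atTop (nhds 0)) {v : ℕ → Space d → ℝ}
    {u : Space d → ℝ} (hv : ∀ n, Continuous (v n)) {B : ℝ} (hB : ∀ n x, |v n x| ≤ B)
    (hlim : ∀ x, Tendsto (fun n => v n x) atTop (nhds (u x))) :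
    Tendsto (fun n => ∫ x, jumpOp (δ n) l (v n) x * η x) atTop
      (nhds (∫ x, u x * dirDeriv l (dirDeriv l η) x)) := by
  have hs := hη.smoothBdd
  have hB0 : 0 ≤ B := (abs_nonneg _).trans (hB 0 0)
  obtain ⟨C, hC⟩ := exists_jumpOp_sub_le hs l
  obtain ⟨C2, hC2⟩ := (((hs.dirDeriv l).dirDeriv l) []).2
  have hC0 : 0 ≤ C := by
    have := (abs_nonneg _).trans (hC 1 one_pos 0); simpa using this
  simp_rw [fun n => integral_jumpOp_mul (hv n) (hB n) hη (δ n) l]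
  refine tendsto_integral_of_dominated_convergence
    (fun x => B * (Metric.cthickening ‖l‖ (tsupport η)).indicator (fun _ => C + C2) x)
    (fun n => ((hv n).mul (hs.jumpOp (δ n) l).continuous).aestronglyMeasurable)
    ((hη.integrable_indicator _ _).const_mul B) (fun n => Eventually.of_forall fun x => ?_)
    (Eventually.of_forall fun x => (hlim x).mul ?_)
  · rw [norm_mul]
    refine mul_le_mul (hB n x) ?_ (norm_nonneg _) hB0
    by_cases hx : x ∈ Metric.cthickening ‖l‖ (tsupport η)
    · rw [indicator_of_mem hx]
      have h1 := hC (δ n) (hδ0 n) x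
      have h2 := hC2 x
      rw [wordDeriv_nil] at h2
      rw [Real.norm_eq_abs]
      have h3 : |jumpOp (δ n) l η x| ≤ |jumpOp (δ n) l η x - dirDeriv l (dirDeriv l η) x| +
        |dirDeriv l (dirDeriv l η) x| := by
        have := abs_add_le (jumpOp (δ n) l η x - dirDeriv l (dirDeriv l η) x)
          (dirDeriv l (dirDeriv l η) x)
        rwa [sub_add_cancel] at this
      have h4 : C * δ n ≤ C * 1 := mul_le_mul_of_nonneg_left (hδ1 n) hC0
      linarith
    · rw [indicator_of_notMem hx, jumpOp, setIntegral_eq_zero_of_forall_eq_zero, mul_zero, norm_zero]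
      intro θ hθ
      have e2 : η (x + 0) = 0 := IsTest.eq_zero_of_notMem (by rw [norm_zero]; positivity) hx
      rw [add_zero] at e2
      rw [e2, IsTest.eq_zero_of_notMem _ hx, sub_zero]
      rw [norm_smul, norm_mul, Real.norm_of_nonneg (hδ0 n).le]
      have h5 : ‖θ‖ ≤ 1 := abs_le.2 hθ
      have h6 : δ n * ‖θ‖ ≤ 1 := mul_le_one₀ (hδ1 n) (norm_nonneg _) h5
      nlinarith [norm_nonneg l]
  · rw [tendsto_iff_norm_sub_tendsto_zero]
    exact squeeze_zero (fun n => norm_nonneg _) (fun n => hC (δ n) (hδ0 n) x)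
      (by simpa using hδ.const_mul C)

/-- The adjoint quotient points along `-y`, and on `η` it converges to the derivative in that
direction. -/
lemma tendsto_diffQuot_test {η : Space d → ℝ} (hη : IsTest η) {y : Space d} (hy : ‖y‖ ≤ 1)
    {δ : ℕ → ℝ}
    (hδ0 : ∀ n, 0 < δ n) (hδ1 : ∀ n, δ n ≤ 1) (hδ : Tendsto δ atTop (nhds 0)) {v : ℕ → Space d → ℝ}
    {u : Space d → ℝ} (hv : ∀ n, Continuous (v n)) {B : ℝ} (hB : ∀ n x, |v n x| ≤ B)
    (hlim : ∀ x, Tendsto (fun n => v n x) atTop (nhds (u x))) :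
    Tendsto (fun n => ∫ x, diffQuot (δ n) y (v n) x * η x) atTop
      (nhds (∫ x, u x * dirDeriv (-y) η x)) := by
  have hs := hη.smoothBdd
  have hB0 : 0 ≤ B := (abs_nonneg _).trans (hB 0 0)
  obtain ⟨C, hC⟩ : ∃ C, ∀ x, ‖fderiv ℝ η x‖ ≤ C := by
    obtain ⟨C, hC⟩ := (hη.2.fderiv ℝ).exists_bound_of_continuous hs.continuous_fderiv
    exact ⟨C, hC⟩
  have hC0 : 0 ≤ C := (norm_nonneg _).trans (hC 0)
  simp_rw [fun n => integral_diffQuot_mul (hv n) hη (δ n) y]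
  refine tendsto_integral_of_dominated_convergence
    (fun x => B * (Metric.cthickening 1 (tsupport η)).indicator (fun _ => C) x)
    (fun n => ((hv n).mul (hs.diffQuot (δ n) _).continuous).aestronglyMeasurable)
    ((hη.integrable_indicator _ _).const_mul B) (fun n => Eventually.of_forall fun x => ?_)
    (Eventually.of_forall fun x => (hlim x).mul ?_)
  · rw [norm_mul]
    refine mul_le_mul (hB n x) ?_ (norm_nonneg _) hB0
    by_cases hx : x ∈ Metric.cthickening 1 (tsupport η)
    · rw [indicator_of_mem hx, diffQuot, norm_div, Real.norm_of_nonneg (hδ0 n).le,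
        div_le_iff₀ (hδ0 n)]
      have := Convex.norm_image_sub_le_of_norm_fderiv_le (𝕜 := ℝ) (f := η) (s := univ) (C := C)
        (x := x) (y := x + δ n • -y) (fun y _ => hs.differentiable y) (fun y _ => hC y)
        convex_univ (mem_univ _) (mem_univ _)
      refine this.trans (mul_le_mul_of_nonneg_left ?_ hC0)
      rw [add_sub_cancel_left, norm_smul, norm_neg, Real.norm_of_nonneg (hδ0 n).le]
      nlinarith [hδ0 n]
    · have e2 : η (x + 0) = 0 := IsTest.eq_zero_of_notMem (by rw [norm_zero]; norm_num) hx
      rw [add_zero] at e2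
      rw [indicator_of_notMem hx, diffQuot, e2, IsTest.eq_zero_of_notMem _ hx]
      · simp
      · rw [norm_smul, norm_neg, Real.norm_of_nonneg (hδ0 n).le]
        exact mul_le_one₀ (hδ1 n) (norm_nonneg _) hy
  · have h1 := hasDerivAt_line hs.differentiable x (-y) 0
    rw [zero_smul, add_zero, hasDerivAt_iff_tendsto_slope_zero] at h1
    have h2 : Tendsto δ atTop (nhdsWithin 0 {0}ᶜ) :=
      tendsto_nhdsWithin_iff.2 ⟨hδ, Eventually.of_forall fun n => (hδ0 n).ne'⟩
    refine (h1.comp h2).congr fun n => ?_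
    simp only [Function.comp_apply, zero_add, zero_smul, add_zero, diffQuot, smul_eq_mul]
    ring

/-! ### Integration by parts for the weak derivatives in the operator. -/

/-- The second derivative in the direction `l`, in the weak sense. -/
def secondDir (l : Space d) (v : Space d → ℝ) (x : Space d) : ℝ :=
  ∑ i, ∑ j, l i * l j * weakDeriv (idx i + idx j) v x

lemma count_pair (i j : Fin d) : (fun k => [i, j].count k) = idx i + idx j := by
  ext k
  simp only [idx, List.count_cons, List.count_nil, Pi.add_apply, Pi.single_apply]
  grind

lemma count_singleton' (i : Fin d) : (fun k => [i].count k) = idx i := by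
  ext k
  simp only [idx, List.count_cons, List.count_nil, Pi.single_apply]
  grind

lemma order_idx (i : Fin d) : order (idx i) = 1 := by
  rw [← count_singleton', order_count]; rfl

lemma order_idx_add (i j : Fin d) : order (idx i + idx j) = 2 := by
  rw [← count_pair, order_count]; rfl

section

variable {m : ℕ} {K : ℝ} {u : Space d → ℝ}

lemma WeakBdd.integral_weakDeriv_idx (hu : WeakBdd m K u) (hm : 2 ≤ m) (i : Fin d)
    {η : Space d → ℝ} (hη : IsTest η) :
    ∫ x, u x * partialDeriv i η x = -∫ x, weakDeriv (idx i) u x * η x := by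
  have h := hu.isWeakDeriv (α := idx i) (by rw [order_idx]; omega)
  rw [← count_singleton' i] at h ⊢
  simpa using h.integral_wordDeriv hη

lemma WeakBdd.integral_weakDeriv_pair (hu : WeakBdd m K u) (hm : 2 ≤ m) (i j : Fin d)
    {η : Space d → ℝ} (hη : IsTest η) :
    ∫ x, u x * wordDeriv [i, j] η x = ∫ x, weakDeriv (idx i + idx j) u x * η x := by
  have h := hu.isWeakDeriv (α := idx i + idx j) (by rw [order_idx_add]; omega)
  rw [← count_pair i j] at h ⊢
  simpa using h.integral_wordDeriv hη

lemma WeakBdd.aestronglyMeasurable_weakDeriv (hu : WeakBdd m K u) {α : Fin d → ℕ}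
    (hα : order α ≤ m) : AEStronglyMeasurable (weakDeriv α u) :=
  (hu.isWeakDeriv hα).2.1.aestronglyMeasurable

lemma WeakBdd.aestronglyMeasurable_secondDir (hu : WeakBdd m K u) (hm : 2 ≤ m) (l : Space d) :
    AEStronglyMeasurable (secondDir l u) :=
  Finset.aestronglyMeasurable_fun_sum _ fun i _ => Finset.aestronglyMeasurable_fun_sum _ fun j _ =>
    (hu.aestronglyMeasurable_weakDeriv (by rw [order_idx_add]; omega)).const_mul _

lemma WeakBdd.integrable_weakDeriv_mul (hu : WeakBdd m K u) {α : Fin d → ℕ}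
    (hα : order α ≤ m) {ψ : Space d → ℝ} (hψ : Integrable ψ) :
    Integrable fun x => weakDeriv α u x * ψ x :=
  integrable_bdd_mul (hu.aestronglyMeasurable_weakDeriv hα) (hu.abs_weakDeriv_le hα) hψ

lemma WeakBdd.integral_secondDir_mul (hu : WeakBdd m K u) (hm : 2 ≤ m) (l : Space d)
    {ψ : Space d → ℝ} (hψ : Integrable ψ) : ∫ x, secondDir l u x * ψ x =
      ∑ i, ∑ j, l i * l j * ∫ x, weakDeriv (idx i + idx j) u x * ψ x := by
  simp_rw [secondDir, Finset.sum_mul]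
  have hi : ∀ i j, Integrable fun x => l i * l j * weakDeriv (idx i + idx j) u x * ψ x :=
    fun i j => by
      simp_rw [mul_assoc (l i * l j)]
      exact (hu.integrable_weakDeriv_mul (by rw [order_idx_add]; omega) hψ).const_mul _
  rw [integral_finsetSum _ fun i _ => integrable_finsetSum _ fun j _ => hi i j]
  refine Finset.sum_congr rfl fun i _ => ?_
  rw [integral_finsetSum _ fun j _ => hi i j]
  refine Finset.sum_congr rfl fun j _ => ?_
  simp_rw [mul_assoc (l i * l j)]
  rw [integral_const_mul]

lemma WeakBdd.integral_dirDeriv_dirDeriv (hu : WeakBdd m K u) (hm : 2 ≤ m) (l : Space d)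
    {η : Space d → ℝ} (hη : IsTest η) :
    ∫ x, u x * dirDeriv l (dirDeriv l η) x = ∫ x, secondDir l u x * η x := by
  rw [hu.integral_secondDir_mul hm l hη.integrable]
  simp_rw [dirDeriv_dirDeriv_eq hη.smoothBdd, Finset.mul_sum]
  have hi : ∀ i j, Integrable fun x => u x * (l i * l j * wordDeriv [i, j] η x) := fun i j =>
    integrable_bdd_mul hu.continuous.aestronglyMeasurable (Eventually.of_forall hu.abs_le)
      ((hη.wordDeriv [i, j]).integrable.const_mul _)
  rw [integral_finsetSum _ fun i _ => integrable_finsetSum _ fun j _ => hi i j]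
  refine Finset.sum_congr rfl fun i _ => ?_
  rw [integral_finsetSum _ fun j _ => hi i j]
  refine Finset.sum_congr rfl fun j _ => ?_
  simp_rw [mul_left_comm (u _)]
  rw [integral_const_mul, hu.integral_weakDeriv_pair hm i j hη]

lemma WeakBdd.exists_abs_secondDir_le (hu : WeakBdd m K u) (hm : 2 ≤ m) (l : Space d) :
    ∀ᵐ x, |secondDir l u x| ≤ (∑ i, ∑ j, |l i * l j|) * K := by
  have h : ∀ᵐ x, ∀ i j, |weakDeriv (idx i + idx j) u x| ≤ K := by
    rw [ae_all_iff]; intro i; rw [ae_all_iff]; intro j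
    exact hu.abs_weakDeriv_le (by rw [order_idx_add]; omega)
  filter_upwards [h] with x hx
  rw [secondDir, Finset.sum_mul]
  refine (Finset.abs_sum_le_sum_abs _ _).trans (Finset.sum_le_sum fun i _ => ?_)
  rw [Finset.sum_mul]
  refine (Finset.abs_sum_le_sum_abs _ _).trans (Finset.sum_le_sum fun j _ => ?_)
  rw [abs_mul]
  exact mul_le_mul_of_nonneg_left (hx i j) (abs_nonneg _)

end

/-! ### Existence -/

lemma mollify_const (n : ℕ) (K : ℝ) (x : Space d) : mollify n (fun _ => K) x = K := by
  rw [mollify, integral_mul_const, integral_sub_left_eq_self (kernel d n) volume x, integral_kernel,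
    one_mul]

lemma stepAvg_const (n : ℕ) {τ : ℝ} (hτ : 0 < τ) (k : ℕ) (K : ℝ) (x : Space d) :
    stepAvg n τ k (fun _ _ => K) x = K := by
  simp only [stepAvg, mollify_const]
  rw [setIntegral_const, Real.volume_real_Ioc_of_le (by nlinarith), smul_eq_mul]
  field_simp
  ring

/-- Regarding the artificial rate `K` as a coefficient lets `TimeReg.tendsto_term` treat all terms
of the scheme alike. -/
lemma timeReg_const {K : ℝ} (hK : 0 ≤ K) : TimeReg 0 K (fun _ (_ : Space d) => K) := by
  refine ⟨measurable_const, fun s => ⟨continuous_const, fun α hα => ?_⟩⟩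
  have h0 : α = 0 := by
    ext i
    have := (Finset.sum_eq_zero_iff (s := Finset.univ) (f := α)).1 (Nat.le_zero.1 hα) i
      (Finset.mem_univ i)
    simpa using this
  rw [h0]
  exact ⟨_, isWeakDeriv_zero continuous_const.locallyIntegrable,
    Eventually.of_forall fun x => (abs_of_nonneg hK).le⟩

lemma integrable_mul_mul_test {A B η : Space d → ℝ} (hA : Continuous A) (hB : Continuous B)
    (hη : IsTest η) : Integrable fun x => A x * (B x * η x) := by
  simp_rw [← mul_assoc]
  exact LocallyIntegrable.mul_test (hA.mul hB).locallyIntegrable hη.continuous hη.2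

section

variable {m : ℕ} {K F G : ℝ} {D : ProblemData d}

/-- The rates are split into `b_i` on the forward directions and `K` on all directions, so each
piece has the form of a coefficient average times a difference of `v`. -/
lemma ProblemData.Regular.integral_stepOp (h : D.Regular m K F G) (n : ℕ) {τ : ℝ} (hτ : 0 < τ)
    (k : ℕ) {v η : Space d → ℝ} (hv : SmoothBdd v) (hη : IsTest η) :
    Integrable (fun x => D.stepOp K n τ k v x * η x) ∧
    ∫ x, D.stepOp K n τ k v x * η x =
      (∑ l ∈ D.Λ, 1 / 2 * ∫ x, stepAvg n τ k (D.q l) x * (jumpOp (mesh n) l v x * η x))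
      + (∑ i, ∫ x, stepAvg n τ k (D.b i) x * (diffQuot (mesh n) (unitVec (i, true)) v x * η x))
      + (∑ e, ∫ x, stepAvg n τ k (fun _ _ => K) x * (diffQuot (mesh n) (unitVec e) v x * η x))
      + ∫ x, stepAvg n τ k D.c x * (v x * η x) := by
  have hdq : ∀ e, Continuous (diffQuot (mesh n) (unitVec e) v) := fun e => (hv.diffQuot _ _).continuous
  have i1 : ∀ l ∈ D.Λ, Integrable fun x => 1 / 2 *
      (stepAvg n τ k (D.q l) x * (jumpOp (mesh n) l v x * η x)) := fun l hl =>
    (integrable_mul_mul_test ((h.q_reg l hl).smoothBdd_stepAvg n τ k).continuous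
      (hv.jumpOp _ l).continuous hη).const_mul _
  have i2 : ∀ i ∈ Finset.univ, Integrable fun x =>
      stepAvg n τ k (D.b i) x * (diffQuot (mesh n) (unitVec (i, true)) v x * η x) := fun i _ =>
    integrable_mul_mul_test ((h.b_reg i).smoothBdd_stepAvg n τ k).continuous (hdq _) hη
  have i3 : ∀ e ∈ Finset.univ, Integrable fun x =>
      stepAvg n τ k (fun _ _ => K) x * (diffQuot (mesh n) (unitVec e) v x * η x) := fun e _ =>
    integrable_mul_mul_test ((timeReg_const h.K_nonneg).smoothBdd_stepAvg n τ k).continuous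
      (hdq _) hη
  have i4 : Integrable fun x => stepAvg n τ k D.c x * (v x * η x) :=
    integrable_mul_mul_test (h.c_reg.smoothBdd_stepAvg n τ k).continuous hv.continuous hη
  have e : (fun x => D.stepOp K n τ k v x * η x) = fun x =>
      (∑ l ∈ D.Λ, 1 / 2 * (stepAvg n τ k (D.q l) x * (jumpOp (mesh n) l v x * η x)))
      + (∑ i, stepAvg n τ k (D.b i) x * (diffQuot (mesh n) (unitVec (i, true)) v x * η x))
      + (∑ e, stepAvg n τ k (fun _ _ => K) x * (diffQuot (mesh n) (unitVec e) v x * η x))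
      + stepAvg n τ k D.c x * (v x * η x) := by
    ext x
    have e1 : ∑ e, rates K n τ k D.b e x * diffQuot (mesh n) (unitVec e) v x =
        (∑ i, stepAvg n τ k (D.b i) x * diffQuot (mesh n) (unitVec (i, true)) v x) +
        ∑ e, K * diffQuot (mesh n) (unitVec e) v x := by
      simp only [rates, add_mul, Finset.sum_add_distrib]
      congr 1
      rw [Fintype.sum_prod_type]
      exact Finset.sum_congr rfl fun i _ => by simp
    simp only [stepAvg_const n hτ]
    rw [ProblemData.stepOp, approxOp, e1]
    simp only [add_mul, Finset.sum_mul, mul_assoc]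
    ring
  have j1 := integrable_finsetSum _ i1
  have j2 := integrable_finsetSum _ i2
  have j3 := integrable_finsetSum _ i3
  rw [e]
  have j12 := j1.fun_add j2
  have j123 := j12.fun_add j3
  refine ⟨j123.fun_add i4, ?_⟩
  rw [integral_add j123 i4, integral_add j12 j3, integral_add j1 j2,
    integral_finsetSum _ i1, integral_finsetSum _ i2, integral_finsetSum _ i3]
  simp_rw [integral_const_mul]

/-- The discrete counterpart of the integrated equation; each of its sums over steps is sent to the
limit separately. -/
lemma ProblemData.Regular.integral_scheme (h : D.Regular m K F G) (n : ℕ) {τ : ℝ} (hτ : 0 < τ)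
    {η : Space d → ℝ} (hη : IsTest η) (N : ℕ) :
    ∫ x, D.scheme K n τ N x * η x = (∫ x, mollify n D.g x * η x)
      + ((∑ l ∈ D.Λ, 1 / 2 * ∑ k ∈ Finset.range N, τ * ∫ x, stepAvg n τ k (D.q l) x *
          (jumpOp (mesh n) l (D.scheme K n τ k) x * η x))
      + (∑ i, ∑ k ∈ Finset.range N, τ * ∫ x, stepAvg n τ k (D.b i) x *
          (diffQuot (mesh n) (unitVec (i, true)) (D.scheme K n τ k) x * η x))
      + (∑ e, ∑ k ∈ Finset.range N, τ * ∫ x, stepAvg n τ k (fun _ _ => K) x *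
          (diffQuot (mesh n) (unitVec e) (D.scheme K n τ k) x * η x))
      + (∑ k ∈ Finset.range N, τ * ∫ x, stepAvg n τ k D.c x * (D.scheme K n τ k x * η x))
      + ∑ k ∈ Finset.range N, τ * ∫ x, stepAvg n τ k D.f x * (1 * η x)) := by
  induction N with
  | zero => simp [ProblemData.scheme]
  | succ N ih =>
    have hv := h.smoothBdd_scheme n hτ N
    obtain ⟨i1, e1⟩ := h.integral_stepOp n hτ N hv hη
    have i2 : Integrable fun x => stepAvg n τ N D.f x * (1 * η x) :=
      integrable_mul_mul_test (h.f_reg.smoothBdd_stepAvg n τ N).continuous continuous_const hη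
    have i0 : Integrable fun x => D.scheme K n τ N x * η x :=
      LocallyIntegrable.mul_test hv.continuous.locallyIntegrable hη.continuous hη.2
    have e2 : ∀ x, D.scheme K n τ (N + 1) x * η x = D.scheme K n τ N x * η x +
        τ * (D.stepOp K n τ N (D.scheme K n τ N) x * η x + stepAvg n τ N D.f x * (1 * η x)) :=
      fun x => by rw [ProblemData.scheme]; ring
    simp_rw [e2]
    rw [integral_add i0 ((i1.fun_add i2).const_mul τ), integral_const_mul, integral_add i1 i2, e1, ih]
    simp only [Finset.sum_range_succ, mul_add, Finset.sum_add_distrib, Finset.mul_sum]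
    simp only [mul_left_comm τ]
    ring

lemma ProblemData.Regular.abs_scheme_sub_le (h : D.Regular m K F G) (hm : 2 ≤ m) {n : ℕ} {τ : ℝ}
    (hτ : SmallStep d m K (mesh n) τ D.Λ.card) {T : ℝ} (hT : 0 ≤ T) (N j : ℕ)
    (hk : (N + j : ℕ) * τ ≤ T) (x : Space d) :
    |D.scheme K n τ (N + j) x - D.scheme K n τ N x| ≤
      j * τ * (incrementBound d (2 * K) (∑ l ∈ D.Λ, ‖l‖ ^ 2)
        (Real.sqrt (energyBound d m K (∑ l ∈ D.Λ, ‖l‖ ^ 2) F G T)) + F) := by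
  induction j with
  | zero => simp
  | succ j ih =>
    have hk' : (N + j : ℕ) * τ ≤ T := by
      push_cast at hk ⊢
      nlinarith [hτ.pos]
    have h1 := h.scheme_increment_le hm hτ hT hk' x
    have h2 := abs_sub_le (D.scheme K n τ (N + j + 1) x) (D.scheme K n τ (N + j) x)
      (D.scheme K n τ N x)
    rw [← add_assoc]
    push_cast
    linarith [ih hk']

lemma incrementBound_nonneg (d : ℕ) {K L2 s : ℝ} (hK : 0 ≤ K) (hL : 0 ≤ L2) (hs : 0 ≤ s) :
    0 ≤ incrementBound d K L2 s := by
  unfold incrementBound; positivity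

/-- Equicontinuity of the schemes. -/
lemma ProblemData.Regular.abs_scheme_stepIdx_sub_le (h : D.Regular m K F G) (hm : 2 ≤ m) {n : ℕ}
    {τ : ℝ} (hτ : SmallStep d m K (mesh n) τ D.Λ.card) {T : ℝ} {s S A : ℝ}
    (hs : s = Real.sqrt (energyBound d m K (∑ l ∈ D.Λ, ‖l‖ ^ 2) F G T))
    (hA : A = incrementBound d (2 * K) (∑ l ∈ D.Λ, ‖l‖ ^ 2) s + F)
    (hS : S = A + s)
    (z z' : Icc (0 : ℝ) T × Space d) :
    |D.scheme K n τ (stepIdx τ z.1) z.2 - D.scheme K n τ (stepIdx τ z'.1) z'.2| ≤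
      S * (dist z z' + τ) := by
  have hT : (0:ℝ) ≤ T := z.1.2.1.trans z.1.2.2
  have hs0 : 0 ≤ s := hs ▸ Real.sqrt_nonneg _
  have hs2 : s ^ 2 = energyBound d m K (∑ l ∈ D.Λ, ‖l‖ ^ 2) F G T := by
    rw [hs, Real.sq_sqrt (energyBound_nonneg d m hT)]
  have hA0 : 0 ≤ A := by
    rw [hA]
    exact add_nonneg (incrementBound_nonneg d (by linarith [h.K_nonneg])
      (Finset.sum_nonneg fun _ _ => sq_nonneg _) hs0) h.F_nonneg
  -- If `j` steps separate `t` from `t'`, then `j * τ ≤ t' - t + τ`, and each step contributes at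
  -- most `A * τ`.
  have time : ∀ t t' : Icc (0 : ℝ) T, (t : ℝ) ≤ t' → ∀ x,
      |D.scheme K n τ (stepIdx τ t') x - D.scheme K n τ (stepIdx τ t) x| ≤
        A * (dist t t' + τ) := by
    intro t t' htt x
    have hle : stepIdx τ t ≤ stepIdx τ t' := by
      have : ⌈(t:ℝ) / τ⌉₊ ≤ ⌈(t':ℝ) / τ⌉₊ := by
        have := hτ.pos
        gcongr
      unfold stepIdx; omega
    obtain ⟨j, hj⟩ := Nat.exists_eq_add_of_le hle
    have h1 := stepIdx_mul_le hτ.pos t'.2.1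
    have h2 := le_stepIdx_mul (t := t) hτ.pos
    rw [hj] at h1 ⊢
    have h3 := h.abs_scheme_sub_le hm hτ hT _ j (h1.trans t'.2.2) x
    rw [← hs, ← hA] at h3
    refine h3.trans ?_
    rw [mul_comm]
    refine mul_le_mul_of_nonneg_left ?_ hA0
    push_cast at h1
    rw [Subtype.dist_eq, dist_comm, Real.dist_eq, abs_of_nonneg (by linarith)]
    linarith
  have time' : |D.scheme K n τ (stepIdx τ z.1) z.2 - D.scheme K n τ (stepIdx τ z'.1) z.2| ≤
      A * (dist z z' + τ) := by
    have hd : dist z.1 z'.1 ≤ dist z z' := le_max_left _ _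
    rcases le_total (z.1 : ℝ) z'.1 with hz | hz
    · rw [abs_sub_comm]
      refine (time _ _ hz _).trans ?_
      gcongr
    · refine (time _ _ hz _).trans ?_
      rw [dist_comm]
      gcongr
  have space : |D.scheme K n τ (stepIdx τ z'.1) z.2 - D.scheme K n τ (stepIdx τ z'.1) z'.2| ≤
      s * (dist z z' + τ) := by
    have h1 := abs_sub_le_of_grad (h.smoothBdd_scheme n hτ.pos (stepIdx τ z'.1)).differentiable hs0
      (fun y => grad_wordDeriv_le (m := m) (b := []) (fun x => by
        rw [hs2]
        exact h.energy_scheme_le hm hτ ((stepIdx_mul_le hτ.pos z'.1.2.1).trans z'.1.2.2) x)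
        (by simp; omega) y) z'.2 (z.2 - z'.2)
    rw [add_sub_cancel] at h1
    refine h1.trans (mul_le_mul_of_nonneg_left ?_ hs0)
    rw [← dist_eq_norm]
    have hd : dist z.2 z'.2 ≤ dist z z' := le_max_right _ _
    linarith [hτ.pos]
  have := abs_sub_le (D.scheme K n τ (stepIdx τ z.1) z.2)
    (D.scheme K n τ (stepIdx τ z'.1) z.2) (D.scheme K n τ (stepIdx τ z'.1) z'.2)
  rw [hS, add_mul]
  linarith

end

lemma dirDeriv_unitVec (e : Fin d × Bool) (η : Space d → ℝ) (x : Space d) :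
    dirDeriv (-unitVec e) η x = (if e.2 then -1 else 1) * partialDeriv e.1 η x := by
  rcases e with ⟨i, _ | _⟩ <;> simp [dirDeriv, unitVec, partialDeriv]

/-- The a.e. limit of the one-sided difference quotients. -/
def signedDeriv (e : Fin d × Bool) (v : Space d → ℝ) (x : Space d) : ℝ :=
  (if e.2 then 1 else -1) * weakDeriv (idx e.1) v x

lemma WeakBdd.integral_dirDeriv_unitVec {m : ℕ} {K : ℝ} {u : Space d → ℝ} (hu : WeakBdd m K u)
    (hm : 2 ≤ m) (e : Fin d × Bool) {η : Space d → ℝ} (hη : IsTest η) :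
    ∫ x, u x * dirDeriv (-unitVec e) η x = ∫ x, signedDeriv e u x * η x := by
  simp only [dirDeriv_unitVec, signedDeriv, mul_left_comm (u _), mul_assoc]
  rw [integral_const_mul, integral_const_mul, hu.integral_weakDeriv_idx hm e.1 hη]
  split_ifs <;> ring

lemma WeakBdd.abs_signedDeriv_le {m : ℕ} {K : ℝ} {u : Space d → ℝ} (hu : WeakBdd m K u)
    (hm : 2 ≤ m) (e : Fin d × Bool) : ∀ᵐ x, |signedDeriv e u x| ≤ K := by
  filter_upwards [hu.abs_weakDeriv_le (α := idx e.1) (by rw [order_idx]; omega)] with x hx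
  rw [signedDeriv, abs_mul]
  split_ifs <;> simpa using hx

section

variable {m : ℕ} {K F G : ℝ} {D : ProblemData d}

theorem ProblemData.Regular.exists_solution (h : D.Regular m K F G) (hm : 2 ≤ m) {T : ℝ}
    (hT : 0 ≤ T) : ∃ u : ℝ → Space d → ℝ, Continuous (fun z : ℝ × Space d => u z.1 z.2) ∧
      (∀ t, WeakBdd m (Real.sqrt (energyBound d m K (∑ l ∈ D.Λ, ‖l‖ ^ 2) F G T)) (u t)) ∧
      ∀ t ∈ Icc 0 T, ∀ η : Space d → ℝ, IsTest η → ∫ x, u t x * η x = (∫ x, D.g x * η x)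
        + ((∑ l ∈ D.Λ, 1 / 2 * ∫ s in (0:ℝ)..t, ∫ x, D.q l s x * secondDir l (u s) x * η x)
          + (∑ i, ∫ s in (0:ℝ)..t, ∫ x, D.b i s x * weakDeriv (idx i) (u s) x * η x)
          + (∫ s in (0:ℝ)..t, ∫ x, D.c s x * u s x * η x)
          + ∫ s in (0:ℝ)..t, ∫ x, D.f s x * 1 * η x) := by
  have hmesh0 : Tendsto mesh atTop (nhds 0) := tendsto_one_div_add_atTop_nhds_zero_nat
  have hmesh1 : ∀ n, mesh n ≤ 1 := fun n => by
    rw [mesh, div_le_one (by positivity)]; linarith [(Nat.cast_nonneg n : (0:ℝ) ≤ n)]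
  set L2 := ∑ l ∈ D.Λ, ‖l‖ ^ 2 with hL2
  set s₀ := Real.sqrt (energyBound d m K L2 F G T) with hs₀
  have hs0 : 0 ≤ s₀ := Real.sqrt_nonneg _
  have hs2 : s₀ ^ 2 = energyBound d m K L2 F G T := Real.sq_sqrt (energyBound_nonneg d m hT)
  -- The time step is also kept below the mesh, so that it tends to zero with it.
  choose τ hτ hτm using fun n => exists_smallStep d m h.K_nonneg (mesh_pos n) D.Λ.card (mesh_pos n)
  have hτ0 : Tendsto τ atTop (nhds 0) :=
    squeeze_zero (fun n => (hτ n).pos.le) hτm hmesh0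
  have hE : ∀ n (k : ℕ), k * τ n ≤ T → ∀ x, energy m (D.scheme K n (τ n) k) x ≤ s₀ ^ 2 :=
    fun n k hk x => by rw [hs2]; exact h.energy_scheme_le hm (hτ n) hk x
  have hw : ∀ n (k : ℕ), k * τ n ≤ T → ∀ w : List (Fin d), w.length ≤ m → ∀ x,
      |wordDeriv w (D.scheme K n (τ n) k) x| ≤ s₀ :=
    fun n k hk w hw x => abs_wordDeriv_le hs0 (hE n k hk x) hw
  have hv : ∀ n (k : ℕ), k * τ n ≤ T → ∀ x, |D.scheme K n (τ n) k x| ≤ s₀ :=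
    fun n k hk x => hw n k hk [] (by simp) x
  have hsm : ∀ n k, SmoothBdd (D.scheme K n (τ n) k) := fun n k =>
    h.smoothBdd_scheme n (hτ n).pos k
  have hidx : ∀ n {t : ℝ}, t ∈ Icc 0 T → stepIdx (τ n) t * τ n ≤ T := fun n t ht =>
    (stepIdx_mul_le (hτ n).pos ht.1).trans ht.2
  set A := incrementBound d (2 * K) L2 s₀ + F with hA
  have hA0 : 0 ≤ A := add_nonneg (incrementBound_nonneg d (by linarith [h.K_nonneg])
      (Finset.sum_nonneg fun _ _ => sq_nonneg _) hs0) h.F_nonneg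
  have hV := fun n => h.abs_scheme_stepIdx_sub_le hm (hτ n) (T := T) hs₀ hA rfl
  have : Nonempty (Icc (0:ℝ) T × Space d) := ⟨⟨⟨0, le_rfl, hT⟩, 0⟩⟩
  obtain ⟨φ, hφ, u, hu⟩ := exists_subseq_tendsto
    (V := fun n (z : Icc (0:ℝ) T × Space d) => D.scheme K n (τ n) (stepIdx (τ n) z.1) z.2)
    (B := s₀) (add_nonneg hA0 hs0) hτ0 (fun n z => hv n _ (hidx n z.1.2) _) hV
  have hφt := hφ.tendsto_atTop
  have huc : Continuous u := by
    refine (LipschitzWith.of_dist_le_mul (K := ⟨A + s₀, add_nonneg hA0 hs0⟩)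
      fun z z' => ?_).continuous
    have h1 := ((hu z).sub (hu z')).abs
    have h2 : Tendsto (fun n => (A + s₀) * (dist z z' + τ (φ n))) atTop
        (nhds ((A + s₀) * (dist z z' + 0))) :=
      ((hτ0.comp hφt).const_add _).const_mul _
    rw [add_zero] at h2
    exact le_of_tendsto_of_tendsto' h1 h2 fun n => hV (φ n) z z'
  -- Freezing the limit outside `[0, T]` gives a function continuous for all times.
  set U : ℝ → Space d → ℝ := fun t x => u (projIcc 0 T hT t, x) with hU
  have hUlim : ∀ t ∈ Icc 0 T, ∀ x, Tendsto
      (fun n => D.scheme K (φ n) (τ (φ n)) (stepIdx (τ (φ n)) t) x) atTop (nhds (U t x)) := by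
    intro t ht x
    simp only [hU]
    rw [projIcc_of_mem hT ht]
    exact hu (⟨t, ht⟩, x)
  have hUW : ∀ t, WeakBdd m s₀ (U t) := fun t =>
    weakBdd_of_tendsto (v := fun n => D.scheme K (φ n) (τ (φ n))
      (stepIdx (τ (φ n)) (projIcc 0 T hT t : Icc 0 T))) (fun n => hsm _ _)
      (fun n => hw (φ n) _ (hidx (φ n) (projIcc 0 T hT t).2))
      (huc.comp (by fun_prop)) (fun x => hu (projIcc 0 T hT t, x))
  refine ⟨U, huc.comp ((continuous_projIcc.comp continuous_fst).prodMk continuous_snd), hUW,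
    fun t ht η hη => ?_⟩
  have hpos : ∀ n, 0 < τ (φ n) := fun n => (hτ _).pos
  have hτφ := hτ0.comp hφt
  have hmφ := hmesh0.comp hφt
  have l0 : Tendsto (fun n => ∫ x, D.scheme K (φ n) (τ (φ n)) (stepIdx (τ (φ n)) t) x * η x)
      atTop (nhds (∫ x, U t x * η x)) :=
    tendsto_integral_mul (fun n => (hsm _ _).continuous.aestronglyMeasurable)
      (fun n => hv (φ n) _ (hidx (φ n) ht)) (hUlim t ht) hη.integrable
  have lg : Tendsto (fun n => ∫ x, mollify (φ n) D.g x * η x) atTop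
      (nhds (∫ x, D.g x * η x)) :=
    tendsto_integral_mul (fun n => (h.g_reg.smoothBdd_mollify _).continuous.aestronglyMeasurable)
      (fun n => h.g_reg.abs_wordDeriv_mollify_le (φ n) (w := []) (by simp))
      (fun x => (tendsto_mollify h.g_reg.continuous x).comp hφt) hη.integrable
  have ld : ∀ (ψ : ℝ → Space d → ℝ) (m' : ℕ) (K' : ℝ), TimeReg m' K' ψ → ∀ e : Fin d × Bool,
      Tendsto (fun n => ∑ k ∈ Finset.range (stepIdx (τ (φ n)) t), τ (φ n) *
        ∫ x, stepAvg (φ n) (τ (φ n)) k ψ x * (diffQuot (mesh (φ n)) (unitVec e)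
          (D.scheme K (φ n) (τ (φ n)) k) x * η x)) atTop
        (nhds (∫ s in (0:ℝ)..t, ∫ x, ψ s x * signedDeriv e (U s) x * η x)) :=
    fun ψ m' K' hψ e => hψ.tendsto_term hφt hpos hτφ (B := s₀)
      (H := fun s => signedDeriv e (U s))
      (fun n k => ((hsm _ _).diffQuot _ _).continuous)
      (fun n k hk x => abs_diffQuot_le (hsm _ _).differentiable hs0
        (fun z => grad_wordDeriv_le (b := []) (hE (φ n) k hk) (by simp; omega) z) (mesh_pos _)
        (norm_unitVec e) x)
      (fun s _ => ((hUW s).aestronglyMeasurable_weakDeriv (by rw [order_idx]; omega)).const_mul _)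
      (fun s _ => (hUW s).abs_signedDeriv_le hm e)
      (fun s hs ζ hζ => by
        rw [← (hUW s).integral_dirDeriv_unitVec hm e hζ]
        exact tendsto_diffQuot_test hζ (norm_unitVec e) (fun n => mesh_pos _)
          (fun n => hmesh1 _) hmφ (fun n => (hsm _ _).continuous)
          (fun n => hv (φ n) _ (hidx (φ n) hs)) (hUlim s hs)) hη ht
  have lq : ∀ l ∈ D.Λ,
      Tendsto (fun n => ∑ k ∈ Finset.range (stepIdx (τ (φ n)) t), τ (φ n) *
        ∫ x, stepAvg (φ n) (τ (φ n)) k (D.q l) x * (jumpOp (mesh (φ n)) l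
          (D.scheme K (φ n) (τ (φ n)) k) x * η x)) atTop
        (nhds (∫ s in (0:ℝ)..t, ∫ x, D.q l s x * secondDir l (U s) x * η x)) := by
    intro l hl
    -- One constant has to dominate both the discrete jump operators and the limiting second
    -- derivative, which are estimated differently.
    set B := 12 * (d + 1) * ‖l‖ ^ 2 * s₀ + (∑ i, ∑ j, |l i * l j|) * s₀ with hB
    have hB1 : 0 ≤ 12 * (d + 1) * ‖l‖ ^ 2 * s₀ := by positivity
    have hB2 : 0 ≤ (∑ i, ∑ j, |l i * l j|) * s₀ := by positivity
    refine (h.q_reg l hl).tendsto_term hφt hpos hτφ (B := B)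
      (fun n k => ((hsm _ _).jumpOp _ _).continuous)
      (fun n k hk x => (abs_jumpOp_le_of_energy hm (hsm _ _) hs0 (hE (φ n) k hk) (mesh_pos _) l
        x).trans (by linarith))
      (fun s _ => (hUW s).aestronglyMeasurable_secondDir hm l)
      (fun s _ => ((hUW s).exists_abs_secondDir_le hm l).mono fun x hx => hx.trans (by linarith))
      (fun s hs ζ hζ => ?_) hη ht
    rw [← (hUW s).integral_dirDeriv_dirDeriv hm l hζ]
    exact tendsto_jumpOp_test hζ l (fun n => mesh_pos _)
          (fun n => hmesh1 _) hmφ (fun n => (hsm _ _).continuous)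
          (fun n => hv (φ n) _ (hidx (φ n) hs)) (hUlim s hs)
  have lc : Tendsto (fun n => ∑ k ∈ Finset.range (stepIdx (τ (φ n)) t), τ (φ n) *
        ∫ x, stepAvg (φ n) (τ (φ n)) k D.c x * (D.scheme K (φ n) (τ (φ n)) k x * η x)) atTop
        (nhds (∫ s in (0:ℝ)..t, ∫ x, D.c s x * U s x * η x)) :=
    h.c_reg.tendsto_term hφt hpos hτφ (B := s₀)
      (fun n k => (hsm _ _).continuous) (fun n k hk => hv (φ n) k hk)
      (fun s _ => (hUW s).continuous.aestronglyMeasurable)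
      (fun s _ => Eventually.of_forall (hUW s).abs_le)
      (fun s hs ζ hζ => tendsto_integral_mul
        (fun n => (hsm _ _).continuous.aestronglyMeasurable)
        (fun n => hv (φ n) _ (hidx (φ n) hs)) (hUlim s hs) hζ.integrable) hη ht
  have lf : Tendsto (fun n => ∑ k ∈ Finset.range (stepIdx (τ (φ n)) t), τ (φ n) *
        ∫ x, stepAvg (φ n) (τ (φ n)) k D.f x * (1 * η x)) atTop
        (nhds (∫ s in (0:ℝ)..t, ∫ x, D.f s x * 1 * η x)) :=
    h.f_reg.tendsto_term hφt hpos hτφ (B := 1) (h := fun _ _ _ => 1) (H := fun _ _ => 1)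
      (fun n k => continuous_const) (fun n k _ x => by simp)
      (fun s _ => continuous_const.aestronglyMeasurable)
      (fun s _ => Eventually.of_forall fun x => by simp)
      (fun s hs ζ hζ => tendsto_const_nhds) hη ht
  have lK : ∑ e : Fin d × Bool,
      ∫ s in (0:ℝ)..t, ∫ x, (fun _ _ => K) s x * signedDeriv e (U s) x * η x = 0 := by
    rw [Fintype.sum_prod_type]
    refine Finset.sum_eq_zero fun i _ => ?_
    rw [Fintype.sum_bool, add_eq_zero_iff_eq_neg, ← intervalIntegral.integral_neg]
    congr 1
    ext s
    rw [← integral_neg]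
    congr 1
    ext x
    simp [signedDeriv]
  have hlim := lg.add (((((tendsto_finsetSum D.Λ fun l hl => (lq l hl).const_mul (1 / 2 : ℝ)).add
    (tendsto_finsetSum Finset.univ fun i _ => ld (D.b i) _ _ (h.b_reg i) (i, true))).add
    (tendsto_finsetSum Finset.univ fun e _ => ld (fun _ _ => K) _ _ (timeReg_const h.K_nonneg) e)
    ).add lc).add lf)
  rw [lK, add_zero] at hlim
  have heq := tendsto_nhds_unique l0
    (hlim.congr fun n => (h.integral_scheme (φ n) (hpos n) hη _).symm)
  rw [heq]
  simp only [signedDeriv, if_true, one_mul]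

end

/-! ### Measurability in time -/

/-- Bounded functions of time and space that agree, at each time and for almost every `x`, with a
jointly measurable function. -/
structure TimeBdd (H : ℝ → Space d → ℝ) : Prop where
  version : ∃ J : ℝ → Space d → ℝ, (Measurable fun z : ℝ × Space d => J z.1 z.2) ∧
    ∀ s, H s =ᵐ[volume] J s
  bound : ∃ B, ∀ s, ∀ᵐ x, |H s x| ≤ B

section

variable {H H' : ℝ → Space d → ℝ}

lemma TimeBdd.add (h : TimeBdd H) (h' : TimeBdd H') : TimeBdd fun s x => H s x + H' s x := by
  obtain ⟨⟨J, hJ, e⟩, B, hB⟩ := h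
  obtain ⟨⟨J', hJ', e'⟩, B', hB'⟩ := h'
  refine ⟨⟨fun s x => J s x + J' s x, hJ.add hJ', fun s => (e s).add (e' s)⟩, B + B', fun s => ?_⟩
  filter_upwards [hB s, hB' s] with x h1 h2
  exact (abs_add_le _ _).trans (add_le_add h1 h2)

lemma TimeBdd.mul (h : TimeBdd H) (h' : TimeBdd H') : TimeBdd fun s x => H s x * H' s x := by
  obtain ⟨⟨J, hJ, e⟩, B, hB⟩ := h
  obtain ⟨⟨J', hJ', e'⟩, B', hB'⟩ := h'
  refine ⟨⟨fun s x => J s x * J' s x, hJ.mul hJ', fun s => (e s).mul (e' s)⟩, B * B', fun s => ?_⟩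
  filter_upwards [hB s, hB' s] with x h1 h2
  rw [abs_mul]
  exact mul_le_mul h1 h2 (abs_nonneg _) ((abs_nonneg _).trans h1)

lemma timeBdd_const (a : ℝ) : TimeBdd fun _ (_ : Space d) => a :=
  ⟨⟨_, measurable_const, fun _ => EventuallyEq.rfl⟩, |a|, fun _ => Eventually.of_forall fun _ => le_rfl⟩

lemma TimeBdd.const_mul (h : TimeBdd H) (a : ℝ) : TimeBdd fun s x => a * H s x :=
  (timeBdd_const a).mul h

lemma TimeBdd.finset_sum {ι : Type*} (S : Finset ι) {H : ι → ℝ → Space d → ℝ}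
    (h : ∀ k ∈ S, TimeBdd (H k)) : TimeBdd fun s x => ∑ k ∈ S, H k s x := by
  classical
  induction S using Finset.induction_on with
  | empty => simpa using timeBdd_const 0
  | insert a S ha ih =>
    simp only [Finset.sum_insert ha]
    exact (h a (by simp)).add (ih fun k hk => h k (by simp [hk]))

lemma TimeBdd.aestronglyMeasurable (h : TimeBdd H) (s : ℝ) : AEStronglyMeasurable (H s) := by
  obtain ⟨⟨J, hJ, e⟩, -⟩ := h
  exact AEStronglyMeasurable.congr (hJ.comp (measurable_const.prodMk measurable_id)).aestronglyMeasurable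
    (e s).symm

lemma TimeBdd.integrable (h : TimeBdd H) {η : Space d → ℝ} (hη : Integrable η) (s : ℝ) :
    Integrable fun x => H s x * η x := by
  obtain ⟨B, hB⟩ := h.bound
  exact integrable_bdd_mul (h.aestronglyMeasurable s) (hB s) hη

lemma TimeBdd.locallyIntegrable (h : TimeBdd H) (s : ℝ) : LocallyIntegrable (H s) := by
  obtain ⟨B, hB⟩ := h.bound
  refine LocallyIntegrable.mono (g := H s) (locallyIntegrable_const B) (h.aestronglyMeasurable s) ?_
  filter_upwards [hB s] with x hx
  exact hx.trans (le_abs_self B)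

/-- Integration in `x` does not see the choice of representative, so measurability in time is
inherited from the jointly measurable version. -/
lemma TimeBdd.intervalIntegrable (h : TimeBdd H) {η : Space d → ℝ} (hη : IsTest η) (a b : ℝ) :
    IntervalIntegrable (fun s => ∫ x, H s x * η x) volume a b := by
  obtain ⟨⟨J, hJ, e⟩, B, hB⟩ := h
  have h1 : (fun s => ∫ x, H s x * η x) = fun s => ∫ x, J s x * η x := funext fun s =>
    integral_congr_ae (by filter_upwards [e s] with x hx; rw [hx])
  have hm : Measurable fun s => ∫ x, H s x * η x := by
    rw [h1]
    have h2 : Measurable fun z : ℝ × Space d => J z.1 z.2 * η z.2 :=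
      hJ.mul (hη.continuous.measurable.comp measurable_snd)
    exact h2.stronglyMeasurable.integral_prod_right'.measurable
  rw [intervalIntegrable_iff]
  have : IsFiniteMeasure (volume.restrict (uIoc a b)) :=
    ⟨by rw [Measure.restrict_apply_univ]; exact measure_Ioc_lt_top⟩
  exact Integrable.of_bound (C := B * ∫ x, |η x|) hm.aestronglyMeasurable
    (Eventually.of_forall fun s => abs_integral_bdd_mul_le (hB s) hη.integrable)

end

section

variable {m : ℕ} {K : ℝ} {ψ : ℝ → Space d → ℝ}

lemma TimeReg.timeBdd (h : TimeReg m K ψ) : TimeBdd ψ :=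
  ⟨⟨ψ, h.measurable, fun _ => EventuallyEq.rfl⟩, K, fun s => Eventually.of_forall (h.weakBdd s).abs_le⟩

/-- `weakDeriv` is chosen separately at each time, and nothing makes it jointly measurable. The
upper limit of the derivatives of the mollifications is a jointly measurable version, by Lebesgue
differentiation at each time. -/
lemma TimeReg.timeBdd_weakDeriv (h : TimeReg m K ψ) {α : Fin d → ℕ} (hα : order α ≤ m) :
    TimeBdd fun s => weakDeriv α (ψ s) := by
  refine ⟨⟨fun s x => limsup (fun n => wordDeriv (idxWord α) (mollify n (ψ s)) x) atTop,
    ?_, fun s => ?_⟩, K, fun s => (h.weakBdd s).abs_weakDeriv_le hα⟩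
  · refine Measurable.limsup fun n => ?_
    have h1 : ∀ s, wordDeriv (idxWord α) (mollify n (ψ s)) = fun x =>
        ∫ y, wordDeriv (idxWord α) (kernel d n) (x - y) * ψ s y := fun s =>
      wordDeriv_conv (isTest_kernel n) (h.weakBdd s).continuous.locallyIntegrable _
    simp_rw [h1]
    exact measurable_conv ((isTest_kernel n).wordDeriv _).continuous h.measurable
  · have hw := (h.weakBdd s).isWeakDeriv hα
    have e : (fun i => (idxWord α).count i) = α := funext fun i => count_idxWord α i
    filter_upwards [ae_tendsto_mollify hw.2.1] with x hx
    rw [← hx.limsup_eq]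
    congr 1
    ext n
    rw [wordDeriv_mollify (e.symm ▸ hw), e]

end

/-! ### The equation -/

/-- The part of the operator with derivatives. -/
def ProblemData.diffOp (D : ProblemData d) (s : ℝ) (v : Space d → ℝ) (x : Space d) : ℝ :=
  (∑ l ∈ D.Λ, 1 / 2 * (D.q l s x * secondDir l v x)) + ∑ i, D.b i s x * weakDeriv (idx i) v x

/-- The integrated equation. -/
def ProblemData.Solves (D : ProblemData d) (T : ℝ) (u : ℝ → Space d → ℝ) : Prop :=
  ∀ t ∈ Icc 0 T, ∀ η : Space d → ℝ, IsTest η → ∫ x, u t x * η x = (∫ x, D.g x * η x)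
    + (∫ s in (0:ℝ)..t, ∫ x, (D.c s x * u s x + D.f s x) * η x)
    + ∫ s in (0:ℝ)..t, ∫ x, D.diffOp s (u s) x * η x

section

variable {m : ℕ} {K F G : ℝ} {D : ProblemData d}

lemma TimeReg.timeBdd_secondDir {B : ℝ} {u : ℝ → Space d → ℝ} (hu : TimeReg m B u) (hm : 2 ≤ m)
    (l : Space d) : TimeBdd fun s => secondDir l (u s) :=
  TimeBdd.finset_sum _ fun i _ => TimeBdd.finset_sum _ fun j _ =>
    (hu.timeBdd_weakDeriv (by rw [order_idx_add]; omega)).const_mul _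

lemma TimeReg.timeBdd_firstDeriv {B : ℝ} {u : ℝ → Space d → ℝ} (hu : TimeReg m B u) (hm : 2 ≤ m)
    (i : Fin d) : TimeBdd fun s => weakDeriv (idx i) (u s) :=
  hu.timeBdd_weakDeriv (by rw [order_idx]; omega)

variable {m' : ℕ} {B : ℝ} {u : ℝ → Space d → ℝ}

lemma ProblemData.Regular.timeBdd_diffOp (h : D.Regular m K F G)
    (hu : TimeReg m' B u) (hm : 2 ≤ m') : TimeBdd fun s => D.diffOp s (u s) :=
  (TimeBdd.finset_sum _ fun l hl =>
      ((h.q_reg l hl).timeBdd.mul (hu.timeBdd_secondDir hm l)).const_mul _).add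
    (TimeBdd.finset_sum _ fun i _ => (h.b_reg i).timeBdd.mul (hu.timeBdd_firstDeriv hm i))

lemma TimeBdd.integral_integral_add {H H' : ℝ → Space d → ℝ} (h : TimeBdd H) (h' : TimeBdd H')
    {η : Space d → ℝ} (hη : IsTest η) (a b : ℝ) :
    ∫ s in a..b, ∫ x, (H s x + H' s x) * η x =
      (∫ s in a..b, ∫ x, H s x * η x) + ∫ s in a..b, ∫ x, H' s x * η x := by
  rw [← intervalIntegral.integral_add (h.intervalIntegrable hη a b) (h'.intervalIntegrable hη a b)]
  congr 1
  ext s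
  simp_rw [add_mul]
  exact integral_add (h.integrable hη.integrable s) (h'.integrable hη.integrable s)

lemma TimeBdd.integral_integral_sum {ι : Type*} (S : Finset ι) {H : ι → ℝ → Space d → ℝ}
    (h : ∀ k ∈ S, TimeBdd (H k)) {η : Space d → ℝ} (hη : IsTest η) (a b : ℝ) :
    ∫ s in a..b, ∫ x, (∑ k ∈ S, H k s x) * η x = ∑ k ∈ S, ∫ s in a..b, ∫ x, H k s x * η x := by
  rw [← intervalIntegral.integral_finsetSum fun k hk => (h k hk).intervalIntegrable hη a b]
  congr 1
  ext s
  simp_rw [Finset.sum_mul]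
  exact integral_finsetSum _ fun k hk => (h k hk).integrable hη.integrable s

/-- Collects the separate time integrals into those of the whole operator; this requires every
summand to be integrable in time, which `TimeBdd` provides. -/
theorem ProblemData.Regular.exists_solves (h : D.Regular m K F G) (hm : 2 ≤ m) {T : ℝ}
    (hT : 0 ≤ T) : ∃ u : ℝ → Space d → ℝ, Continuous (fun z : ℝ × Space d => u z.1 z.2) ∧
      TimeReg m (Real.sqrt (energyBound d m K (∑ l ∈ D.Λ, ‖l‖ ^ 2) F G T)) u ∧ D.Solves T u := by
  obtain ⟨u, hc, hb, he⟩ := h.exists_solution hm hT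
  have hu : TimeReg m (Real.sqrt (energyBound d m K (∑ l ∈ D.Λ, ‖l‖ ^ 2) F G T)) u :=
    ⟨hc.measurable, hb⟩
  refine ⟨u, hc, hu, fun t ht η hη => ?_⟩
  have h1 : ∀ l ∈ D.Λ, TimeBdd fun s x => 1 / 2 * (D.q l s x * secondDir l (u s) x) := fun l hl =>
    ((h.q_reg l hl).timeBdd.mul (hu.timeBdd_secondDir hm l)).const_mul _
  have h2 : ∀ i ∈ Finset.univ, TimeBdd fun s x => D.b i s x * weakDeriv (idx i) (u s) x :=
    fun i _ => (h.b_reg i).timeBdd.mul (hu.timeBdd_firstDeriv hm i)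
  rw [he t ht η hη, TimeBdd.integral_integral_add (h.c_reg.timeBdd.mul hu.timeBdd) h.f_reg.timeBdd
    hη]
  simp only [ProblemData.diffOp]
  rw [TimeBdd.integral_integral_add (TimeBdd.finset_sum _ h1) (TimeBdd.finset_sum _ h2) hη,
    TimeBdd.integral_integral_sum _ h1 hη, TimeBdd.integral_integral_sum _ h2 hη]
  simp_rw [mul_one, mul_assoc (1 / 2 : ℝ), integral_const_mul, intervalIntegral.integral_const_mul]
  ring

/-- The whole operator. -/
def ProblemData.fullOp (D : ProblemData d) (s : ℝ) (v : Space d → ℝ) (x : Space d) : ℝ :=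
  D.diffOp s v x + D.c s x * v x

lemma ProblemData.Regular.timeBdd_fullOp (h : D.Regular m K F G)
    (hu : TimeReg m' B u) (hm : 2 ≤ m') : TimeBdd fun s => D.fullOp s (u s) :=
  (h.timeBdd_diffOp hu hm).add (h.c_reg.timeBdd.mul hu.timeBdd)

lemma WeakBdd.sub {K K' : ℝ} {v v' : Space d → ℝ} (h : WeakBdd m K v) (h' : WeakBdd m K' v') :
    WeakBdd m (K + K') (fun x => v x - v' x) ∧ ∀ α, order α ≤ m →
      weakDeriv α (fun x => v x - v' x) =ᵐ[volume] fun x => weakDeriv α v x - weakDeriv α v' x := by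
  have e : (fun x => v x - v' x) = fun x => v x + -1 * v' x := by ext x; ring
  have key : ∀ α, order α ≤ m → IsWeakDeriv α (fun x => v x - v' x)
      (fun x => weakDeriv α v x + -1 * weakDeriv α v' x) := fun α hα => by
    rw [e]; exact (h.isWeakDeriv hα).add ((h'.isWeakDeriv hα).const_mul (-1))
  refine ⟨⟨h.continuous.sub h'.continuous, fun α hα => ⟨_, key α hα, ?_⟩⟩, fun α hα => ?_⟩
  · filter_upwards [h.abs_weakDeriv_le hα, h'.abs_weakDeriv_le hα] with x h1 h2
    refine (abs_add_le _ _).trans (add_le_add h1 ?_)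
    rwa [neg_one_mul, abs_neg]
  · filter_upwards [(key α hα).weakDeriv_ae_eq] with x hx
    rw [hx]; ring

/-- Linearity holds only almost everywhere, since representatives of weak derivatives are chosen. -/
lemma ProblemData.fullOp_sub (D : ProblemData d) {B' : ℝ} {v v' : Space d → ℝ}
    (hv : WeakBdd m' B v) (hv' : WeakBdd m' B' v') (hm : 2 ≤ m') (s : ℝ) :
    ∀ᵐ x, D.fullOp s (fun x => v x - v' x) x = D.fullOp s v x - D.fullOp s v' x := by
  have e := (hv.sub hv').2
  have h1 : ∀ᵐ x, ∀ i, weakDeriv (idx i) (fun x => v x - v' x) x =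
      weakDeriv (idx i) v x - weakDeriv (idx i) v' x := by
    rw [ae_all_iff]; intro i
    exact e _ (by rw [order_idx]; omega)
  have h2 : ∀ᵐ x, ∀ i j, weakDeriv (idx i + idx j) (fun x => v x - v' x) x =
      weakDeriv (idx i + idx j) v x - weakDeriv (idx i + idx j) v' x := by
    rw [ae_all_iff]; intro i; rw [ae_all_iff]; intro j
    exact e _ (by rw [order_idx_add]; omega)
  filter_upwards [h1, h2] with x h1 h2
  simp only [ProblemData.fullOp, ProblemData.diffOp, secondDir, h1, h2, mul_sub,
    Finset.sum_sub_distrib]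
  ring

/-- The difference of two solutions solves the homogeneous equation. -/
lemma ProblemData.Regular.integral_sub (h : D.Regular m K F G) {B' : ℝ} {u' : ℝ → Space d → ℝ}
    (hu : TimeReg m' B u) (hu' : TimeReg m' B' u') (hm : 2 ≤ m') {T : ℝ} (hs : D.Solves T u)
    (hs' : D.Solves T u') {t : ℝ} (ht : t ∈ Icc 0 T) {η : Space d → ℝ} (hη : IsTest η) :
    ∫ x, (u t x - u' t x) * η x =
      ∫ s in (0:ℝ)..t, ∫ x, D.fullOp s (fun x => u s x - u' s x) x * η x := by
  have key : ∀ (v : ℝ → Space d → ℝ) (B : ℝ), TimeReg m' B v → D.Solves T v →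
      ∫ x, v t x * η x = (∫ x, D.g x * η x) + (∫ s in (0:ℝ)..t, ∫ x, D.f s x * η x) +
        ∫ s in (0:ℝ)..t, ∫ x, D.fullOp s (v s) x * η x := by
    intro v B hv hsv
    have hcv := h.c_reg.timeBdd.mul hv.timeBdd
    rw [hsv t ht η hη, TimeBdd.integral_integral_add hcv h.f_reg.timeBdd hη]
    simp only [ProblemData.fullOp]
    rw [TimeBdd.integral_integral_add (h.timeBdd_diffOp hv hm) hcv hη]
    ring
  have e1 : ∀ s, ∫ x, D.fullOp s (fun x => u s x - u' s x) x * η x =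
      (∫ x, D.fullOp s (u s) x * η x) - ∫ x, D.fullOp s (u' s) x * η x := fun s => by
    rw [← MeasureTheory.integral_sub ((h.timeBdd_fullOp hu hm).integrable hη.integrable s)
      ((h.timeBdd_fullOp hu' hm).integrable hη.integrable s)]
    refine integral_congr_ae ?_
    filter_upwards [D.fullOp_sub (hu.weakBdd s) (hu'.weakBdd s) hm s] with x hx
    rw [hx, sub_mul]
  simp_rw [e1, sub_mul]
  rw [MeasureTheory.integral_sub (hu.timeBdd.integrable hη.integrable t)
    (hu'.timeBdd.integrable hη.integrable t), key u B hu hs, key u' B' hu' hs',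
    intervalIntegral.integral_sub ((h.timeBdd_fullOp hu hm).intervalIntegrable hη 0 t)
    ((h.timeBdd_fullOp hu' hm).intervalIntegrable hη 0 t)]
  ring

end

/-! ### Uniqueness -/

/-- Families of smooth functions with bounds of all derivatives proportional to `ρ`. -/
structure SmoothFamily {ι : Type*} (ρ : ι → ℝ) (V : ι → Space d → ℝ) : Prop where
  smooth : ∀ i, SmoothBdd (V i)
  bound : ∀ w, ∃ B, ∀ i x, |wordDeriv w (V i) x| ≤ B * ρ i

lemma wordDeriv_dirDeriv {v : Space d → ℝ} (hv : SmoothBdd v) (w : List (Fin d)) (l x : Space d) :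
    wordDeriv w (dirDeriv l v) x = ∑ i, l i * wordDeriv (w ++ [i]) v x := by
  rw [dirDeriv_eq, wordDeriv_finset_sum _ _ fun i _ => (hv.partial_ i).const_mul _]
  refine Finset.sum_congr rfl fun i _ => ?_
  rw [wordDeriv_const_mul _ _ (hv.partial_ i), wordDeriv_append]
  rfl

lemma SmoothFamily.dirDeriv {ι : Type*} {ρ : ι → ℝ} {V : ι → Space d → ℝ} (h : SmoothFamily ρ V)
    (l : Space d) : SmoothFamily ρ fun i => dirDeriv l (V i) := by
  refine ⟨fun i => (h.smooth i).dirDeriv l, fun w => ?_⟩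
  choose B hB using fun i => h.bound (w ++ [i])
  refine ⟨∑ j, |l j| * B j, fun i x => ?_⟩
  rw [wordDeriv_dirDeriv (h.smooth i), Finset.sum_mul]
  refine (Finset.abs_sum_le_sum_abs _ _).trans (Finset.sum_le_sum fun j _ => ?_)
  rw [abs_mul, mul_assoc]
  exact mul_le_mul_of_nonneg_left (hB j i x) (abs_nonneg _)

lemma SmoothFamily.abs_le {ι : Type*} {ρ : ι → ℝ} {V : ι → Space d → ℝ} (h : SmoothFamily ρ V) :
    ∃ B, ∀ i x, |V i x| ≤ B * ρ i := h.bound []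

/-- The mollifications have gradients of norm at most `K √d ≤ K (d + 1)`, and the Lipschitz bound
passes to the pointwise limit. -/
lemma WeakBdd.abs_sub_le {m : ℕ} {K : ℝ} {φ : Space d → ℝ} (h : WeakBdd m K φ) (hm : 1 ≤ m)
    (x y : Space d) : |φ x - φ y| ≤ K * (d + 1) * ‖x - y‖ := by
  have hK : 0 ≤ K := (abs_nonneg _).trans (h.abs_le 0)
  have h1 : ∀ n, |mollify n φ x - mollify n φ y| ≤ K * (d + 1) * ‖x - y‖ := fun n => by
    have := abs_sub_le_of_grad (h.smoothBdd_mollify n).differentiable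
      (s := K * (d + 1)) (by positivity) (fun z => by
        have h2 : ∀ i ∈ Finset.univ, partialDeriv i (mollify n φ) z ^ 2 ≤ K ^ 2 := fun i _ => by
          have := h.abs_wordDeriv_mollify_le n (w := [i]) (by simpa using hm) z
          exact sq_le_sq' (_root_.abs_le.1 this).1 (_root_.abs_le.1 this).2
        refine (Finset.sum_le_card_nsmul _ _ _ h2).trans ?_
        rw [Finset.card_univ, Fintype.card_fin, nsmul_eq_mul, mul_pow, mul_comm]
        gcongr
        nlinarith [(Nat.cast_nonneg d : (0:ℝ) ≤ d)]) y (x - y)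
    rwa [add_sub_cancel] at this
  exact le_of_tendsto (((tendsto_mollify h.continuous x).sub (tendsto_mollify h.continuous y)).abs)
    (Eventually.of_forall h1)

/-- Friedrichs' commutator: the kernel vanishes beyond the distance `mesh n`, within which `a`
varies by at most `P * mesh n`. -/
lemma abs_mollify_mul_sub_le {a H : Space d → ℝ} (hac : Continuous a) {P B : ℝ} (hP : 0 ≤ P)
    (ha : ∀ y z, |a y - a z| ≤ P * ‖y - z‖) (hH : LocallyIntegrable H) (hB : ∀ᵐ y, |H y| ≤ B)
    (n : ℕ) (x : Space d) :
    |mollify n (fun y => a y * H y) x - a x * mollify n H x| ≤ P * mesh n * B := by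
  have hκ := (isTest_kernel (d := d) n).comp_sub x
  have hB0 : 0 ≤ B := by
    obtain ⟨y, hy⟩ := hB.exists
    exact (abs_nonneg _).trans hy
  have i1 : Integrable fun y => kernel d n (x - y) * (a y * H y) := by
    have := LocallyIntegrable.mul_test hH (hκ.continuous.mul hac) hκ.2.mul_right
    refine this.congr (Eventually.of_forall fun y => ?_)
    simp only [Pi.mul_apply]
    ring
  have i2 := (convKernel_integrable (isTest_kernel n) hH x).const_mul (a x)
  rw [mollify, mollify, ← integral_const_mul, ← integral_sub i1 i2]
  have h1 : ∫ y, kernel d n (x - y) * (P * mesh n * B) = P * mesh n * B := mollify_const n _ x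
  rw [← h1]
  refine norm_integral_le_of_norm_le (f := fun y => kernel d n (x - y) * (a y * H y) -
    a x * (kernel d n (x - y) * H y)) (hκ.integrable.mul_const _) ?_
  filter_upwards [hB] with y hy
  have e : kernel d n (x - y) * (a y * H y) - a x * (kernel d n (x - y) * H y) =
      kernel d n (x - y) * ((a y - a x) * H y) := by ring
  rw [e, norm_mul, Real.norm_of_nonneg (kernel_nonneg n _)]
  rcases le_or_gt (1 / ((n : ℝ) + 1)) ‖x - y‖ with hn | hn
  · rw [kernel_eq_zero hn]; simp
  · refine mul_le_mul_of_nonneg_left ?_ (kernel_nonneg n _)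
    rw [norm_mul]
    refine mul_le_mul ((ha y x).trans ?_) hy (norm_nonneg _)
      (mul_nonneg hP (mesh_pos n).le)
    rw [norm_sub_rev]
    exact mul_le_mul_of_nonneg_left hn.le hP

lemma WeakBdd.mollify_secondDir {m : ℕ} {K : ℝ} {v : Space d → ℝ} (h : WeakBdd m K v) (hm : 2 ≤ m)
    (n : ℕ) (l x : Space d) :
    mollify n (secondDir l v) x = dirDeriv l (dirDeriv l (mollify n v)) x := by
  rw [dirDeriv_dirDeriv_eq (h.smoothBdd_mollify n), mollify]
  simp_rw [mul_comm (kernel d n _)]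
  rw [h.integral_secondDir_mul hm l ((isTest_kernel n).comp_sub x).integrable]
  refine Finset.sum_congr rfl fun i _ => Finset.sum_congr rfl fun j _ => ?_
  have h1 := h.isWeakDeriv (α := idx i + idx j) (by rw [order_idx_add]; omega)
  rw [wordDeriv_mollify (w := [i, j]) (g := weakDeriv (idx i + idx j) v)
    (by rw [count_pair]; exact h1), mollify]
  simp_rw [mul_comm (kernel d n _)]

lemma WeakBdd.mollify_firstDeriv {m : ℕ} {K : ℝ} {v : Space d → ℝ} (h : WeakBdd m K v)
    (hm : 2 ≤ m) (n : ℕ) (i : Fin d) :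
    mollify n (weakDeriv (idx i) v) = partialDeriv i (mollify n v) := by
  have h1 := h.isWeakDeriv (α := idx i) (by rw [order_idx]; omega)
  exact (wordDeriv_mollify (w := [i]) (by rw [count_singleton']; exact h1) n).symm

/-- The operator acting on smooth functions. -/
def ProblemData.smoothOp (D : ProblemData d) (s : ℝ) (v : Space d → ℝ) (x : Space d) : ℝ :=
  (∑ l ∈ D.Λ, 1 / 2 * (D.q l s x * dirDeriv l (dirDeriv l v) x)) +
    (∑ i, D.b i s x * partialDeriv i v x) + D.c s x * v x

lemma abs_sum_sub_sum_le {ι : Type*} (S : Finset ι) {a b e : ι → ℝ}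
    (h : ∀ i ∈ S, |a i - b i| ≤ e i) : |∑ i ∈ S, a i - ∑ i ∈ S, b i| ≤ ∑ i ∈ S, e i := by
  rw [← Finset.sum_sub_distrib]
  exact (Finset.abs_sum_le_sum_abs _ _).trans (Finset.sum_le_sum h)

section

variable {m : ℕ} {K F G : ℝ} {D : ProblemData d} {B : ℝ} {u : ℝ → Space d → ℝ}

/-- Derivatives commute with mollification, so only freezing the Lipschitz coefficients at `x` costs
anything, and the derivatives of `u` they multiply are bounded uniformly in time. -/
lemma ProblemData.Regular.exists_commutator_le (h : D.Regular m K F G) (hm : 2 ≤ m)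
    (hu : TimeReg 2 B u) : ∃ C, ∀ n s x,
      |mollify n (D.fullOp s (u s)) x - D.smoothOp s (mollify n (u s)) x| ≤ C * mesh n := by
  have hK := h.K_nonneg
  have hP : 0 ≤ K * (d + 1) := by positivity
  have hlip : ∀ {a : ℝ → Space d → ℝ}, TimeReg m K a → ∀ s y z,
      |a s y - a s z| ≤ K * (d + 1) * ‖y - z‖ := fun ha s y z =>
    (ha.weakBdd s).abs_sub_le (by omega) y z
  refine ⟨(∑ l ∈ D.Λ, 1 / 2 * (K * (d + 1) * ((∑ i, ∑ j, |l i * l j|) * B))) +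
    (∑ _i : Fin d, K * (d + 1) * B) + K * (d + 1) * B, fun n s x => ?_⟩
  have h1 : ∀ l ∈ D.Λ, TimeBdd fun s x => 1 / 2 * (D.q l s x * secondDir l (u s) x) := fun l hl =>
    ((h.q_reg l hl).timeBdd.mul (hu.timeBdd_secondDir le_rfl l)).const_mul _
  have h2 : ∀ i ∈ Finset.univ, TimeBdd fun s x => D.b i s x * weakDeriv (idx i) (u s) x :=
    fun i _ => (h.b_reg i).timeBdd.mul (hu.timeBdd_firstDeriv le_rfl i)
  have h3 : TimeBdd fun s x => D.c s x * u s x := h.c_reg.timeBdd.mul hu.timeBdd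
  have i1 : ∀ l ∈ D.Λ, Integrable fun y => kernel d n (x - y) *
      (1 / 2 * (D.q l s y * secondDir l (u s) y)) := fun l hl =>
    convKernel_integrable (isTest_kernel n) ((h1 l hl).locallyIntegrable s) x
  have i2 : ∀ i ∈ Finset.univ, Integrable fun y => kernel d n (x - y) *
      (D.b i s y * weakDeriv (idx i) (u s) y) := fun i hi =>
    convKernel_integrable (isTest_kernel n) ((h2 i hi).locallyIntegrable s) x
  have i3 := convKernel_integrable (isTest_kernel n) (h3.locallyIntegrable s) x
  have e : mollify n (D.fullOp s (u s)) x =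
      (∑ l ∈ D.Λ, 1 / 2 * mollify n (fun y => D.q l s y * secondDir l (u s) y) x) +
      (∑ i, mollify n (fun y => D.b i s y * weakDeriv (idx i) (u s) y) x) +
      mollify n (fun y => D.c s y * u s y) x := by
    have j1 := integrable_finsetSum _ i1
    have j2 := integrable_finsetSum _ i2
    simp only [mollify, ProblemData.fullOp, ProblemData.diffOp, mul_add, Finset.mul_sum]
    rw [integral_add (j1.fun_add j2) i3, integral_add j1 j2, integral_finsetSum _ i1,
      integral_finsetSum _ i2]
    simp_rw [mul_left_comm _ (1 / 2 : ℝ), integral_const_mul]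
  rw [e, ProblemData.smoothOp, add_mul, add_mul, Finset.sum_mul, Finset.sum_mul]
  have b1 := abs_sum_sub_sum_le D.Λ
    (a := fun l => 1 / 2 * mollify n (fun y => D.q l s y * secondDir l (u s) y) x)
    (b := fun l => 1 / 2 * (D.q l s x * dirDeriv l (dirDeriv l (mollify n (u s))) x))
    (e := fun l => 1 / 2 * (K * (d + 1) * ((∑ i, ∑ j, |l i * l j|) * B)) * mesh n) (fun l hl => by
      have := abs_mollify_mul_sub_le ((h.q_reg l hl).weakBdd s).continuous hP
        (hlip (h.q_reg l hl) s) ((hu.timeBdd_secondDir le_rfl l).locallyIntegrable s)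
        ((hu.weakBdd s).exists_abs_secondDir_le le_rfl l) n x
      rw [(hu.weakBdd s).mollify_secondDir le_rfl] at this
      rw [← mul_sub, abs_mul, abs_of_pos (by norm_num : (0:ℝ) < 1 / 2)]
      calc _ ≤ 1 / 2 * (K * (d + 1) * mesh n * ((∑ i, ∑ j, |l i * l j|) * B)) := by gcongr
        _ = _ := by ring)
  have b2 := abs_sum_sub_sum_le Finset.univ
    (a := fun i => mollify n (fun y => D.b i s y * weakDeriv (idx i) (u s) y) x)
    (b := fun i => D.b i s x * partialDeriv i (mollify n (u s)) x)
    (e := fun i => K * (d + 1) * B * mesh n) (fun i _ => by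
      have := abs_mollify_mul_sub_le ((h.b_reg i).weakBdd s).continuous hP
        (hlip (h.b_reg i) s) ((hu.timeBdd_firstDeriv le_rfl i).locallyIntegrable s)
        ((hu.weakBdd s).abs_weakDeriv_le (α := idx i) (by rw [order_idx]; omega)) n x
      rw [(hu.weakBdd s).mollify_firstDeriv le_rfl] at this
      rwa [mul_right_comm])
  have b3 := abs_mollify_mul_sub_le (h.c_reg.weakBdd s).continuous hP
        (hlip h.c_reg s) (hu.timeBdd.locallyIntegrable s)
        (Eventually.of_forall (hu.weakBdd s).abs_le) n x
  rw [mul_right_comm] at b3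
  rw [abs_le] at *
  constructor <;> linarith [b1.1, b1.2, b2.1, b2.2, b3.1, b3.2]

end

/-! The pointwise inequalities behind the maximum principle. -/

section

variable {v : Space d → ℝ} {A C δ σ : ℝ}

/-- A substitute for the second derivative test when the supremum need not be attained. Adding
Taylor's formula at `x ± δl` cancels the first derivative, and the deficit `A - σ * v x` measures
how far `x` is from a maximum. -/
lemma sign_mul_dirDeriv_dirDeriv_le (hv : SmoothBdd v) (hA : ∀ y, σ * v y ≤ A) (hσ : |σ| = 1)
    (l : Space d) (hC : ∀ x, |dirDeriv l (dirDeriv l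
      (dirDeriv l v)) x| ≤ C) (hδ : 0 < δ) (x : Space d) :
    σ * dirDeriv l (dirDeriv l v) x ≤
      2 * ((A - σ * v x) / δ ^ 2 + C * δ) := by
  have key : ∀ s : ℝ, σ * (dirDeriv l v x * s +
      dirDeriv l (dirDeriv l v) x * (s ^ 2 / 2)) ≤
      A - σ * v x + C * |s| ^ 3 := fun s => by
    have h1 := hv.taylor_two l hC x s
    rw [← one_mul |_|, ← hσ, ← abs_mul] at h1
    have h2 := (abs_le.1 h1).1
    have h3 := hA (x + s • l)
    linarith
  have h1 := key δ
  have h2 := key (-δ)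
  rw [abs_neg] at h2
  rw [abs_of_pos hδ] at h1 h2
  have h4 : 2 * ((A - σ * v x) / δ ^ 2 + C * δ) =
    (2 * (A - σ * v x) + 2 * (C * δ ^ 3)) / δ ^ 2 := by field_simp
  rw [h4, le_div_iff₀ (by positivity)]
  linarith

/-- The same device one order lower; steps in both directions control the absolute value. -/
lemma abs_dirDeriv_le (hv : SmoothBdd v) (hA : ∀ y, σ * v y ≤ A) (hσ : |σ| = 1)
    (l : Space d) (hC : ∀ x, |dirDeriv l
      (dirDeriv l v) x| ≤ C) (hδ : 0 < δ) (x : Space d) :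
    |dirDeriv l v x| ≤ (A - σ * v x) / δ + C * δ := by
  set v1 := dirDeriv l v
  have hv1 : SmoothBdd v1 := hv.dirDeriv l
  have hd0 : ∀ s, HasDerivAt (fun s : ℝ => v (x + s • l)) (v1 (x + s • l)) s :=
    hasDerivAt_line hv.differentiable x l
  have hd1 : ∀ s, HasDerivAt (fun s : ℝ => v1 (x + s • l)) (dirDeriv l v1 (x + s • l)) s :=
    hasDerivAt_line hv1.differentiable x l
  have e1 := abs_sub_le_of_deriv_le hd1 (C := C) 0 (fun s => by simpa using hC _)
  have e0 := abs_sub_le_of_deriv_le (φ := fun s : ℝ => v (x + s • l) - v1 x * s)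
    (φ' := fun s => v1 (x + s • l) - v1 x) (C := C)
    (fun s => by
      have h := (hd0 s).fun_sub ((hasDerivAt_id s).const_mul (v1 x))
      simpa using h) 1 (fun s => by simpa using e1 s)
  simp only [zero_smul, add_zero, mul_zero, sub_zero, Nat.reduceAdd] at e0
  have key : ∀ s : ℝ, σ * v1 x * s ≤ A - σ * v x + C * |s| ^ 2 := fun s => by
    have h1 := e0 s
    rw [← one_mul |_|, ← hσ, ← abs_mul] at h1
    have h2 := (abs_le.1 h1).1
    have h3 := hA (x + s • l)
    linarith
  have h1 := key δ
  have h2 := key (-δ)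
  rw [abs_neg] at h2
  rw [abs_of_pos hδ] at h1 h2
  rw [← one_mul |v1 x|, ← hσ, ← abs_mul]
  have h4 : (A - σ * v x) / δ + C * δ = (A - σ * v x + C * δ ^ 2) / δ := by field_simp
  rw [h4, le_div_iff₀ hδ, ← abs_of_pos hδ, ← abs_mul, abs_of_pos hδ, abs_le]
  constructor <;> linarith

end

/-! ### The maximum principle for mollified differences of solutions. -/

section

variable {m : ℕ} {K F G : ℝ} {D : ProblemData d} {B : ℝ} {u : ℝ → Space d → ℝ}

/-- Meant for `v` at the start of a time step and `v'` at a later moment of it, so that the deficit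
is frozen at the start. For the second order part `q ≥ 0` makes an upper bound sufficient; `b` may
have either sign and needs a bound on the absolute value. -/
lemma ProblemData.Regular.sign_mul_smoothOp_le (h : D.Regular m K F G) {v v' : Space d → ℝ}
    {A C δ τ σ : ℝ} (hv : SmoothBdd v) (hA : ∀ y, |v y| ≤ A) (hσ : |σ| = 1) (hδ : 0 < δ)
    (hC : 0 ≤ C) (h3 : ∀ l ∈ D.Λ, ∀ x, |dirDeriv l (dirDeriv l (dirDeriv l v)) x| ≤ C)
    (h2 : ∀ (i : Fin d) (x : Space d), |dirDeriv (EuclideanSpace.single i 1)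
      (dirDeriv (EuclideanSpace.single i 1) v) x| ≤ C)
    {x : Space d} (t2 : ∀ l ∈ D.Λ, |dirDeriv l (dirDeriv l v') x - dirDeriv l (dirDeriv l v) x| ≤ C * τ)
    (t1 : ∀ i : Fin d, |dirDeriv (EuclideanSpace.single i 1) v' x -
      dirDeriv (EuclideanSpace.single i 1) v x| ≤ C * τ)
    (t0 : |v' x - v x| ≤ C * τ) (r : ℝ) :
    σ * D.smoothOp r v' x ≤ (D.Λ.card * (K / δ ^ 2) + d * (K / δ)) * (A - σ * v x) + K * A +
      (D.Λ.card + d + 1) * (K * (C * (δ + τ))) := by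
  have hK := h.K_nonneg
  have hσA : ∀ y, σ * v y ≤ A := fun y => by
    refine (le_abs_self (σ * v y)).trans ?_
    rw [abs_mul, hσ, one_mul]
    exact hA y
  have hAv : 0 ≤ A - σ * v x := sub_nonneg.2 (hσA x)
  have hCτ : 0 ≤ C * τ := (abs_nonneg _).trans t0
  have le_of : ∀ {a b e : ℝ}, |a - b| ≤ e → σ * a ≤ σ * b + e := fun {a b e} hab => by
    rw [← one_mul |_|, ← hσ, ← abs_mul] at hab
    linarith [(abs_le.1 hab).2]
  have q1 : ∀ l ∈ D.Λ, σ * (1 / 2 * (D.q l r x * dirDeriv l (dirDeriv l v') x)) ≤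
      K / δ ^ 2 * (A - σ * v x) + K * (C * (δ + τ)) := fun l hl => by
    have hq0 := h.q_nonneg l hl r x
    have hq1 : D.q l r x ≤ K := (le_abs_self _).trans (((h.q_reg l hl).weakBdd r).abs_le x)
    have e1 := sign_mul_dirDeriv_dirDeriv_le hv hσA hσ l (h3 l hl) hδ x
    have e2 := le_of (t2 l hl)
    calc σ * (1 / 2 * (D.q l r x * dirDeriv l (dirDeriv l v') x)) =
        D.q l r x * (1 / 2 * (σ * dirDeriv l (dirDeriv l v') x)) := by ring
      _ ≤ D.q l r x * ((A - σ * v x) / δ ^ 2 + C * δ + C * τ) := by gcongr; linarith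
      _ ≤ K * ((A - σ * v x) / δ ^ 2 + C * δ + C * τ) := by gcongr
      _ = _ := by ring
  have b1 : ∀ i ∈ Finset.univ, σ * (D.b i r x * partialDeriv i v' x) ≤
      K / δ * (A - σ * v x) + K * (C * (δ + τ)) := fun i _ => by
    have hb := ((h.b_reg i).weakBdd r).abs_le x
    have e1 := abs_dirDeriv_le hv hσA hσ (EuclideanSpace.single i 1) (h2 i) hδ x
    have e2 : |partialDeriv i v' x| ≤ (A - σ * v x) / δ + C * δ + C * τ := by
      have := abs_sub_abs_le_abs_sub (dirDeriv (EuclideanSpace.single i 1) v' x)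
        (dirDeriv (EuclideanSpace.single i 1) v x)
      change |dirDeriv (EuclideanSpace.single i 1) v' x| ≤ _
      linarith [t1 i]
    calc σ * (D.b i r x * partialDeriv i v' x) ≤ |σ * (D.b i r x * partialDeriv i v' x)| :=
          le_abs_self _
      _ = |D.b i r x| * |partialDeriv i v' x| := by rw [abs_mul, hσ, one_mul, abs_mul]
      _ ≤ K * ((A - σ * v x) / δ + C * δ + C * τ) := by gcongr
      _ = _ := by ring
  have c1 : σ * (D.c r x * v' x) ≤ K * A + K * (C * τ) := by
    have hc := (h.c_reg.weakBdd r).abs_le x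
    have e2 : |v' x| ≤ A + C * τ := by
      linarith [abs_sub_abs_le_abs_sub (v' x) (v x), hA x]
    calc σ * (D.c r x * v' x) ≤ |σ * (D.c r x * v' x)| := le_abs_self _
      _ = |D.c r x| * |v' x| := by rw [abs_mul, hσ, one_mul, abs_mul]
      _ ≤ K * (A + C * τ) := by gcongr
      _ = _ := by ring
  have hC0 : K * (C * τ) ≤ K * (C * (δ + τ)) := by gcongr; linarith
  have s1 := Finset.sum_le_sum q1
  have s2 := Finset.sum_le_sum b1
  rw [Finset.sum_const, nsmul_eq_mul, ← Finset.mul_sum] at s1 s2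
  rw [Finset.card_univ, Fintype.card_fin] at s2
  rw [ProblemData.smoothOp, mul_add, mul_add]
  linarith

/-- The homogeneous equation, tested with all test functions. -/
def ProblemData.SolvesHomogeneous (D : ProblemData d) (T : ℝ) (u : ℝ → Space d → ℝ) : Prop :=
  ∀ t ∈ Icc 0 T, ∀ η : Space d → ℝ, IsTest η →
    ∫ x, u t x * η x = ∫ s in (0:ℝ)..t, ∫ x, D.fullOp s (u s) x * η x

lemma ProblemData.Regular.integral_increment (h : D.Regular m K F G) (hu : TimeReg 2 B u) {T : ℝ}
    (hs : D.SolvesHomogeneous T u) {s t : ℝ} (hs0 : s ∈ Icc 0 T) (ht : t ∈ Icc 0 T)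
    {η : Space d → ℝ} (hη : IsTest η) :
    (∫ x, u t x * η x) - ∫ x, u s x * η x = ∫ r in s..t, ∫ x, D.fullOp r (u r) x * η x := by
  have hi := fun a b => (h.timeBdd_fullOp hu le_rfl).intervalIntegrable hη a b
  rw [hs t ht η hη, hs s hs0 η hη, intervalIntegral.integral_interval_sub_left (hi 0 t) (hi 0 s)]

/-- The mollifications of a solution are Lipschitz in time with all derivatives. -/
lemma ProblemData.Regular.smoothFamily_sub (h : D.Regular m K F G) (hu : TimeReg 2 B u) {T : ℝ}
    (hs : D.SolvesHomogeneous T u) (n : ℕ) :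
    SmoothFamily (fun p : Icc 0 T × Icc 0 T => |(p.1 : ℝ) - p.2|)
      (fun p x => mollify n (u p.1) x - mollify n (u p.2) x) := by
  have hsm := fun s => (hu.weakBdd s).smoothBdd_mollify n
  have e : ∀ p : Icc (0:ℝ) T × Icc (0:ℝ) T, (fun x => mollify n (u p.1) x - mollify n (u p.2) x) =
      fun x => mollify n (u p.1) x + -1 * mollify n (u p.2) x := fun p => by ext x; ring
  obtain ⟨Q, hQ⟩ := (h.timeBdd_fullOp hu le_rfl).bound
  refine ⟨fun p => by rw [e]; exact (hsm _).add ((hsm _).const_mul _), fun w => ?_⟩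
  refine ⟨Q * ∫ y, |wordDeriv w (kernel d n) y|, fun p x => ?_⟩
  rw [e, wordDeriv_add w (hsm _) ((hsm _).const_mul _), wordDeriv_const_mul w _ (hsm _)]
  have hη := ((isTest_kernel (d := d) n).wordDeriv w).comp_sub x
  have hw : ∀ s, wordDeriv w (mollify n (u s)) x =
      ∫ y, u s y * wordDeriv w (kernel d n) (x - y) := fun s => by
    simp_rw [mul_comm (u s _)]
    exact congrFun (wordDeriv_conv (isTest_kernel n)
      (hu.weakBdd s).continuous.locallyIntegrable w) x
  -- All space derivatives sit on the kernel, so the equation tested with the differentiated kernel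
  -- gives the Lipschitz bound in time.
  have h1 := h.integral_increment hu hs p.2.2 p.1.2 hη
  simp only [hw]
  rw [neg_one_mul, ← sub_eq_add_neg, h1]
  refine intervalIntegral.norm_integral_le_of_norm_le_const
    (f := fun r => ∫ y, D.fullOp r (u r) y * wordDeriv w (kernel d n) (x - y)) fun r _ => ?_
  rw [← integral_sub_left_eq_self (fun y => |wordDeriv w (kernel d n) y|) volume x]
  exact abs_integral_bdd_mul_le (hQ r) hη.integrable

lemma dirDeriv_sub {v v' : Space d → ℝ} (hv : SmoothBdd v) (hv' : SmoothBdd v') (l : Space d) :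
    dirDeriv l (fun x => v x - v' x) = fun x => dirDeriv l v x - dirDeriv l v' x := by
  ext x
  simp only [dirDeriv]
  rw [fderiv_fun_sub (hv.differentiable x) (hv'.differentiable x)]
  rfl

/-- Uniform constants for the mollifications of a solution. -/
lemma ProblemData.Regular.exists_uniform_bounds (h : D.Regular m K F G) (hu : TimeReg 2 B u)
    {T : ℝ} (hs : D.SolvesHomogeneous T u) (n : ℕ) : ∃ C, 0 ≤ C ∧
      (∀ s, ∀ l ∈ D.Λ, ∀ x, |dirDeriv l (dirDeriv l (dirDeriv l (mollify n (u s)))) x| ≤ C) ∧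
      (∀ s, ∀ (i : Fin d) (x : Space d), |dirDeriv (EuclideanSpace.single i 1)
        (dirDeriv (EuclideanSpace.single i 1) (mollify n (u s))) x| ≤ C) ∧
      ∀ s ∈ Icc 0 T, ∀ t ∈ Icc 0 T, ∀ x,
        (∀ l ∈ D.Λ, |dirDeriv l (dirDeriv l (mollify n (u t))) x -
          dirDeriv l (dirDeriv l (mollify n (u s))) x| ≤ C * |t - s|) ∧
        (∀ i : Fin d, |dirDeriv (EuclideanSpace.single i 1) (mollify n (u t)) x -
          dirDeriv (EuclideanSpace.single i 1) (mollify n (u s)) x| ≤ C * |t - s|) ∧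
        |mollify n (u t) x - mollify n (u s) x| ≤ C * |t - s| := by
  have hsm := fun s => (hu.weakBdd s).smoothBdd_mollify n
  have fam : SmoothFamily (fun _ : ℝ => 1) fun s => mollify n (u s) :=
    ⟨hsm, fun w => by simpa using hu.mollify_unif n w⟩
  have fam' := h.smoothFamily_sub hu hs n
  choose B3 hB3 using fun l => (((fam.dirDeriv l).dirDeriv l).dirDeriv l).abs_le
  choose B2 hB2 using fun i : Fin d => ((fam.dirDeriv (EuclideanSpace.single i 1)).dirDeriv
    (EuclideanSpace.single i 1)).abs_le
  choose L2 hL2 using fun l => ((fam'.dirDeriv l).dirDeriv l).abs_le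
  choose L1 hL1 using fun i : Fin d => (fam'.dirDeriv (EuclideanSpace.single i 1)).abs_le
  obtain ⟨L0, hL0⟩ := fam'.abs_le
  have hsum : ∀ {ι : Type _} (S : Finset ι) (f : ι → ℝ), 0 ≤ ∑ i ∈ S, |f i| := fun S f =>
    Finset.sum_nonneg fun _ _ => abs_nonneg _
  have hle : ∀ {ι : Type _} (S : Finset ι) (f : ι → ℝ), ∀ i ∈ S, f i ≤ ∑ i ∈ S, |f i| :=
    fun S f i hi => (le_abs_self _).trans
      (Finset.single_le_sum (f := fun i => |f i|) (fun _ _ => abs_nonneg _) hi)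
  have n1 := hsum D.Λ B3
  have n2 := hsum Finset.univ B2
  have n3 := hsum D.Λ L2
  have n4 := hsum Finset.univ L1
  have n5 := abs_nonneg L0
  refine ⟨(∑ l ∈ D.Λ, |B3 l|) + (∑ i, |B2 i|) + (∑ l ∈ D.Λ, |L2 l|) + (∑ i, |L1 i|) + |L0|,
    by positivity, fun s l hl x => ?_, fun s i x => ?_, fun s hs' t ht x =>
      ⟨fun l hl => ?_, fun i => ?_, ?_⟩⟩
  · have := hB3 l s x
    linarith [hle D.Λ B3 l hl]
  · have := hB2 i s x
    linarith [hle Finset.univ B2 i (Finset.mem_univ i)]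
  · have := hL2 l (⟨t, ht⟩, ⟨s, hs'⟩) x
    rw [dirDeriv_sub (hsm _) (hsm _), dirDeriv_sub ((hsm _).dirDeriv l) ((hsm _).dirDeriv l)] at this
    refine this.trans (mul_le_mul_of_nonneg_right ?_ (abs_nonneg _))
    linarith [hle D.Λ L2 l hl]
  · have := hL1 i (⟨t, ht⟩, ⟨s, hs'⟩) x
    rw [dirDeriv_sub (hsm _) (hsm _)] at this
    refine this.trans (mul_le_mul_of_nonneg_right ?_ (abs_nonneg _))
    linarith [hle Finset.univ L1 i (Finset.mem_univ i)]
  · refine (hL0 (⟨t, ht⟩, ⟨s, hs'⟩) x).trans (mul_le_mul_of_nonneg_right ?_ (abs_nonneg _))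
    linarith [le_abs_self L0]

/-- The maximum principle on a short time interval. -/
lemma ProblemData.Regular.abs_mollify_step_le (h : D.Regular m K F G) (hu : TimeReg 2 B u)
    {T : ℝ} (hs : D.SolvesHomogeneous T u) {n : ℕ} {ε : ℝ}
    (hε : ∀ r x, |mollify n (D.fullOp r (u r)) x - D.smoothOp r (mollify n (u r)) x| ≤ ε) :
    ∃ M, 0 ≤ M ∧ ∀ δ > 0, ∀ τ > 0, τ * (D.Λ.card * (K / δ ^ 2) + d * (K / δ)) ≤ 1 →
      ∀ s, 0 ≤ s → s + τ ≤ T → ∀ A, (∀ x, |mollify n (u s) x| ≤ A) →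
        ∀ x, |mollify n (u (s + τ)) x| ≤ A + τ * (K * A + M * (δ + τ) + ε) := by
  obtain ⟨C, hC, h3, h2, ht⟩ := h.exists_uniform_bounds hu hs n
  have hK := h.K_nonneg
  refine ⟨(D.Λ.card + d + 1) * (K * C), by positivity, fun δ hδ τ hτ hτδ s hs0 hsT A hA x => ?_⟩
  have hmem : ∀ r ∈ Icc s (s + τ), r ∈ Icc 0 T := fun r hr => ⟨hs0.trans hr.1, hr.2.trans hsT⟩
  have hle : s ≤ s + τ := by linarith
  have hη := (isTest_kernel (d := d) n).comp_sub x
  have hinc := h.integral_increment hu hs (hmem s ⟨le_rfl, hle⟩) (hmem _ ⟨hle, le_rfl⟩) hη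
  have hmol : ∀ g : Space d → ℝ, ∫ y, g y * kernel d n (x - y) = mollify n g x := fun g => by
    rw [mollify]; simp_rw [mul_comm]
  simp only [hmol] at hinc
  have hi := (h.timeBdd_fullOp hu le_rfl).intervalIntegrable hη s (s + τ)
  simp only [hmol] at hi
  -- The sign is taken from the final value at `x`, so an upper bound for `σ` times the increment is
  -- enough.
  obtain ⟨σ, hσ, hσx⟩ : ∃ σ : ℝ, |σ| = 1 ∧
      |mollify n (u (s + τ)) x| = σ * mollify n (u (s + τ)) x := by
    rcases abs_cases (mollify n (u (s + τ)) x) with ⟨e, _⟩ | ⟨e, _⟩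
    · exact ⟨1, by simp, by rw [e, one_mul]⟩
    · exact ⟨-1, by simp, by rw [e, neg_one_mul]⟩
  set Θ := D.Λ.card * (K / δ ^ 2) + d * (K / δ)
  set R := Θ * (A - σ * mollify n (u s) x) + K * A +
      (D.Λ.card + d + 1) * (K * (C * (δ + τ))) + ε
  have hbound : ∀ r ∈ Icc s (s + τ), σ * mollify n (D.fullOp r (u r)) x ≤ R := fun r hr => by
    obtain ⟨t2, t1, t0⟩ := ht s (hmem s ⟨le_rfl, hle⟩) r (hmem r hr) x
    have hrs : C * |r - s| ≤ C * τ := by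
      refine mul_le_mul_of_nonneg_left ?_ hC
      rw [abs_of_nonneg (by linarith [hr.1])]
      linarith [hr.2]
    have e1 := h.sign_mul_smoothOp_le ((hu.weakBdd s).smoothBdd_mollify n) hA hσ hδ hC (h3 s)
      (h2 s) (fun l hl => (t2 l hl).trans hrs) (fun i => (t1 i).trans hrs) (t0.trans hrs) r
    have e2 := hε r x
    rw [← one_mul |_|, ← hσ, ← abs_mul] at e2
    have e3 := (abs_le.1 e2).2
    rw [mul_sub] at e3
    simp only [R]
    linarith
  have hI := intervalIntegral.integral_mono_on hle (hi.const_mul σ)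
    (intervalIntegrable_const (c := R)) hbound
  rw [intervalIntegral.integral_const_mul, ← hinc, intervalIntegral.integral_const,
    add_sub_cancel_left, smul_eq_mul, mul_sub, ← hσx] at hI
  have hσs : σ * mollify n (u s) x ≤ A := by
    refine (le_abs_self _).trans ?_
    rw [abs_mul, hσ, one_mul]
    exact hA x
  -- As `τ * Θ ≤ 1`, the initial value at `x` plus this multiple of its deficit stays below `A`; no
  -- point of maximum is used.
  have h5 : τ * Θ * (A - σ * mollify n (u s) x) ≤ 1 * (A - σ * mollify n (u s) x) :=
    mul_le_mul_of_nonneg_right hτδ (sub_nonneg.2 hσs)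
  simp only [R] at hI
  linarith

lemma mollify_eq_zero_of_integral {v : Space d → ℝ} (hv : ∀ η : Space d → ℝ, IsTest η →
    ∫ x, v x * η x = 0) (n : ℕ) (x : Space d) : mollify n v x = 0 := by
  rw [← hv _ ((isTest_kernel n).comp_sub x), mollify]
  simp_rw [mul_comm]

/-- With `n` fixed, `M` absorbs the bounds on higher derivatives of the mollifications. The errors
`M * (δ + τ)` disappear as `δ → 0` with `τ ≤ δ`, and only `ε` survives Gronwall's inequality. -/
lemma ProblemData.Regular.abs_mollify_le_of_commutator (h : D.Regular m K F G)
    (hu : TimeReg 2 B u) {T : ℝ} (hs : D.SolvesHomogeneous T u) {n : ℕ} {ε : ℝ}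
    (hε : ∀ r x, |mollify n (D.fullOp r (u r)) x - D.smoothOp r (mollify n (u r)) x| ≤ ε)
    {t : ℝ} (ht : t ∈ Icc 0 T) (x : Space d) :
    |mollify n (u t) x| ≤ Real.exp (K * T) * (T * ε) := by
  obtain ⟨M, hM, step⟩ := h.abs_mollify_step_le hu hs hε
  have hK := h.K_nonneg
  have hε0 : 0 ≤ ε := (abs_nonneg _).trans (hε 0 0)
  have hT : 0 ≤ T := ht.1.trans ht.2
  have h0 : ∀ x, mollify n (u 0) x = 0 := mollify_eq_zero_of_integral (fun η hη => by
    rw [hs 0 ⟨le_rfl, hT⟩ η hη, intervalIntegral.integral_same]) n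
  rcases ht.1.eq_or_lt with ht0 | ht0
  · rw [← ht0, h0, abs_zero]; positivity
  have key : ∀ δ > 0, |mollify n (u t) x| ≤ Real.exp (K * T) * (T * (M * (δ + δ) + ε)) := by
    intro δ hδ
    set Θ := D.Λ.card * (K / δ ^ 2) + d * (K / δ)
    have hΘ : 0 ≤ Θ := by positivity
    -- So many steps make `τ = t / k` satisfy both `τ * Θ ≤ 1` and `τ ≤ δ`.
    obtain ⟨k, hk⟩ := exists_nat_gt (t * Θ + t / δ)
    have hk0 : (0:ℝ) < k := lt_of_le_of_lt (by positivity) hk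
    set τ := t / k
    have hτ : 0 < τ := by positivity
    have hτ1 : τ * Θ ≤ 1 := by
      rw [div_mul_eq_mul_div, div_le_one hk0]
      have : 0 < t / δ := by positivity
      linarith
    have hτ2 : τ ≤ δ := by
      rw [div_le_iff₀ hk0]
      have h1 : t / δ ≤ k := by
        have : 0 ≤ t * Θ := by positivity
        linarith
      rw [div_le_iff₀ hδ] at h1
      linarith
    have hkτ : k * τ = t := mul_div_cancel₀ t hk0.ne'
    set e := M * (δ + δ) + ε
    have he : 0 ≤ e := by positivity
    have main : ∀ j : ℕ, j ≤ k → ∀ x, |mollify n (u (j * τ)) x| ≤ (1 + K * τ) ^ j * (j * τ * e) := by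
      intro j
      induction j with
      | zero => intro _ x; simp [h0]
      | succ j ih =>
        intro hj x
        have hjT : j * τ + τ ≤ T := by
          have : (j + 1 : ℝ) ≤ k := by exact_mod_cast hj
          nlinarith [ht.2]
        have h1 := step δ hδ τ hτ hτ1 (j * τ) (by positivity) hjT _ (ih (by omega)) x
        have e1 : ((j + 1 : ℕ) : ℝ) * τ = j * τ + τ := by push_cast; ring
        rw [e1]
        refine h1.trans ?_
        have h2 : (1:ℝ) ≤ (1 + K * τ) ^ (j + 1) := one_le_pow₀ (by nlinarith)
        have h3 := mul_le_mul_of_nonneg_right h2 (show 0 ≤ τ * e by positivity)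
        have h4 : M * (δ + τ) + ε ≤ e := by
          simp only [e]; gcongr
        have h5 := mul_le_mul_of_nonneg_left h4 hτ.le
        rw [pow_succ] at h3 ⊢
        linarith
    have h6 := main k le_rfl x
    rw [hkτ] at h6
    refine h6.trans ?_
    have h7 : (1 + K * τ) ^ k ≤ Real.exp (K * T) := by
      calc (1 + K * τ) ^ k ≤ Real.exp (K * τ) ^ k := by
            gcongr; linarith [Real.add_one_le_exp (K * τ)]
        _ = Real.exp (K * t) := by rw [← Real.exp_nat_mul, ← hkτ]; ring_nf
        _ ≤ _ := by gcongr; exact ht.2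
    gcongr
    exact ht.2
  have hlim : Tendsto (fun δ : ℝ => Real.exp (K * T) * (T * (M * (δ + δ) + ε)))
      (nhdsWithin 0 (Ioi 0)) (nhds (Real.exp (K * T) * (T * (M * (0 + 0) + ε)))) := by
    refine (Continuous.tendsto ?_ 0).mono_left nhdsWithin_le_nhds
    fun_prop
  have := ge_of_tendsto hlim (eventually_nhdsWithin_of_forall fun δ hδ => key δ hδ)
  simpa using this

theorem ProblemData.Regular.eq_zero (h : D.Regular m K F G) (hm : 2 ≤ m)
    (hu : TimeReg 2 B u) {T : ℝ} (hs : D.SolvesHomogeneous T u) {t : ℝ} (ht : t ∈ Icc 0 T)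
    (x : Space d) : u t x = 0 := by
  obtain ⟨C, hC⟩ := h.exists_commutator_le hm hu
  have h1 : ∀ n, |mollify n (u t) x| ≤ Real.exp (K * T) * (T * (C * mesh n)) := fun n =>
    h.abs_mollify_le_of_commutator hu hs (hC n) ht x
  have h2 : Tendsto (fun n => Real.exp (K * T) * (T * (C * mesh n))) atTop (nhds 0) := by
    have : Tendsto mesh atTop (nhds 0) := tendsto_one_div_add_atTop_nhds_zero_nat
    simpa using ((this.const_mul C).const_mul T).const_mul (Real.exp (K * T))
  exact tendsto_nhds_unique (tendsto_mollify (hu.weakBdd t).continuous x)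
    (squeeze_zero_norm h1 h2)

theorem ProblemData.Regular.solution_unique (h : D.Regular m K F G) (hm : 2 ≤ m) {B' : ℝ}
    {u' : ℝ → Space d → ℝ} (hu : TimeReg 2 B u) (hu' : TimeReg 2 B' u') {T : ℝ}
    (hs : D.Solves T u) (hs' : D.Solves T u') {t : ℝ} (ht : t ∈ Icc 0 T) (x : Space d) :
    u t x = u' t x := by
  have hr : TimeReg 2 (B + B') fun s x => u s x - u' s x :=
    ⟨hu.measurable.sub hu'.measurable, fun s => ((hu.weakBdd s).sub (hu'.weakBdd s)).1⟩
  exact sub_eq_zero.1 (h.eq_zero hm hr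
    (fun t ht η hη => h.integral_sub hu hu' le_rfl hs hs' ht hη) ht x)

end

/-! ### The classes `𝔅^m` and their norms -/

lemma sq_weakDeriv_le_sqDeriv (α : Fin d → ℕ) (φ : Space d → ℝ) (x : Space d) :
    weakDeriv α φ x ^ 2 ≤ sqDeriv (order α) φ x :=
  Finset.single_le_sum (f := fun α => weakDeriv α φ x ^ 2) (fun _ _ => sq_nonneg _)
    (Finset.mem_piAntidiag.2 ⟨rfl, fun i _ => Finset.mem_univ i⟩)

lemma sqDeriv_nonneg (k : ℕ) (φ : Space d → ℝ) (x : Space d) : 0 ≤ sqDeriv k φ x :=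
  Finset.sum_nonneg fun _ _ => sq_nonneg _

lemma order_of_mem_piAntidiag {α : Fin d → ℕ} {k : ℕ}
    (h : α ∈ Finset.piAntidiag (Finset.univ : Finset (Fin d)) k) : order α = k :=
  (Finset.mem_piAntidiag.1 h).1

section

variable {m : ℕ} {T : ℝ} {ψ : ℝ → Space d → ℝ}

/-- The set of bounds in the definition of the norm. -/
def normBounds (m : ℕ) (T : ℝ) (ψ : ℝ → Space d → ℝ) : Set ℝ :=
  {K : ℝ | 0 ≤ K ∧ ∀ t ∈ Icc (0 : ℝ) T, ∀ᵐ x,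
    ∑ k ∈ Finset.range (m + 1), sqDeriv k (ψ t) x ≤ K ^ 2}

lemma ae_sum_sqDeriv_le {B : (Fin d → ℕ) → ℝ} {φ : Space d → ℝ}
    (h : ∀ α, order α ≤ m → ∀ᵐ x, |weakDeriv α φ x| ≤ B α) :
    ∀ᵐ x, ∑ k ∈ Finset.range (m + 1), sqDeriv k φ x ≤ ∑ k ∈ Finset.range (m + 1),
      ∑ α ∈ Finset.piAntidiag (Finset.univ : Finset (Fin d)) k, B α ^ 2 := by
  have h1 : ∀ᵐ x, ∀ α, order α ≤ m → |weakDeriv α φ x| ≤ B α := by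
    rw [ae_all_iff]; intro α; rw [eventually_imp_distrib_left]; exact h α
  filter_upwards [h1] with x hx
  refine Finset.sum_le_sum fun k hk => Finset.sum_le_sum fun α hα => ?_
  have := hx α (by rw [order_of_mem_piAntidiag hα]; simpa [Nat.lt_succ_iff] using hk)
  exact sq_le_sq' (abs_le.1 this).1 (abs_le.1 this).2

/-- Without it the infimum defining `normB` could be the default value zero of an empty set. -/
lemma MemB.normBounds_nonempty (h : MemB m T ψ) : (normBounds m T ψ).Nonempty := by
  have h1 : ∀ α : Fin d → ℕ, ∃ K : ℝ, order α ≤ m → ∀ t ∈ Icc (0 : ℝ) T,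
      ∀ᵐ x, |weakDeriv α (ψ t) x| ≤ K := fun α => by
    by_cases hα : order α ≤ m
    · obtain ⟨K, hK⟩ := h.derivs α hα
      refine ⟨K, fun _ t ht => ?_⟩
      obtain ⟨w, hw, hwK⟩ := hK t ht
      filter_upwards [hw.weakDeriv_ae_eq, hwK] with x h1 h2
      rwa [h1]
    · exact ⟨0, fun h => absurd h hα⟩
  choose B hB using h1
  refine ⟨Real.sqrt (∑ k ∈ Finset.range (m + 1),
      ∑ α ∈ Finset.piAntidiag (Finset.univ : Finset (Fin d)) k, B α ^ 2), Real.sqrt_nonneg _,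
      fun t ht => ?_⟩
  rw [Real.sq_sqrt (Finset.sum_nonneg fun _ _ => Finset.sum_nonneg fun _ _ => sq_nonneg _)]
  exact ae_sum_sqDeriv_le fun α hα => hB α hα t ht

lemma normBounds_bddBelow : BddBelow (normBounds m T ψ) := ⟨0, fun _ h => h.1⟩

lemma normB_nonneg : 0 ≤ normB m T ψ := Real.sInf_nonneg fun _ h => h.1

/-- The infimum in the definition of the norm is attained. -/
lemma MemB.sum_sqDeriv_le (h : MemB m T ψ) {t : ℝ} (ht : t ∈ Icc 0 T) :
    ∀ᵐ x, ∑ k ∈ Finset.range (m + 1), sqDeriv k (ψ t) x ≤ normB m T ψ ^ 2 := by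
  have h1 : ∀ n : ℕ, ∃ K ∈ normBounds m T ψ, K < normB m T ψ + 1 / (n + 1) := fun n =>
    exists_lt_of_csInf_lt h.normBounds_nonempty (by
      change normB m T ψ < _
      have : (0:ℝ) < 1 / (n + 1) := by positivity
      linarith)
  choose K hK hlt using h1
  have h2 : ∀ᵐ x, ∀ n, ∑ k ∈ Finset.range (m + 1), sqDeriv k (ψ t) x ≤ K n ^ 2 :=
    ae_all_iff.2 fun n => (hK n).2 t ht
  filter_upwards [h2] with x hx
  have h3 : Tendsto (fun n : ℕ => (normB m T ψ + 1 / ((n : ℝ) + 1)) ^ 2) atTop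
      (nhds ((normB m T ψ + 0) ^ 2)) :=
    (tendsto_one_div_add_atTop_nhds_zero_nat.const_add _).pow 2
  rw [add_zero] at h3
  exact ge_of_tendsto' h3 fun n => (hx n).trans (pow_le_pow_left₀ (hK n).1 (hlt n).le 2)

lemma MemB.abs_weakDeriv_le (h : MemB m T ψ) {t : ℝ} (ht : t ∈ Icc 0 T) {α : Fin d → ℕ}
    (hα : order α ≤ m) : ∀ᵐ x, |weakDeriv α (ψ t) x| ≤ normB m T ψ := by
  filter_upwards [h.sum_sqDeriv_le ht] with x hx
  refine abs_le_of_sq_le_sq ?_ normB_nonneg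
  refine (sq_weakDeriv_le_sqDeriv α (ψ t) x).trans (le_trans ?_ hx)
  exact Finset.single_le_sum (f := fun k => sqDeriv k (ψ t) x) (fun _ _ => sqDeriv_nonneg _ _ _)
    (Finset.mem_range.2 (Nat.lt_succ_of_le hα))

/-- The number of multi-indices of order at most `m`. -/
def numIndices (d m : ℕ) : ℝ := ∑ k ∈ Finset.range (m + 1),
  ((Finset.piAntidiag (Finset.univ : Finset (Fin d)) k).card : ℝ)

lemma normB_le {s : ℝ} (hs : 0 ≤ s) (h : ∀ t ∈ Icc 0 T, ∀ α, order α ≤ m →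
    ∀ᵐ x, |weakDeriv α (ψ t) x| ≤ s) : normB m T ψ ≤ Real.sqrt (numIndices d m) * s := by
  refine csInf_le normBounds_bddBelow ⟨by positivity, fun t ht => ?_⟩
  have hn : 0 ≤ numIndices d m := Finset.sum_nonneg fun _ _ => Nat.cast_nonneg _
  filter_upwards [ae_sum_sqDeriv_le (B := fun _ => s) (h t ht)] with x hx
  refine hx.trans (le_of_eq ?_)
  rw [mul_pow, Real.sq_sqrt hn, numIndices, Finset.sum_mul]
  simp

lemma MemB.isWeakDeriv (h : MemB m T ψ) {t : ℝ} (ht : t ∈ Icc 0 T) {α : Fin d → ℕ}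
    (hα : order α ≤ m) : IsWeakDeriv α (ψ t) (weakDeriv α (ψ t)) := by
  obtain ⟨K, hK⟩ := h.derivs α hα
  obtain ⟨w, hw, -⟩ := hK t ht
  exact hw.weakDeriv

/-- The extension of a function on `[0,T]` to all times. -/
def extend (hT : 0 ≤ T) (ψ : ℝ → Space d → ℝ) (s : ℝ) : Space d → ℝ := ψ (projIcc 0 T hT s)

lemma extend_of_mem (hT : 0 ≤ T) {s : ℝ} (hs : s ∈ Icc 0 T) : extend hT ψ s = ψ s := by
  rw [extend, projIcc_of_mem hT hs]

lemma MemB.measurable_extend (h : MemB m T ψ) (hT : 0 ≤ T) :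
    Measurable fun z : ℝ × Space d => extend hT ψ z.1 z.2 :=
  h.measurable.comp (((continuous_projIcc (h := hT)).measurable.comp measurable_fst).prodMk
    measurable_snd)

lemma MemB.timeReg_extend (h : MemB m T ψ) (hT : 0 ≤ T) {K : ℝ} (hK : ∀ t ∈ Icc 0 T, ∀ α,
    order α ≤ m → ∀ᵐ x, |weakDeriv α (ψ t) x| ≤ K) : TimeReg m K (extend hT ψ) :=
  ⟨h.measurable_extend hT, fun s => ⟨h.continuous _ (projIcc 0 T hT s).2, fun α hα =>
    ⟨_, h.isWeakDeriv (projIcc 0 T hT s).2 hα, hK _ (projIcc 0 T hT s).2 α hα⟩⟩⟩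

lemma TimeReg.memB {K : ℝ} {m' : ℕ} (h : TimeReg m K ψ) (hm : m' ≤ m) : MemB m' T ψ :=
  ⟨h.measurable.comp ((measurable_subtype_coe.comp measurable_fst).prodMk measurable_snd),
    ⟨K, fun t _ x => (h.weakBdd t).abs_le x⟩, fun t _ => (h.weakBdd t).continuous,
    fun α hα => ⟨K, fun t _ => (h.weakBdd t).derivs α (hα.trans hm)⟩⟩

end

/-! ### The problem data of the theorem -/

section

variable {m : ℕ} {T : ℝ} {M : Fin (m + 1) → ℝ} {Λ : Finset (Space d)}
  {q p : Space d → ℝ → Space d → ℝ} {c f : ℝ → Space d → ℝ} {g : Space d → ℝ}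

/-- The data extended to all times, with the first order part written through `D_i`. -/
def problemData (hT : 0 ≤ T) (Λ : Finset (Space d)) (q p : Space d → ℝ → Space d → ℝ)
    (c f : ℝ → Space d → ℝ) (g : Space d → ℝ) : ProblemData d where
  Λ := Λ
  q := fun l => extend hT (q l)
  b := fun i s x => ∑ l ∈ Λ, l i * extend hT (p l) s x
  c := fun s x => -1 * extend hT c s x
  f := extend hT f
  g := g

/-- The constant bounding the coefficients. -/
def coeffBound (M : Fin (m + 1) → ℝ) (L : ℝ) : ℝ := (∑ k, |M k|) * (1 + |L|)

lemma abs_le_coeffBound (M : Fin (m + 1) → ℝ) (L : ℝ) (k : Fin (m + 1)) :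
    |M k| ≤ coeffBound M L ∧ |L| * |M k| ≤ coeffBound M L := by
  have h1 : |M k| ≤ ∑ k, |M k| := Finset.single_le_sum (f := fun k => |M k|)
    (fun _ _ => abs_nonneg _) (Finset.mem_univ k)
  have h2 := abs_nonneg L
  have h3 := abs_nonneg (M k)
  unfold coeffBound
  constructor <;> nlinarith

lemma Admissible.sum_sq_weakDeriv_le (h : Admissible m T M Λ q p c f g) {t : ℝ}
    (ht : t ∈ Icc 0 T) {α : Fin d → ℕ} (hα : order α ≤ m) :
    ∃ k : Fin (m + 1), ∀ᵐ x, ∑ l ∈ Λ, (weakDeriv α (q l t) x ^ 2 + weakDeriv α (p l t) x ^ 2) +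
      weakDeriv α (c t) x ^ 2 ≤ M k ^ 2 := by
  refine ⟨⟨order α, Nat.lt_succ_of_le hα⟩, ?_⟩
  filter_upwards [h.bound ⟨order α, Nat.lt_succ_of_le hα⟩ t ht] with x hx
  refine le_trans ?_ hx
  gcongr <;> exact sq_weakDeriv_le_sqDeriv α _ x

/-- The coefficient of `D_i` is `∑ l i * p l`. Cauchy–Schwarz over `Λ` bounds its derivatives of
order `k` by `dirNorm Λ * |M k|`, free of the number of elements of `Λ`; hence the factor `1 + |L|`
in `coeffBound`. -/
lemma Admissible.regular (h : Admissible m T M Λ q p c f g) (hT : 0 ≤ T) :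
    (problemData hT Λ q p c f g).Regular m (coeffBound M (dirNorm Λ)) (normB m T f)
      (normB m T fun _ => g) := by
  set K := coeffBound M (dirNorm Λ)
  have h0 : (0:ℝ) ∈ Icc 0 T := ⟨le_rfl, hT⟩
  refine ⟨fun l hl s x => h.q_nonneg l hl _ (projIcc 0 T hT s).2 x,
    fun l hl => (h.q_mem l hl).timeReg_extend hT fun t ht α hα => ?_, fun i => ⟨?_, fun s => ?_⟩,
    ⟨(h.c_mem.measurable_extend hT).const_mul (-1), fun s => ?_⟩,
    h.f_mem.timeReg_extend hT fun t ht α hα => h.f_mem.abs_weakDeriv_le ht hα, ?_⟩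
  · obtain ⟨k, hk⟩ := h.sum_sq_weakDeriv_le ht hα
    filter_upwards [hk] with x hx
    refine le_trans ?_ (abs_le_coeffBound M (dirNorm Λ) k).1
    refine sq_le_sq.1 (le_trans ?_ hx)
    have h1 := Finset.single_le_sum (s := Λ)
      (f := fun l => weakDeriv α (q l t) x ^ 2 + weakDeriv α (p l t) x ^ 2)
      (fun _ _ => by positivity) hl
    nlinarith [sq_nonneg (weakDeriv α (p l t) x), sq_nonneg (weakDeriv α (c t) x)]
  · exact Finset.measurable_fun_sum _ fun l hl =>
      ((h.p_mem l hl).measurable_extend hT).const_mul _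
  · set t := (projIcc 0 T hT s : ℝ) with ht_def
    have ht : t ∈ Icc 0 T := (projIcc 0 T hT s).2
    refine ⟨continuous_finsetSum _ fun l hl => ((h.p_mem l hl).continuous t ht).const_mul _,
      fun α hα => ⟨_, IsWeakDeriv.finset_sum Λ fun l hl =>
        ((h.p_mem l hl).isWeakDeriv ht hα).const_mul (l i), ?_⟩⟩
    obtain ⟨k, hk⟩ := h.sum_sq_weakDeriv_le ht hα
    filter_upwards [hk] with x hx
    refine le_trans ?_ (abs_le_coeffBound M (dirNorm Λ) k).2
    rw [← abs_mul]
    refine sq_le_sq.1 ((Finset.sum_mul_sq_le_sq_mul_sq Λ _ _).trans ?_)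
    rw [mul_pow]
    refine mul_le_mul ?_ ?_ (Finset.sum_nonneg fun _ _ => sq_nonneg _) (sq_nonneg _)
    · rw [dirNorm, Real.sq_sqrt (Finset.sum_nonneg fun _ _ => sq_nonneg _)]
      refine Finset.sum_le_sum fun l _ => ?_
      have := PiLp.norm_apply_le l i
      rw [← sq_abs]
      gcongr
      exact this
    · rw [Finset.sum_add_distrib] at hx
      have := Finset.sum_nonneg (s := Λ) fun l _ => sq_nonneg (weakDeriv α (q l t) x)
      linarith [sq_nonneg (weakDeriv α (c t) x)]
  · set t := (projIcc 0 T hT s : ℝ)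
    have ht : t ∈ Icc 0 T := (projIcc 0 T hT s).2
    refine ⟨(h.c_mem.continuous t ht).const_mul _, fun α hα =>
      ⟨_, (h.c_mem.isWeakDeriv ht hα).const_mul (-1), ?_⟩⟩
    obtain ⟨k, hk⟩ := h.sum_sq_weakDeriv_le ht hα
    filter_upwards [hk] with x hx
    refine le_trans ?_ (abs_le_coeffBound M (dirNorm Λ) k).1
    rw [neg_one_mul, abs_neg]
    refine sq_le_sq.1 (le_trans ?_ hx)
    have := Finset.sum_nonneg (s := Λ) (f := fun l => weakDeriv α (q l t) x ^ 2 +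
      weakDeriv α (p l t) x ^ 2) fun l _ => by positivity
    linarith
  · exact ⟨h.g_mem.continuous 0 h0, fun α hα => ⟨_, h.g_mem.isWeakDeriv h0 hα,
      h.g_mem.abs_weakDeriv_le h0 hα⟩⟩

lemma diffOp_problemData (hT : 0 ≤ T) {s : ℝ} (hs : s ∈ Icc 0 T) (v : Space d → ℝ) (x : Space d) :
    (problemData hT Λ q p c f g).diffOp s v x = diffPart Λ q p s v x := by
  simp only [ProblemData.diffOp, problemData, extend_of_mem hT hs, diffPart, secondDir,
    Finset.sum_add_distrib]
  congr 1
  · refine Finset.sum_congr rfl fun l _ => ?_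
    simp only [Finset.mul_sum]
    refine Finset.sum_congr rfl fun i _ => Finset.sum_congr rfl fun j _ => ?_
    ring
  · simp only [Finset.sum_mul]
    rw [Finset.sum_comm]
    refine Finset.sum_congr rfl fun l _ => Finset.sum_congr rfl fun i _ => ?_
    ring

/-- The equation in the definition of a solution is the equation for the extended data. -/
lemma equation_iff_solves (hT : 0 ≤ T) {u v : ℝ → Space d → ℝ} (huv : ∀ s ∈ Icc 0 T, u s = v s) :
    (∀ t ∈ Icc (0 : ℝ) T, ∀ φ : Space d → ℝ, IsTest φ →
      ∫ x, φ x * v t x = (∫ x, φ x * g x)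
        + (∫ s in (0 : ℝ)..t, ∫ x, φ x * (-(c s x * v s x) + f s x))
        + ∫ s in (0 : ℝ)..t, ∫ x, φ x * diffPart Λ q p s (v s) x) ↔
    (problemData hT Λ q p c f g).Solves T u := by
  refine forall₂_congr fun t ht => forall₂_congr fun φ _ => ?_
  have hmem : ∀ s ∈ uIcc 0 t, s ∈ Icc 0 T := fun s hs => by
    rw [uIcc_of_le ht.1] at hs
    exact ⟨hs.1, hs.2.trans ht.2⟩
  have e1 : ∫ s in (0 : ℝ)..t, ∫ x, φ x * (-(c s x * v s x) + f s x) =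
      ∫ s in (0:ℝ)..t, ∫ x, ((problemData hT Λ q p c f g).c s x * u s x +
        (problemData hT Λ q p c f g).f s x) * φ x := by
    refine intervalIntegral.integral_congr fun s hs => ?_
    refine integral_congr_ae (Eventually.of_forall fun x => ?_)
    simp only [problemData, extend_of_mem hT (hmem s hs), huv s (hmem s hs)]
    ring
  have e2 : ∫ s in (0 : ℝ)..t, ∫ x, φ x * diffPart Λ q p s (v s) x =
      ∫ s in (0:ℝ)..t, ∫ x, (problemData hT Λ q p c f g).diffOp s (u s) x * φ x := by
    refine intervalIntegral.integral_congr fun s hs => ?_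
    refine integral_congr_ae (Eventually.of_forall fun x => ?_)
    dsimp only
    rw [diffOp_problemData hT (hmem s hs), huv s (hmem s hs), mul_comm]
  rw [e1, e2, huv t ht]
  simp_rw [mul_comm (φ _)]
  rfl

lemma IsSolution.eq_of_solves {u v : ℝ → Space d → ℝ} {B : ℝ} (hm : 2 ≤ m)
    (h : Admissible m T M Λ q p c f g) (hT : 0 ≤ T) (hv : IsSolution T Λ q p c f g v)
    (hu : TimeReg 2 B u) (hs : (problemData hT Λ q p c f g).Solves T u) {t : ℝ}
    (ht : t ∈ Icc 0 T) (x : Space d) : v t x = u t x := by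
  have h1 : TimeReg 2 (normB 2 T v) (extend hT v) :=
    hv.mem.timeReg_extend hT fun t ht α hα => hv.mem.abs_weakDeriv_le ht hα
  have h2 : (problemData hT Λ q p c f g).Solves T (extend hT v) :=
    (equation_iff_solves hT fun s hs => extend_of_mem hT hs).1 hv.equation
  rw [← extend_of_mem (ψ := v) hT ht]
  exact (h.regular hT).solution_unique hm h1 hu h2 hs ht x

end

/-! ### The final constant and the proof of the theorem. -/

/-- The constant in the a priori estimate. -/
def aprioriConst (d m : ℕ) (K L2 T : ℝ) : ℝ :=
  Real.sqrt (Real.exp (growthRate d m K L2 * T) * ((words d m).card * (1 + 3 * T)))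

/-- Both `F ^ 2` and `G ^ 2` are at most `(F + G) ^ 2`, which makes the bound linear in the data. -/
lemma sqrt_energyBound_le (d m : ℕ) (K L2 : ℝ) {F G T : ℝ} (hT : 0 ≤ T) (hF : 0 ≤ F) (hG : 0 ≤ G) :
    Real.sqrt (energyBound d m K L2 F G T) ≤ aprioriConst d m K L2 T * (F + G) := by
  refine Real.sqrt_le_iff.2 ⟨mul_nonneg (Real.sqrt_nonneg _) (add_nonneg hF hG), ?_⟩
  rw [mul_pow, aprioriConst, Real.sq_sqrt (by positivity), energyBound, mul_assoc (Real.exp _)]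
  refine mul_le_mul_of_nonneg_left ?_ (Real.exp_nonneg _)
  have h1 : G ^ 2 ≤ (F + G) ^ 2 := by gcongr; linarith
  have h2 : F ^ 2 ≤ (F + G) ^ 2 := by gcongr; linarith
  calc _ ≤ ((words d m).card : ℝ) * (F + G) ^ 2 + T * (3 * (words d m).card) * (F + G) ^ 2 := by
        gcongr
    _ = _ := by ring

end DegenerateParabolic

end

theorem theorem08p11p2p1 (d m : ℕ) (hm : 2 ≤ m) (T : ℝ) (hT : 0 < T) (L : ℝ)
    (M : Fin (m + 1) → ℝ) :
    ∃ N : ℝ, ∀ (Λ : Finset (DegenerateParabolic.Space d))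
      (q p : DegenerateParabolic.Space d → ℝ → DegenerateParabolic.Space d → ℝ)
      (c f : ℝ → DegenerateParabolic.Space d → ℝ) (g : DegenerateParabolic.Space d → ℝ),
      DegenerateParabolic.dirNorm Λ = L →
      DegenerateParabolic.Admissible m T M Λ q p c f g →
      ∃ u : ℝ → DegenerateParabolic.Space d → ℝ,
        DegenerateParabolic.IsSolution T Λ q p c f g u ∧
        (∀ v : ℝ → DegenerateParabolic.Space d → ℝ,
          DegenerateParabolic.IsSolution T Λ q p c f g v →
          ∀ t ∈ Set.Icc (0 : ℝ) T, ∀ x, v t x = u t x) ∧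
        DegenerateParabolic.MemB m T u ∧
        DegenerateParabolic.normB m T u ≤
          N * (DegenerateParabolic.normB m T f +
            DegenerateParabolic.normB m T (fun _ => g)) := by
  open DegenerateParabolic in
  -- The root of the number of multi-indices appears because every derivative is bounded by the same
  -- number. The constant is built from `L` before `Λ` is given.
  refine ⟨Real.sqrt (numIndices d m) * aprioriConst d m (coeffBound M L) (L ^ 2) T,
    fun Λ q p c f g hL h => ?_⟩
  have hΛ : ∑ l ∈ Λ, ‖l‖ ^ 2 = L ^ 2 := by
    rw [← hL, dirNorm, Real.sq_sqrt (Finset.sum_nonneg fun _ _ => sq_nonneg _)]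
  have hr := h.regular hT.le
  rw [hL] at hr
  obtain ⟨u, hc, hu, hs⟩ := hr.exists_solves hm hT.le
  have hu2 : TimeReg 2 _ u :=
    ⟨hu.measurable, fun s => ⟨(hu.weakBdd s).continuous,
      fun α hα => (hu.weakBdd s).derivs α (hα.trans hm)⟩⟩
  refine ⟨u, ⟨hc.continuousOn, hu.memB hm, (equation_iff_solves hT.le fun _ _ => rfl).2 hs⟩,
    fun v hv t ht x => hv.eq_of_solves hm h hT.le hu2 hs ht x, hu.memB le_rfl, ?_⟩
  refine (normB_le (Real.sqrt_nonneg _) fun t _ α hα => (hu.weakBdd t).abs_weakDeriv_le hα).trans ?_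
  rw [mul_assoc]
  refine mul_le_mul_of_nonneg_left ?_ (Real.sqrt_nonneg _)
  change Real.sqrt (energyBound d m (coeffBound M L) (∑ l ∈ Λ, ‖l‖ ^ 2) _ _ T) ≤ _
  rw [hΛ]
  exact sqrt_energyBound_le d m _ _ hT.le normB_nonneg normB_nonneg
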